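/- Let $G=(V,E)$ be a simple undirected graph with $n=|V|$ vertices. Write $d(x)$ for the degree of $x$, $e(S,R)$ for the number of edges between $S$ and $R$, $\mu(S)=\sum_{x\in S}d(x)$, $\partial(S)=e(S,V\setminus S)$, and $\phi(S)=\partial(S)/\mu(S)$ (with $0/0=0$). Let $p(y,S)=\frac12\left(\frac{e(\{y\},S)}{d(y)}+\mathbf 1(y\in S)\right)$ be the probability that one step of the lazy random walk leads from $y$ into $S$. The evolving set process moves from $S$ to $\{y: p(y,S)\ge U\}$ with $U$ uniform on $[0,1]$; if $\mathbf K(S,S')$ is its transition kernel, the volume-biased evolving set process is the Markov chain with kernel $\widehat{\mathbf K}(S,S')=\frac{\mu(S')}{\mu(S)}\mathbf K(S,S')$. The algorithm $\mathtt{EvoCut}(v,\phi)$, for a start vertex $v$ and a target conductance $\phi\in(0,1)$, works as follows. Let $T=\lfloor \phi^{-1}/100\rfloor$. If $T=0$, output $\{v\}$. Otherwise let $\theta_T=\sqrt{4T^{-1}\log\mu(V)}$, start with $S=\{v\}$, $X=v$, and repeat until $\phi(S)<\theta_T$ or $T$ steps have been made, then output $S$: move $X$ by one step of the lazy random walk;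 draw $Z$ uniformly from $[0,p(X,S)]$; iterate over the vertices $y$ that lie in $S$ and have a neighbour outside $S$, or lie outside $S$ and have a neighbour in $S$, in order to find those on which $S$ and $\{y:p(y,S)\ge Z\}$ differ; add or remove these vertices, updating $\partial(S)$ and $\mu(S)$. The set $S$, and the numbers $e(\{y\},S)$ for the $y$ just described, are kept in two dictionaries, namely binary tries over the $\lceil\log_2 n\rceil$-digit binary names of the vertices. The number $\mu(V)$ is known to the algorithm, and the graph is accessed through queries only. The work $w$ of a run counts $d(x)+1$ for listing the neighbours of a vertex $x$, and $1$ for every query of a degree, every uniformly random neighbour of a vertex, every uniformly random number in $[0,1]$, every visit of a tree node and every other constant-time operation. Let $S$ be the output of a run. 1. (Simulation.) If $d(v)>0$, then $S$ has the distribution of $S_\tau$, where $(S_t)_{t\ge0}$ is the volume-biased evolving set process started from $S_0=\{v\}$ and $\tau$ is the first time $t$ with $\phi(S_t)<\theta_T$ or $t=T$ (so $\tau=0$ if $T=0$). 2. (Work/volume ratio.) There is an absolute constant $C$ such that, for every $G$, every $v$ with $d(v)>0$ and every $\phi\in(0,1)$, \[\mathbf E\left[\frac{w}{\mu(S)}\right]\le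 C\,\phi^{-1/2}\log^{3/2}n .\] 3. (Approximation guarantee.) There is an absolute constant $C$ such that, for every $G$, every $\phi\in(0,1)$ and every $A\subseteq V$ with $\phi(A)\le\phi$ and $\mu(A)\le\frac23\mu(V)$, there is a subset $A'\subseteq A$ with $\mu(A')\ge\frac12\mu(A)$ such that, for every start vertex $v\in A'$, with probability at least $1/2$ all of the following hold: (a) $\phi(S)\le C\,\phi^{1/2}\log^{1/2}n$; (b) $\mu(S)\le\frac34\mu(V)$; (c) $\mu(S\cap A)\ge\frac9{10}\mu(S)$. -/

import Mathlib

open MeasureTheory Finset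
open scoped ENNReal BigOperators

noncomputable section

namespace EvoCut

/-! ## Graphs: volume, boundary, conductance -/

section Graph

variable {V : Type} [Fintype V] [DecidableEq V]

/-- `e(S, R)`, the number of edges between `S` and `R`. It is only used when `S` is a singleton or
`S` and `R` are disjoint, so that no edge is counted twice. -/
def edges (G : SimpleGraph V) [DecidableRel G.Adj] (S R : Finset V) : ℕ :=
  (G.interedges S R).card

/-- The volume `μ(S)`, the sum of the degrees of the vertices of `S`. -/
def vol (G : SimpleGraph V) [DecidableRel G.Adj] (S : Finset V) : ℕ :=
  ∑ x ∈ S, G.degree x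

/-- `∂(S)`, the number of edges leaving `S`. -/
def boundary (G : SimpleGraph V) [DecidableRel G.Adj] (S : Finset V) : ℕ :=
  edges G S Sᶜ

/-- The conductance `φ(S) = ∂(S) / μ(S)`. -/
def conductance (G : SimpleGraph V) [DecidableRel G.Adj] (S : Finset V) : ℝ :=
  (boundary G S : ℝ) / (vol G S : ℝ)

/-! ## The evolving set process and its volume-biased version -/

/-- `p(y, S)`: the probability that one step of the lazy random walk goes from `y` into `S`. -/
def walkProb (G : SimpleGraph V) [DecidableRel G.Adj] (y : V) (S : Finset V) : ℝ :=
  ((edges G {y} S : ℝ) / (G.degree y : ℝ) + if y ∈ S then 1 else 0) / 2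

/-- The transition kernel `K(S, S')` of the evolving set process: the probability that
`{y | p(y, S) ≥ U} = S'` for `U` uniform on `[0, 1]`. -/
def espKernel (G : SimpleGraph V) [DecidableRel G.Adj] (S S' : Finset V) : ℝ≥0∞ :=
  volume {u : ℝ | u ∈ Set.Icc (0 : ℝ) 1 ∧ {y : V | u ≤ walkProb G y S} = (S' : Set V)}

/-- The transition kernel of the volume-biased evolving set process. -/
def biasedKernel (G : SimpleGraph V) [DecidableRel G.Adj] (S S' : Finset V) : ℝ≥0∞ :=
  (vol G S' : ℝ≥0∞) / (vol G S : ℝ≥0∞) * espKernel G S S'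

/-- The probability of the sample path `S₀, …, S_T` of the volume-biased evolving set process
started from `{v}`. -/
def pathProb (G : SimpleGraph V) [DecidableRel G.Adj] (v : V) {T : ℕ}
    (S : Fin (T + 1) → Finset V) : ℝ≥0∞ :=
  (if S 0 = {v} then 1 else 0) * ∏ i : Fin T, biasedKernel G (S i.castSucc) (S i.succ)

/-- The stopping time `τ` of a path `S₀, …, S_T`: the first `t` such that `φ(S_t) < θ` or
`t = T`. -/
def stopTime (G : SimpleGraph V) [DecidableRel G.Adj] (θ : ℝ) {T : ℕ}
    (S : Fin (T + 1) → Finset V) : Fin (T + 1) :=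
  (univ.filter (fun t : Fin (T + 1) => conductance G (S t) < θ ∨ t = Fin.last T)).min'
    ⟨Fin.last T, by simp⟩

/-- The probability that `S_τ = R` for the volume-biased evolving set process started
from `{v}`. -/
def stoppedProb (G : SimpleGraph V) [DecidableRel G.Adj] (v : V) (T : ℕ) (θ : ℝ)
    (R : Finset V) : ℝ≥0∞ :=
  ∑ S : Fin (T + 1) → Finset V, if S (stopTime G θ S) = R then pathProb G v S else 0

end Graph

/-- The time limit `T = ⌊φ⁻¹ / 100⌋`. -/
def timeLimit (φ : ℝ) : ℕ := ⌊φ⁻¹ / 100⌋₊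

/-- The conductance threshold `θ_T = √(4 T⁻¹ log μ(V))`. -/
def threshold (volV T : ℕ) : ℝ := Real.sqrt (4 * (T : ℝ)⁻¹ * Real.log (volV : ℝ))

/-! ## The machine model -/

/-- Randomized programs that access a graph on the vertex set `V` only through queries.
`tick` stands for one internal operation that takes constant time. -/
inductive Prog (V α : Type) : Type
  | ret (a : α) : Prog V α
  | tick (k : Prog V α) : Prog V α
  | queryNeighbors (x : V) (k : List V → Prog V α) : Prog V α
  | queryDegree (x : V) (k : ℕ → Prog V α) : Prog V α
  | sampleNeighbor (x : V) (k : V → Prog V α) : Prog V α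
  | sampleUnit (k : ℝ → Prog V α) : Prog V α

namespace Prog

/-- Run one program after the other. -/
def bind {V α β : Type} : Prog V α → (α → Prog V β) → Prog V β
  | ret a, f => f a
  | tick k, f => tick (bind k f)
  | queryNeighbors x k, f => queryNeighbors x (fun l => bind (k l) f)
  | queryDegree x k, f => queryDegree x (fun d => bind (k d) f)
  | sampleNeighbor x k, f => sampleNeighbor x (fun y => bind (k y) f)
  | sampleUnit k, f => sampleUnit (fun u => bind (k u) f)

instance (V : Type) : Monad (Prog V) where
  pure := ret
  bind := bind

/-- One internal operation. -/
def step {V : Type} : Prog V Unit := tick (ret ())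

/-- A list of the vertices adjacent to `x`. -/
def neighbors {V : Type} (x : V) : Prog V (List V) := queryNeighbors x ret

/-- The degree of `x`. -/
def degree {V : Type} (x : V) : Prog V ℕ := queryDegree x ret

/-- A uniformly random vertex among those adjacent to `x`. -/
def randomNeighbor {V : Type} (x : V) : Prog V V := sampleNeighbor x ret

/-- A uniformly random number in `[0, 1]`. -/
def randomUnit {V : Type} : Prog V ℝ := sampleUnit ret

variable {V : Type} [Fintype V] [DecidableEq V]

/-- The expected value of `f(a, w)` over the randomness of a run on the graph `G`, where `a` is
the output and `w` the work performed. Listing the neighbours of `x` costs `d(x) + 1`; every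
internal operation, every other query and every random draw costs `1`. All draws are
independent. -/
def expect {α : Type} (G : SimpleGraph V) [DecidableRel G.Adj] :
    Prog V α → (α → ℕ → ℝ≥0∞) → ℝ≥0∞
  | ret a, f => f a 0
  | tick k, f => expect G k (fun a w => f a (w + 1))
  | queryNeighbors x k, f =>
      expect G (k (G.neighborFinset x).toList) (fun a w => f a (w + (G.degree x + 1)))
  | queryDegree x k, f => expect G (k (G.degree x)) (fun a w => f a (w + 1))
  | sampleNeighbor x k, f =>
      (∑ y ∈ G.neighborFinset x, expect G (k y) (fun a w => f a (w + 1))) / (G.degree x : ℝ≥0∞)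
  | sampleUnit k, f => ∫⁻ u in Set.Icc (0 : ℝ) 1, expect G (k u) (fun a w => f a (w + 1))

/-- The probability that the output of a run on the graph `G` satisfies `P`. -/
def prob {α : Type} (G : SimpleGraph V) [DecidableRel G.Adj] (p : Prog V α) (P : α → Prop) :
    ℝ≥0∞ :=
  expect G p (fun a _ => Set.indicator {a | P a} 1 a)

end Prog

/-! ## Dictionaries

A dictionary whose keys are natural numbers below `2 ^ L` is a binary tree in which the path to an
entry is given by the `L` binary digits of its key; subtrees without entries are pruned. Each
function below performs one internal operation per tree node that it visits. -/

inductive Trie (α : Type) : Type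
  | empty : Trie α
  | leaf (a : α) : Trie α
  | node (l r : Trie α) : Trie α

namespace Trie

def left {α : Type} : Trie α → Trie α
  | node l _ => l
  | _ => empty

def right {α : Type} : Trie α → Trie α
  | node _ r => r
  | _ => empty

def join {α : Type} : Trie α → Trie α → Trie α
  | empty, empty => empty
  | l, r => node l r

def ofOption {α : Type} : Option α → Trie α
  | none => empty
  | some a => leaf a

/-- The entry with key `k`, if there is one. -/
def lookup {V α : Type} : Trie α → ℕ → Prog V (Option α)
  | empty, _ => do
      Prog.step
      return none
  | leaf a, _ => do
      Prog.step
      return some a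
  | node l r, k => do
      Prog.step
      if k % 2 = 0 then lookup l (k / 2) else lookup r (k / 2)

/-- Insert or overwrite (`some a`), or delete (`none`), the entry with key `k < 2 ^ L`. -/
def write {V α : Type} : ℕ → Trie α → ℕ → Option α → Prog V (Trie α)
  | 0, _, _, a => do
      Prog.step
      return ofOption a
  | L + 1, t, k, a => do
      Prog.step
      if k % 2 = 0 then
        let l ← write L t.left (k / 2) a
        return join l t.right
      else
        let r ← write L t.right (k / 2) a
        return join t.left r

/-- Iterate over the entries, and put them in front of the list `acc`. -/
def toList {V α : Type} : Trie α → List α → Prog V (List α)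
  | empty, acc => do
      Prog.step
      return acc
  | leaf a, acc => do
      Prog.step
      return a :: acc
  | node l r, acc => do
      Prog.step
      let acc' ← toList r acc
      toList l acc'

end Trie

/-! ## The set-with-boundary data structure

The vertices are the numbers below `n` and serve as keys of `⌈log₂ n⌉` binary digits. -/

section Algorithm

variable {n : ℕ}

/-- The membership dictionary holds the vertices of `S`. -/
abbrev Members (n : ℕ) : Type := Trie (Fin n)

/-- The boundary dictionary holds the vertices `y` of the two-sided vertex boundary `δ(S)` (the
vertices of `S` with a neighbour outside and the vertices outside with a neighbour in `S`),
each with the number `e(y, S)`. -/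
abbrev Border (n : ℕ) : Type := Trie (Fin n × ℕ)

/-- Is `y ∈ S`? -/
def isMember (M : Members n) (y : Fin n) : Prog (Fin n) Bool := do
  let o ← M.lookup y
  return o.isSome

/-- Compute `e(y, S)`. -/
def edgesInto (M : Members n) (B : Border n) (y : Fin n) : Prog (Fin n) ℕ := do
  match ← B.lookup y with
  | some (_, e) => return e
  | none =>
      match ← M.lookup y with
      | some _ => Prog.degree y
      | none => return 0

/-- Compute `p(y, S)`. -/
def computeWalkProb (M : Members n) (B : Border n) (y : Fin n) : Prog (Fin n) ℝ := do
  let e ← edgesInto M B y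
  let i ← isMember M y
  let d ← Prog.degree y
  Prog.step
  return ((e : ℝ) / (d : ℝ) + if i then 1 else 0) / 2

/-- Update the entry of `z` in the boundary dictionary, given the current value `e = e(z, S)` and
the truth value `i` of `z ∈ S`. -/
def writeBorder (B : Border n) (z : Fin n) (e : ℕ) (i : Bool) : Prog (Fin n) (Border n) := do
  let d ← Prog.degree z
  Prog.step
  if (if i then e < d else 0 < e) then
    Trie.write (Nat.clog 2 n) B z (some (z, e))
  else
    Trie.write (Nat.clog 2 n) B z none

/-- Increment (or, if `removed`, decrement) `e(z, S)` for each `z` in a list. -/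
def updateNeighbors (M : Members n) (removed : Bool) :
    List (Fin n) → Border n → Prog (Fin n) (Border n)
  | [], B => do
      Prog.step
      return B
  | z :: zs, B => do
      Prog.step
      let e ← edgesInto M B z
      let i ← isMember M z
      let B' ← writeBorder B z (if removed then e - 1 else e + 1) i
      updateNeighbors M removed zs B'

/-- The internal state: the current set `S` (two dictionaries), the numbers `∂(S)` and `μ(S)`,
and the position of the random walk particle. -/
structure State (n : ℕ) where
  members : Members n
  border : Border n
  cut : ℕ
  size : ℕ
  pos : Fin n

/-- Add `y` to `S` if `y ∉ S`, and remove it if `y ∈ S`. -/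
def toggle (s : State n) (y : Fin n) : Prog (Fin n) (State n) := do
  let i ← isMember s.members y
  let e ← edgesInto s.members s.border y
  let d ← Prog.degree y
  let M ← Trie.write (Nat.clog 2 n) s.members y (if i then none else some y)
  let B ← writeBorder s.border y e (!i)
  let zs ← Prog.neighbors y
  let B' ← updateNeighbors M i zs B
  Prog.step
  return {
    members := M
    border := B'
    cut := if i then s.cut + 2 * e - d else s.cut + d - 2 * e
    size := if i then s.size - d else s.size + d
    pos := s.pos }

def toggleAll : List (Fin n) → State n → Prog (Fin n) (State n)
  | [], s => do
      Prog.step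
      return s
  | y :: ys, s => do
      Prog.step
      let s' ← toggle s y
      toggleAll ys s'

/-! ## The algorithm -/

/-- Among the listed vertices of `δ(S)`, those in the symmetric difference of `S` and
`{y | p(y, S) ≥ Z}`. -/
def selectChanges (s : State n) (Z : ℝ) : List (Fin n × ℕ) → Prog (Fin n) (List (Fin n))
  | [] => do
      Prog.step
      return []
  | y :: ys => do
      Prog.step
      let i ← isMember s.members y.1
      let p ← computeWalkProb s.members s.border y.1
      let D ← selectChanges s Z ys
      Prog.step
      if (if i then p < Z else Z ≤ p) then return y.1 :: D else return D

/-- One step of the simulation: move the lazy walk particle from `X` to `x`, choose a threshold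
`Z` uniformly from `[0, p(x, S)]`, and replace `S` by `{y | p(y, S) ≥ Z}`. -/
def simulateStep (s : State n) : Prog (Fin n) (State n) := do
  let c ← Prog.randomUnit
  Prog.step
  let x ← if c < 1 / 2 then Prog.randomNeighbor s.pos else pure s.pos
  let p ← computeWalkProb s.members s.border x
  let u ← Prog.randomUnit
  let Z := u * p
  Prog.step
  let δ ← Trie.toList s.border []
  let D ← selectChanges s Z δ
  let s' ← toggleAll D s
  return { s' with pos := x }

/-- Simulate until `φ(S) < θ` or until the given number of steps has been made, then output the
list of the vertices of `S`. -/
def simulate (θ : ℝ) : ℕ → State n → Prog (Fin n) (List (Fin n))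
  | 0, s => do
      Prog.step
      Trie.toList s.members []
  | r + 1, s => do
      Prog.step
      if (s.cut : ℝ) / (s.size : ℝ) < θ then
        Trie.toList s.members []
      else
        let s' ← simulateStep s
        simulate θ r s'

/-- `GenerateSample(v, T, ∞)`, where the threshold `θ_T` is computed from the given total volume
`volV` of the graph. -/
def generateSample (volV : ℕ) (v : Fin n) (T : ℕ) : Prog (Fin n) (List (Fin n)) := do
  Prog.step
  let s ← toggle { members := Trie.empty, border := Trie.empty, cut := 0, size := 0, pos := v } v
  simulate (threshold volV T) T s

/-- `EvoCut(v, φ)` for a graph with vertices `0, …, n - 1` and total volume `volV`. -/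
def evoCut (volV : ℕ) (v : Fin n) (φ : ℝ) : Prog (Fin n) (List (Fin n)) := do
  Prog.step
  if timeLimit φ = 0 then return [v] else generateSample volV v (timeLimit φ)

end Algorithm

end EvoCut

end

/-!
The proof rests on three facts about the evolving set process with kernel `K`, where `S'` denotes
the set that follows `S` and `p(y, S)` the probability that the lazy walk leads from `y` into `S`.

*Intertwining* (`sum_degree_mul_jointStep`). If the walk particle is distributed proportionally to
the degrees on `S`, then moving it and drawing `Z` uniformly from `[0, p(X, S)]` produces a step of
the volume-biased process, together with a particle distributed proportionally to the degrees on
the new set. The reason is that reversibility gives the particle at `y` the weight `d(y) p(y, S)`,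
and a uniform `Z` in `[0, p(y, S)]` is a uniform number in `[0, 1]` conditioned on `y ∈ S'`. Hence
the pair of set and particle, stopped by the rule of the algorithm (`jointVal`), averages to the
stopped volume-biased process (`stopVal`). The latter is a recursive form of the sum over paths
(`sum_path_eq_stopVal`), which gives the simulation claim as soon as the data structure is known to
represent the current set (`Rep`, `det_toggle`, `exists_expect_simulateStep`).

*Growth* (`sum_biasedKernel_mul_rpow_le`). The volume of `S'` has mean `(1 + φ(S)) μ(S)` for
thresholds below `1/2` and mean `(1 - φ(S)) μ(S)` for thresholds above, so that concavity of
`x ↦ x ^ (2 / 3)` bounds the mean of `(μ(S') / μ(S)) ^ (-1/3)` under the volume-biased kernel by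
`1 - φ(S)² / 9`. Two consequences are used. First, `log μ(S)` has drift at least `φ(S)² / 3`, so
that the expected sum of `φ(S_t)²` before `τ` is `O(log μ(V))`. Secondly,
`μ(S_t) ^ (-1/3) exp (∑ φ² / 9)` is a supermartingale, so that a run of which all conductances are
at least `θ_T` has probability at most `μ(V) ^ (1/3) exp (-T θ_T² / 9) = μ(V) ^ (-1/9)`. The exponent
`1/3` in place of the usual `1/2` is what makes this power negative. For bounded `μ(V)`, where this
is not small, positive conductances are bounded below, and either `T` is so large that the same
supermartingale settles the matter, or `φ` is so large that the claimed bound is trivial.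

*Cost of a step* (`sum_espKernel_mul_vol_symmDiff`). Multiplied by `μ(S_0)`, the mean of the work
over `μ(S_τ)` is the mean of the work under the unbiased process, restricted to nonempty sets. There
a step costs `O(∂(S) log n)`, because the expected volume of the symmetric difference of `S` and
`S'` is `∂(S)`. Returning to the biased process, this is the mean of `∑ φ(S_t)`, and the
inequality `φ ≤ t φ² + 1 / (4 t)` reduces it to the drift of `log μ`.

For the last claim, the intertwining also shows that the expected fraction of the volume of `S_τ`
that lies outside `A` is the probability that the particle ends outside `A`, hence at most the
probability `escape` that the walk leaves `A` within `T` steps. Its mean over the stationary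
distribution on `A` is at most `T φ(A) ≤ 1/100`, and Markov's inequality yields the set
`goodStarts`. The bound on `μ(S)` follows from the overlap with `A`.
-/

set_option linter.unusedSectionVars false

namespace EvoCut

/-! ### Runs of programs -/

namespace Prog

variable {V : Type} [Fintype V] {α β : Type} (G : SimpleGraph V) [DecidableRel G.Adj]

theorem expect_bind (p : Prog V α) (q : α → Prog V β) (f : β → ℕ → ℝ≥0∞) :
    expect G (p >>= q) f =
      expect G p (fun a w => expect G (q a) (fun b w' => f b (w + w'))) := by
  change expect G (p.bind q) f = _
  induction p generalizing f with
  | ret a => simp [Prog.bind, expect]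
  | tick k ih => simp only [Prog.bind, expect, ih, add_right_comm]
  | queryNeighbors x k ih => simp only [Prog.bind, expect, ih, add_right_comm]
  | queryDegree x k ih => simp only [Prog.bind, expect, ih, add_right_comm]
  | sampleNeighbor x k ih => simp only [Prog.bind, expect, ih, add_right_comm]
  | sampleUnit k ih => simp only [Prog.bind, expect, ih, add_right_comm]

theorem expect_pure (a : α) (f : α → ℕ → ℝ≥0∞) : expect G (pure a) f = f a 0 := rfl

theorem expect_mono (p : Prog V α) {f g : α → ℕ → ℝ≥0∞} (h : ∀ a w, f a w ≤ g a w) :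
    expect G p f ≤ expect G p g := by
  induction p generalizing f g with
  | ret a => exact h _ _
  | tick k ih => exact ih fun a w => h _ _
  | queryNeighbors x k ih => exact ih _ fun a w => h _ _
  | queryDegree x k ih => exact ih _ fun a w => h _ _
  | sampleNeighbor x k ih =>
      simp only [expect]
      gcongr with y hy
      exact ih _ fun a w => h _ _
  | sampleUnit k ih =>
      simp only [expect]
      exact lintegral_mono fun u => ih _ fun a w => h _ _

/-- The run of `p` on `G` involves no randomness: it outputs `a`, with work at most `b`. -/
def Det (p : Prog V α) (a : α) (b : ℕ) : Prop :=
  ∃ w ≤ b, ∀ f : α → ℕ → ℝ≥0∞, expect G p f = f a w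

variable {G}

theorem Det.mono {p : Prog V α} {a : α} {b c : ℕ} (h : Det G p a b) (hbc : b ≤ c) :
    Det G p a c := by
  obtain ⟨w, hw, h⟩ := h
  exact ⟨w, hw.trans hbc, h⟩

theorem Det.pure (a : α) : Det G (Pure.pure a : Prog V α) a 0 := ⟨0, le_rfl, fun _ => rfl⟩

theorem Det.bind {p : Prog V α} {q : α → Prog V β} {a : α} {a' : β} {b b' c : ℕ}
    (h : Det G p a b) (h' : Det G (q a) a' b') (hc : b + b' ≤ c) : Det G (p >>= q) a' c := by
  obtain ⟨w, hw, h⟩ := h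
  obtain ⟨w', hw', h'⟩ := h'
  exact ⟨w + w', by omega, fun f => by rw [expect_bind, h, h']⟩

theorem Det.step : Det G (Prog.step : Prog V Unit) () 1 := ⟨1, le_rfl, fun _ => rfl⟩

theorem Det.degree (x : V) : Det G (Prog.degree x) (G.degree x) 1 := ⟨1, le_rfl, fun _ => rfl⟩

theorem Det.neighbors (x : V) :
    Det G (Prog.neighbors x) (G.neighborFinset x).toList (G.degree x + 1) :=
  ⟨G.degree x + 1, le_rfl, fun f => by simp [Prog.neighbors, expect]⟩

end Prog

/-! ### Tries -/

namespace Trie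

open Prog

variable {V : Type} [Fintype V] {α : Type} {G : SimpleGraph V} [DecidableRel G.Adj]

/-- All entries sit at depth `L`, and every inner node has an entry below it. -/
def Good : ℕ → Trie α → Prop
  | _, empty => True
  | 0, leaf _ => True
  | _ + 1, leaf _ => False
  | 0, node _ _ => False
  | L + 1, node l r => Good L l ∧ Good L r ∧ (l ≠ empty ∨ r ≠ empty)

/-- The entry with key `k`. -/
def get : Trie α → ℕ → Option α
  | empty, _ => none
  | leaf a, _ => some a
  | node l r, k => if k % 2 = 0 then get l (k / 2) else get r (k / 2)

/-- The list of the entries, in the order in which `toList` produces it. -/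
def entries : Trie α → List α
  | empty => []
  | leaf a => [a]
  | node l r => entries l ++ entries r

theorem det_lookup {L : ℕ} {t : Trie α} (ht : Good L t) (k : ℕ) :
    Det G (lookup t k : Prog V (Option α)) (t.get k) (L + 1) := by
  induction t generalizing L k with
  | empty => exact Det.step.bind (Det.pure _) (by omega)
  | leaf a => exact Det.step.bind (Det.pure _) (by omega)
  | node l r ihl ihr =>
      cases L with
      | zero => exact ht.elim
      | succ L =>
          rw [lookup, get]
          refine Det.step.bind (b' := L + 1) ?_ (by omega)
          split_ifs
          · exact ihl ht.1 _
          · exact ihr ht.2.1 _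

theorem good_left {L : ℕ} {t : Trie α} (ht : Good (L + 1) t) : Good L t.left := by
  cases t with
  | empty => simp [left, Good]
  | leaf a => exact ht.elim
  | node l r => exact ht.1

theorem good_right {L : ℕ} {t : Trie α} (ht : Good (L + 1) t) : Good L t.right := by
  cases t with
  | empty => simp [right, Good]
  | leaf a => exact ht.elim
  | node l r => exact ht.2.1

theorem get_eq_left_right {L : ℕ} {t : Trie α} (ht : Good (L + 1) t) (k : ℕ) :
    t.get k = if k % 2 = 0 then t.left.get (k / 2) else t.right.get (k / 2) := by
  cases t with
  | empty => simp [left, right, get]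
  | leaf a => exact ht.elim
  | node l r => rfl

theorem good_join {L : ℕ} {l r : Trie α} (hl : Good L l) (hr : Good L r) :
    Good (L + 1) (join l r) := by
  cases l <;> cases r <;> simp_all [join, Good]

theorem get_join (l r : Trie α) (k : ℕ) :
    (join l r).get k = if k % 2 = 0 then l.get (k / 2) else r.get (k / 2) := by
  cases l <;> cases r <;> simp [join, get]

theorem det_write {L : ℕ} {t : Trie α} (ht : Good L t) {k : ℕ} (hk : k < 2 ^ L) (a : Option α) :
    ∃ t' : Trie α, Det G (write L t k a : Prog V (Trie α)) t' (L + 1) ∧ Good L t' ∧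
      ∀ j < 2 ^ L, t'.get j = if j = k then a else t.get j := by
  induction L generalizing t k with
  | zero =>
      refine ⟨ofOption a, Det.step.bind (Det.pure _) (by omega), ?_, ?_⟩
      · cases a <;> simp [ofOption, Good]
      · intro j hj
        have : j = k := by simp at hk hj; omega
        cases a <;> simp [ofOption, get, this]
  | succ L ih =>
      have hk2 : k / 2 < 2 ^ L := by rw [pow_succ] at hk; omega
      by_cases h0 : k % 2 = 0
      · obtain ⟨l, h1, h2, h3⟩ := ih (good_left ht) hk2
        refine ⟨join l t.right, ?_, good_join h2 (good_right ht), ?_⟩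
        · rw [write]
          simp only [h0, if_true]
          exact Det.step.bind (h1.bind (Det.pure _) le_rfl) (by omega)
        · intro j hj
          have hj2 : j / 2 < 2 ^ L := by rw [pow_succ] at hj; omega
          rw [get_join, get_eq_left_right ht, h3 _ hj2]
          by_cases hj0 : j % 2 = 0
          · have : j / 2 = k / 2 ↔ j = k := by omega
            simp [hj0, this]
          · have : j ≠ k := by rintro rfl; exact hj0 h0
            simp [hj0, this]
      · obtain ⟨l, h1, h2, h3⟩ := ih (good_right ht) hk2
        refine ⟨join t.left l, ?_, good_join (good_left ht) h2, ?_⟩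
        · rw [write]
          simp only [h0, if_false]
          exact Det.step.bind (h1.bind (Det.pure _) le_rfl) (by omega)
        · intro j hj
          have hj2 : j / 2 < 2 ^ L := by rw [pow_succ] at hj; omega
          rw [get_join, get_eq_left_right ht, h3 _ hj2]
          by_cases hj0 : j % 2 = 0
          · have : j ≠ k := by rintro rfl; exact h0 hj0
            simp [hj0, this]
          · have : j / 2 = k / 2 ↔ j = k := by omega
            simp [hj0, this]

/-- Since subtrees without entries are pruned, a nonempty trie has an entry. This bounds the number
of nodes that `toList` visits in terms of the number of entries. -/
theorem entries_pos {L : ℕ} {t : Trie α} (ht : Good L t) (h : t ≠ empty) :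
    0 < (entries t).length := by
  induction t generalizing L with
  | empty => exact (h rfl).elim
  | leaf a => simp [entries]
  | node l r ihl ihr =>
      cases L with
      | zero => exact ht.elim
      | succ L =>
          rw [entries, List.length_append]
          rcases ht.2.2 with h | h
          · have := ihl ht.1 h; omega
          · have := ihr ht.2.1 h; omega

theorem det_toList {L : ℕ} {t : Trie α} (ht : Good L t) (acc : List α) :
    Det G (toList t acc : Prog V (List α)) (entries t ++ acc)
      ((2 * L + 1) * (entries t).length + 1) := by
  induction t generalizing L acc with
  | empty => exact Det.step.bind (Det.pure _) (by omega)
  | leaf a => exact Det.step.bind (Det.pure _) (by omega)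
  | node l r ihl ihr =>
      have hpos := entries_pos ht (by simp)
      cases L with
      | zero => exact ht.elim
      | succ L =>
          rw [toList]
          rw [entries, List.append_assoc]
          refine Det.step.bind ((ihr ht.2.1 acc).bind (ihl ht.1 (entries r ++ acc)) le_rfl) ?_
          rw [entries, List.length_append] at hpos
          rw [List.length_append]
          nlinarith

theorem mem_entries {L : ℕ} {t : Trie α} (ht : Good L t) (a : α) :
    a ∈ entries t ↔ ∃ k < 2 ^ L, t.get k = some a := by
  induction t generalizing L with
  | empty => simp [entries, get]
  | leaf b =>
      simp only [entries, get, List.mem_singleton, Option.some.injEq]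
      exact ⟨fun h => ⟨0, by positivity, h.symm⟩, fun ⟨_, _, h⟩ => h.symm⟩
  | node l r ihl ihr =>
      cases L with
      | zero => exact ht.elim
      | succ L =>
          rw [entries, List.mem_append, ihl ht.1, ihr ht.2.1]
          constructor
          · rintro (⟨k, hk, h⟩ | ⟨k, hk, h⟩)
            · exact ⟨2 * k, by rw [pow_succ]; omega, by simpa [get] using h⟩
            · refine ⟨2 * k + 1, by rw [pow_succ]; omega, ?_⟩
              have h1 : (2 * k + 1) % 2 ≠ 0 := by omega
              have h2 : (2 * k + 1) / 2 = k := by omega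
              rw [get, if_neg h1, h2, h]
          · rintro ⟨k, hk, h⟩
            have hk2 : k / 2 < 2 ^ L := by rw [pow_succ] at hk; omega
            rw [get] at h
            split_ifs at h
            · exact Or.inl ⟨_, hk2, h⟩
            · exact Or.inr ⟨_, hk2, h⟩

theorem nodup_entries {L : ℕ} {t : Trie α} (ht : Good L t) (key : α → ℕ)
    (hkey : ∀ k < 2 ^ L, ∀ a, t.get k = some a → key a = k) : (entries t).Nodup := by
  induction t generalizing L key with
  | empty => simp [entries]
  | leaf b => simp [entries]
  | node l r ihl ihr =>
      cases L with
      | zero => exact ht.elim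
      | succ L =>
          have hl : ∀ k < 2 ^ L, ∀ a, l.get k = some a → key a = 2 * k := fun k hk a h =>
            hkey (2 * k) (by rw [pow_succ]; omega) a (by simpa [get] using h)
          have hr : ∀ k < 2 ^ L, ∀ a, r.get k = some a → key a = 2 * k + 1 := fun k hk a h =>
            hkey (2 * k + 1) (by rw [pow_succ]; omega) a (by
              have h1 : (2 * k + 1) % 2 ≠ 0 := by omega
              have h2 : (2 * k + 1) / 2 = k := by omega
              rw [get, if_neg h1, h2, h])
          rw [entries, List.nodup_append]
          refine ⟨ihl ht.1 (fun a => key a / 2) fun k hk a h => by rw [hl k hk a h]; omega,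
            ihr ht.2.1 (fun a => key a / 2) fun k hk a h => by rw [hr k hk a h]; omega, ?_⟩
          rintro a ha b hb rfl
          obtain ⟨k, hk, h⟩ := (mem_entries ht.1 a).1 ha
          obtain ⟨k', hk', h'⟩ := (mem_entries ht.2.1 a).1 hb
          have := hl k hk a h
          have := hr k' hk' a h'
          omega

end Trie

/-! ### Counting edges -/

section Edges

variable {V : Type} [Fintype V] [DecidableEq V] (G : SimpleGraph V) [DecidableRel G.Adj]

theorem edges_singleton (y : V) (S : Finset V) :
    edges G {y} S = ((G.neighborFinset y).filter (· ∈ S)).card := by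
  rw [edges, SimpleGraph.interedges_def]
  refine card_nbij' (fun e => e.2) (fun z => (y, z)) ?_ ?_ ?_ ?_
  · intro e he
    simp only [coe_filter, mem_product, mem_singleton, Set.mem_ofPred_eq] at he
    simp only [coe_filter, SimpleGraph.mem_neighborFinset, Set.mem_ofPred_eq]
    exact ⟨he.1.1 ▸ he.2, he.1.2⟩
  · intro z hz
    simp only [coe_filter, SimpleGraph.mem_neighborFinset, Set.mem_ofPred_eq] at hz
    simp only [coe_filter, mem_product, mem_singleton, Set.mem_ofPred_eq]
    exact ⟨⟨trivial, hz.2⟩, hz.1⟩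
  · intro e he
    simp only [coe_filter, mem_product, mem_singleton, Set.mem_ofPred_eq] at he
    exact Prod.ext he.1.1.symm rfl
  · intro z _; rfl

theorem edges_eq_sum (S R : Finset V) :
    edges G S R = ∑ x ∈ S, ∑ y ∈ R, if G.Adj x y then 1 else 0 := by
  rw [edges, SimpleGraph.interedges_def, card_filter, sum_product]

theorem edges_eq_sum_left (S R : Finset V) : edges G S R = ∑ x ∈ S, edges G {x} R := by
  simp [edges_eq_sum]

theorem edges_comm (S R : Finset V) : edges G S R = edges G R S := by
  rw [edges_eq_sum, edges_eq_sum, sum_comm]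
  simp_rw [G.adj_comm]

theorem edges_insert_left {S : Finset V} {y : V} (hy : y ∉ S) (R : Finset V) :
    edges G (insert y S) R = edges G {y} R + edges G S R := by
  rw [edges_eq_sum_left, sum_insert hy, ← edges_eq_sum_left]

theorem edges_insert_right {S : Finset V} {y : V} (hy : y ∉ S) (R : Finset V) :
    edges G R (insert y S) = edges G R {y} + edges G R S := by
  rw [edges_comm, edges_insert_left G hy, edges_comm, edges_comm G S]

theorem edges_add_compl (y : V) (S : Finset V) :
    edges G {y} S + edges G {y} Sᶜ = G.degree y := by
  rw [edges_singleton, edges_singleton, ← SimpleGraph.card_neighborFinset_eq_degree]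
  simp only [mem_compl]
  exact card_filter_add_card_filter_not _

theorem edges_le_degree (y : V) (S : Finset V) : edges G {y} S ≤ G.degree y := by
  have := edges_add_compl G y S; omega

theorem edges_singleton_singleton (z y : V) :
    edges G {z} {y} = if G.Adj z y then 1 else 0 := by
  rw [edges_eq_sum, sum_singleton, sum_singleton]

theorem boundary_eq_sum (S : Finset V) : boundary G S = ∑ y ∈ S, edges G {y} Sᶜ :=
  edges_eq_sum_left G S _

theorem boundary_eq_sum_compl (S : Finset V) : boundary G S = ∑ y ∈ Sᶜ, edges G {y} S := by
  rw [boundary, edges_comm, edges_eq_sum_left]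

theorem boundary_le_vol (S : Finset V) : boundary G S ≤ vol G S := by
  rw [boundary_eq_sum]
  exact sum_le_sum fun y _ => edges_le_degree G y _

theorem vol_mono {S R : Finset V} (h : S ⊆ R) : vol G S ≤ vol G R :=
  sum_le_sum_of_subset h

theorem boundary_insert {S : Finset V} {y : V} (hy : y ∉ S) :
    boundary G (insert y S) + 2 * edges G {y} S = boundary G S + G.degree y := by
  have hS : Sᶜ = insert y (insert y S)ᶜ := by 
    ext z
    by_cases hz : z = y
    · simp [hz, hy]
    · simp [hz]
  have h1 := edges_insert_left G hy (insert y S)ᶜ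
  have h2 : edges G S Sᶜ = edges G S {y} + edges G S (insert y S)ᶜ := by
    conv_lhs => rw [hS]
    exact edges_insert_right G (by simp) S
  have h3 := edges_add_compl G y (insert y S)
  rw [edges_insert_right G hy, edges_singleton_singleton, if_neg (G.loopless.irrefl y)] at h3
  rw [edges_comm G S {y}] at h2
  unfold boundary
  omega

end Edges

/-! ### The set-with-boundary data structure -/

section DataStructure

open Prog
open scoped symmDiff

variable {n : ℕ} (G : SimpleGraph (Fin n)) [DecidableRel G.Adj]

theorem val_lt_two_pow_clog (y : Fin n) : (y : ℕ) < 2 ^ Nat.clog 2 n :=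
  y.2.trans_le (Nat.le_pow_clog (by norm_num) n)

/-- `y` belongs to the two-sided boundary of `S` if `e y` is its number of neighbours in `S`. -/
def OnBorder (S : Finset (Fin n)) (e : Fin n → ℕ) (y : Fin n) : Prop :=
  (y ∈ S ∧ e y < G.degree y) ∨ (y ∉ S ∧ 0 < e y)

/-- The dictionary `M` holds the vertices of `S`. -/
structure RepMembers (S : Finset (Fin n)) (M : Members n) : Prop where
  good : Trie.Good (Nat.clog 2 n) M
  get : ∀ k < 2 ^ Nat.clog 2 n, ∀ a, M.get k = some a ↔ (a : ℕ) = k ∧ a ∈ S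

/-- The dictionary `B` holds the pairs `(y, e y)` for which `OnBorder G S e y`. In the middle of an
update, `e` is not the function `y ↦ e(y, S)`. -/
structure RepBorder (S : Finset (Fin n)) (e : Fin n → ℕ) (B : Border n) : Prop where
  good : Trie.Good (Nat.clog 2 n) B
  get : ∀ k < 2 ^ Nat.clog 2 n, ∀ a, B.get k = some a ↔
    (a.1 : ℕ) = k ∧ a.2 = e a.1 ∧ OnBorder G S e a.1

/-- The state `s` is the correct representation of the set `S`. -/
structure Rep (S : Finset (Fin n)) (s : State n) : Prop where
  members : RepMembers S s.members
  border : RepBorder G S (fun y => edges G {y} S) s.border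
  cut : s.cut = boundary G S
  size : s.size = vol G S

variable {G} {S : Finset (Fin n)} {M : Members n} {B : Border n} {e : Fin n → ℕ}

theorem RepMembers.isSome (h : RepMembers S M) (y : Fin n) :
    (M.get y).isSome = decide (y ∈ S) := by
  have := h.get y (val_lt_two_pow_clog y)
  rw [Bool.eq_iff_iff, Option.isSome_iff_exists, decide_eq_true_iff]
  constructor
  · rintro ⟨a, ha⟩
    obtain ⟨h1, h2⟩ := (this a).1 ha
    rwa [← Fin.ext h1]
  · exact fun hy => ⟨y, (this y).2 ⟨rfl, hy⟩⟩

theorem det_isMember (h : RepMembers S M) (y : Fin n) :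
    Det G (isMember M y) (decide (y ∈ S)) (Nat.clog 2 n + 1) := by
  rw [← h.isSome]
  exact (Trie.det_lookup h.good y).bind (Det.pure _) le_rfl

/-- A vertex without an entry in the boundary dictionary has all or none of its neighbours in `S`,
according to whether it belongs to `S`, so that `e(y, S)` can always be computed. -/
theorem det_edgesInto (h : RepMembers S M) (hB : RepBorder G S e B) {y : Fin n} (he : e y ≤ G.degree y) :
    Det G (edgesInto M B y) (e y) (2 * (Nat.clog 2 n + 1) + 1) := by
  have hg := hB.get y (val_lt_two_pow_clog y)
  have hsome := h.isSome y
  refine (Trie.det_lookup hB.good y).bind (b' := Nat.clog 2 n + 2) ?_ (by omega)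
  rcases hb : B.get y with _ | a
  · have hno : ¬ OnBorder G S e y := fun ho => by
      have := (hg (y, e y)).2 ⟨rfl, rfl, ho⟩
      rw [hb] at this
      cases this
    refine (Trie.det_lookup h.good y).bind (b' := 1) ?_ (by omega)
    by_cases hy : y ∈ S
    · rw [decide_eq_true hy, Option.isSome_iff_exists] at hsome
      obtain ⟨a, ha⟩ := hsome
      have : e y = G.degree y := by
        by_contra hne
        exact hno (Or.inl ⟨hy, by omega⟩)
      rw [ha, this]
      exact Det.degree y
    · rw [decide_eq_false hy, Option.isSome_eq_false_iff, Option.isNone_iff_eq_none] at hsome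
      have : e y = 0 := by
        by_contra hne
        exact hno (Or.inr ⟨hy, by omega⟩)
      rw [hsome, this]
      exact (Det.pure _).mono (by omega)
  · obtain ⟨h1, h2, -⟩ := (hg a).1 hb
    obtain ⟨a1, a2⟩ := a
    obtain rfl : a1 = y := Fin.ext h1
    obtain rfl : a2 = e a1 := h2
    exact (Det.pure _).mono (by omega)

theorem det_computeWalkProb {s : State n} (h : Rep G S s) (y : Fin n) :
    Det G (computeWalkProb s.members s.border y) (walkProb G y S) (3 * (Nat.clog 2 n + 1) + 3) := by
  have hdef : walkProb G y S = (((edges G {y} S : ℕ) : ℝ) / ((G.degree y : ℕ) : ℝ) +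
      if decide (y ∈ S) = true then 1 else 0) / 2 := by simp [walkProb]
  rw [hdef]
  exact (det_edgesInto h.members h.border (edges_le_degree G y S)).bind
    ((det_isMember h.members y).bind ((Det.degree y).bind (Det.step.bind (Det.pure _) le_rfl)
      le_rfl) le_rfl) (by omega)

/-- Overwriting the entry of `z`. The membership of `z` may change at the same time. -/
theorem det_writeBorder (hB : RepBorder G S e B) (z : Fin n) (c : ℕ) (S' : Finset (Fin n))
    (hS : ∀ y, y ≠ z → (y ∈ S' ↔ y ∈ S)) :
    ∃ B', Det G (writeBorder B z c (decide (z ∈ S'))) B' (Nat.clog 2 n + 3) ∧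
      RepBorder G S' (Function.update e z c) B' := by
  have hne : ∀ y, y ≠ z → (OnBorder G S' (Function.update e z c) y ↔ OnBorder G S e y) := by
    intro y hy
    simp [OnBorder, Function.update_of_ne hy, hS y hy]
  have hz : OnBorder G S' (Function.update e z c) z ↔
      (if z ∈ S' then c < G.degree z else 0 < c) := by
    simp only [OnBorder, Function.update_self]
    split_ifs with h <;> simp [h]
  have key : ∀ (v : Option (Fin n × ℕ)),
      (∀ a, v = some a ↔ a.1 = z ∧ a.2 = c ∧ OnBorder G S' (Function.update e z c) z) →
      ∃ B', Det G (Trie.write (Nat.clog 2 n) B z v : Prog (Fin n) _) B' (Nat.clog 2 n + 1) ∧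
        RepBorder G S' (Function.update e z c) B' := by
    intro v hv
    obtain ⟨B', h1, h2, h3⟩ := Trie.det_write (G := G) hB.good (val_lt_two_pow_clog z) v
    refine ⟨B', h1, h2, fun k hk a => ?_⟩
    rw [h3 k hk]
    split_ifs with hkz
    · rw [hv]
      constructor
      · rintro ⟨h, h', h''⟩
        refine ⟨by rw [h, hkz], by rw [h', h, Function.update_self], by rwa [h]⟩
      · rintro ⟨h, h', h''⟩
        obtain h : a.1 = z := Fin.ext (h.trans hkz)
        rw [h] at h' h''
        exact ⟨h, by rwa [Function.update_self] at h', h''⟩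
    · rw [hB.get k hk]
      constructor
      · rintro ⟨h, h', h''⟩
        have hna : a.1 ≠ z := fun ha => hkz (by rw [← h, ha])
        exact ⟨h, by rwa [Function.update_of_ne hna], (hne _ hna).2 h''⟩
      · rintro ⟨h, h', h''⟩
        have hna : a.1 ≠ z := fun ha => hkz (by rw [← h, ha])
        exact ⟨h, by rwa [Function.update_of_ne hna] at h', (hne _ hna).1 h''⟩
  have hdet : ∀ {B'}, Det G (if (if decide (z ∈ S') = true then c < G.degree z else 0 < c) then
        Trie.write (Nat.clog 2 n) B z (some (z, c))
      else Trie.write (Nat.clog 2 n) B z none : Prog (Fin n) (Border n)) B' (Nat.clog 2 n + 1) →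
      Det G (writeBorder B z c (decide (z ∈ S'))) B' (Nat.clog 2 n + 3) := fun h =>
    (Det.degree z).bind (Det.step.bind h le_rfl) (by omega)
  by_cases ho : OnBorder G S' (Function.update e z c) z
  · obtain ⟨B', h1, h2⟩ := key (some (z, c)) fun a => by
      simp only [Option.some.injEq, ho, and_true]
      rw [Prod.ext_iff]
      exact ⟨fun h => ⟨h.1.symm, h.2.symm⟩, fun h => ⟨h.1.symm, h.2.symm⟩⟩
    refine ⟨B', hdet ?_, h2⟩
    rw [hz] at ho
    rw [if_pos (by simpa using ho)]
    exact h1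
  · obtain ⟨B', h1, h2⟩ := key none fun a => by simp [ho]
    refine ⟨B', hdet ?_, h2⟩
    rw [hz] at ho
    rw [if_neg (by simpa using ho)]
    exact h1

/-- The list does not contain a vertex twice, so that each entry changes by one. -/
theorem det_updateNeighbors (hM : RepMembers S M) (removed : Bool)
    (zs : List (Fin n)) (hzs : zs.Nodup) (hB : RepBorder G S e B)
    (he : ∀ z ∈ zs, e z ≤ G.degree z) :
    ∃ B', Det G (updateNeighbors M removed zs B) B' (8 * (Nat.clog 2 n + 1) * zs.length + 1) ∧
      RepBorder G S
        (fun z => if z ∈ zs then (if removed then e z - 1 else e z + 1) else e z) B' := by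
  induction zs generalizing e B with
  | nil => exact ⟨B, Det.step.bind (Det.pure _) le_rfl, by simpa using hB⟩
  | cons z zs ih =>
      obtain ⟨hz, hnd⟩ := List.nodup_cons.1 hzs
      obtain ⟨B₁, h1, h2⟩ := det_writeBorder hB z (if removed then e z - 1 else e z + 1) S
        fun _ _ => Iff.rfl
      have hne : ∀ y ∈ zs, y ≠ z := fun y hy h => hz (h ▸ hy)
      obtain ⟨B₂, h3, h4⟩ := ih hnd h2 fun y hy => by
        rw [Function.update_of_ne (hne y hy)]
        exact he y (by simp [hy])
      refine ⟨B₂, ?_, ?_⟩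
      · rw [updateNeighbors]
        refine Det.step.bind ((det_edgesInto hM hB (he z (by simp))).bind
          ((det_isMember hM z).bind (Det.bind (a := B₁) (b := Nat.clog 2 n + 3) ?_ h3 le_rfl) le_rfl)
            le_rfl) ?_
        · exact h1
        · rw [List.length_cons]
          nlinarith
      · convert h4 using 1
        funext y
        by_cases hy : y = z
        · subst hy; simp [hz]
        · simp [hy]

theorem symmDiff_singleton_of_mem {y : Fin n} (hy : y ∈ S) : S ∆ {y} = S.erase y := by
  ext x
  by_cases hx : x = y
  · subst hx; simp [mem_symmDiff, hy]
  · simp [mem_symmDiff, hx]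

theorem symmDiff_singleton_of_notMem {y : Fin n} (hy : y ∉ S) : S ∆ {y} = insert y S := by
  ext x
  by_cases hx : x = y
  · subst hx; simp [mem_symmDiff, hy]
  · simp [mem_symmDiff, hx]

theorem edges_symmDiff (S : Finset (Fin n)) (y z : Fin n) :
    edges G {z} (S ∆ {y}) =
      if G.Adj y z then (if y ∈ S then edges G {z} S - 1 else edges G {z} S + 1)
      else edges G {z} S := by
  by_cases hy : y ∈ S
  · have h1 := symmDiff_singleton_of_mem hy
    have h2 := edges_insert_right G (notMem_erase y S) {z}
    rw [insert_erase hy, edges_singleton_singleton] at h2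
    simp only [G.adj_comm z y] at h2
    rw [h1, if_pos hy]
    split_ifs at h2 ⊢ <;> omega
  · have h1 := symmDiff_singleton_of_notMem hy
    have h2 := edges_insert_right G hy {z}
    rw [edges_singleton_singleton] at h2
    simp only [G.adj_comm z y] at h2
    rw [h1, if_neg hy]
    split_ifs at h2 ⊢ <;> omega

theorem det_toggle {s : State n} (h : Rep G S s) (y : Fin n) :
    ∃ s', Det G (toggle s y) s' (25 * (Nat.clog 2 n + 1) * (G.degree y + 1)) ∧
      Rep G (S ∆ {y}) s' ∧ s'.pos = s.pos := by
  have hmem : ∀ z, z ≠ y → (z ∈ S ∆ {y} ↔ z ∈ S) := fun z hz => by simp [mem_symmDiff, hz]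
  have hmemy : y ∈ S ∆ {y} ↔ y ∉ S := by simp [mem_symmDiff]
  obtain ⟨M', hM1, hM2, hM3⟩ := Trie.det_write (G := G) h.members.good (val_lt_two_pow_clog y)
    (if decide (y ∈ S) = true then none else some y)
  obtain ⟨B₁, hB1, hB2⟩ := det_writeBorder h.border y (edges G {y} S) (S ∆ {y}) hmem
  rw [Function.update_eq_self] at hB2
  have hbool : decide (y ∈ S ∆ {y}) = !decide (y ∈ S) := by
    rw [decide_eq_decide.2 hmemy, decide_not]
  rw [hbool] at hB1
  have hM : RepMembers (S ∆ {y}) M' := by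
    refine ⟨hM2, fun k hk a => ?_⟩
    rw [hM3 k hk]
    split_ifs with hky hyS
    · simp only [false_iff, not_and]
      intro ha
      obtain rfl : a = y := Fin.ext (ha.trans hky)
      rw [hmemy]
      simpa using hyS
    · simp only [Option.some.injEq]
      constructor
      · rintro rfl
        exact ⟨hky.symm, hmemy.2 (by simpa using hyS)⟩
      · rintro ⟨ha, -⟩
        exact (Fin.ext (ha.trans hky)).symm
    · rw [h.members.get k hk]
      refine and_congr_right fun ha => (hmem a ?_).symm
      rintro rfl
      exact hky ha.symm
  obtain ⟨B₂, hB3, hB4⟩ := det_updateNeighbors hM (decide (y ∈ S))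
    (G.neighborFinset y).toList (nodup_toList _) hB2
    (fun z _ => edges_le_degree G z S)
  refine ⟨_, (det_isMember h.members y).bind
    ((det_edgesInto h.members h.border (edges_le_degree G y S)).bind
    ((Det.degree y).bind (hM1.bind (hB1.bind ((Det.neighbors y).bind (hB3.bind
      (Det.step.bind (Det.pure _) le_rfl) le_rfl) le_rfl) le_rfl) le_rfl) le_rfl) le_rfl) ?_,
      ⟨hM, ?_, ?_, ?_⟩, ?_⟩
  · rw [length_toList, SimpleGraph.card_neighborFinset_eq_degree]
    nlinarith [Nat.zero_le (Nat.clog 2 n * G.degree y)]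
  · convert hB4 using 1
    funext z
    rw [edges_symmDiff]
    simp
  · simp only [h.cut]
    by_cases hy : y ∈ S
    · have h1 := symmDiff_singleton_of_mem hy
      have h2 := boundary_insert G (notMem_erase y S)
      rw [insert_erase hy, ← h1, edges_symmDiff, if_neg (G.loopless.irrefl y)] at h2
      simp only [hy, decide_true, if_true]
      omega
    · have h1 := symmDiff_singleton_of_notMem hy
      have h2 := boundary_insert G hy
      simp only [hy, decide_false, h1, Bool.false_eq_true, if_false]
      omega
  · simp only [h.size]
    by_cases hy : y ∈ S
    · have h1 := symmDiff_singleton_of_mem hy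
      have h2 : G.degree y + vol G (S.erase y) = vol G S := add_sum_erase S (fun x => G.degree x) hy
      simp only [hy, decide_true, if_true, h1]
      omega
    · have h1 := symmDiff_singleton_of_notMem hy
      have h2 : vol G (insert y S) = G.degree y + vol G S := sum_insert hy
      simp only [hy, decide_false, h1, Bool.false_eq_true, if_false, h2]
      omega
  · rfl

theorem det_toggleAll (D : List (Fin n)) (hD : D.Nodup) {s : State n} (h : Rep G S s) :
    ∃ s', Det G (toggleAll D s) s'
        (26 * (Nat.clog 2 n + 1) * (D.map fun y => G.degree y + 1).sum + 1) ∧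
      Rep G (S ∆ D.toFinset) s' ∧ s'.pos = s.pos := by
  induction D generalizing S s with
  | nil => exact ⟨s, Det.step.bind (Det.pure _) le_rfl, by
      rw [List.toFinset_nil, ← bot_eq_empty, symmDiff_bot]; exact h, rfl⟩
  | cons y D ih =>
      obtain ⟨hy, hnd⟩ := List.nodup_cons.1 hD
      obtain ⟨s₁, h1, h2, h3⟩ := det_toggle h y
      obtain ⟨s₂, h4, h5, h6⟩ := ih hnd h2
      refine ⟨s₂, ?_, ?_, h6.trans h3⟩
      · rw [toggleAll]
        refine Det.step.bind (h1.bind h4 le_rfl) ?_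
        rw [List.map_cons, List.sum_cons]
        nlinarith [Nat.zero_le (Nat.clog 2 n * G.degree y)]
      · convert h5 using 1
        rw [symmDiff_assoc, List.toFinset_cons]
        congr 1
        ext x
        simp only [mem_insert, mem_symmDiff, mem_singleton, List.mem_toFinset]
        constructor
        · rintro (rfl | hx)
          · exact Or.inl ⟨rfl, hy⟩
          · exact Or.inr ⟨hx, fun h => hy (h ▸ hx)⟩
        · rintro (hx | hx)
          · exact Or.inl hx.1
          · exact Or.inr hx.1

theorem det_selectChanges {s : State n} (h : Rep G S s) (Z : ℝ) (δ : List (Fin n × ℕ)) :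
    Det G (selectChanges s Z δ)
      ((δ.filter fun y => ¬ (y.1 ∈ S ↔ Z ≤ walkProb G y.1 S)).map
        Prod.fst)
      (9 * (Nat.clog 2 n + 1) * δ.length + 1) := by
  induction δ with
  | nil => exact Det.step.bind (Det.pure _) le_rfl
  | cons y δ ih =>
      rw [selectChanges]
      refine Det.step.bind ((det_isMember h.members y.1).bind ((det_computeWalkProb h y.1).bind
        (ih.bind (Det.step.bind (b' := 0) ?_ le_rfl) le_rfl) le_rfl) le_rfl) ?_
      · rw [List.filter_cons]
        by_cases hy : y.1 ∈ S <;> by_cases hZ : Z ≤ walkProb G y.1 S <;>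
          simp only [hy, hZ, not_lt.2, lt_of_not_ge, not_false_eq_true, decide_true, decide_false,
            if_true, if_false, Bool.false_eq_true, iff_true, iff_false, not_true] <;>
          exact Det.pure _
      · rw [List.length_cons]
        nlinarith

end DataStructure

/-! ### The evolving set process -/

section EvolvingSets

open scoped symmDiff

variable {V : Type} [Fintype V] [DecidableEq V] (G : SimpleGraph V) [DecidableRel G.Adj]

theorem walkProb_nonneg (y : V) (S : Finset V) : 0 ≤ walkProb G y S := by
  unfold walkProb; positivity

theorem edges_div_degree_le_one (y : V) (S : Finset V) :
    (edges G {y} S : ℝ) / (G.degree y : ℝ) ≤ 1 :=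
  div_le_one_of_le₀ (by exact_mod_cast edges_le_degree G y S) (by positivity)

theorem walkProb_le_one (y : V) (S : Finset V) : walkProb G y S ≤ 1 := by
  have := edges_div_degree_le_one G y S
  unfold walkProb
  split_ifs <;> linarith

theorem half_le_walkProb {y : V} {S : Finset V} (hy : y ∈ S) : 1 / 2 ≤ walkProb G y S := by
  have : 0 ≤ (edges G {y} S : ℝ) / (G.degree y : ℝ) := by positivity
  rw [walkProb, if_pos hy]; linarith

theorem walkProb_le_half {y : V} {S : Finset V} (hy : y ∉ S) : walkProb G y S ≤ 1 / 2 := by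
  have := edges_div_degree_le_one G y S
  rw [walkProb, if_neg hy]; linarith

theorem degree_mul_walkProb (y : V) (S : Finset V) :
    (G.degree y : ℝ) * walkProb G y S =
      ((edges G {y} S : ℝ) + if y ∈ S then (G.degree y : ℝ) else 0) / 2 := by
  have h : (G.degree y : ℝ) * ((edges G {y} S : ℝ) / (G.degree y : ℝ)) = edges G {y} S := by
    rcases Nat.eq_zero_or_pos (G.degree y) with h0 | h0
    · have := edges_le_degree G y S
      have : edges G {y} S = 0 := by omega
      simp [this, h0]
    · field_simp
  rw [walkProb, mul_div_assoc', mul_add, h]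
  split_ifs <;> simp

theorem edges_pos_of_walkProb_pos {y : V} {S : Finset V} (hy : y ∉ S)
    (h : 0 < walkProb G y S) : 0 < edges G {y} S := by
  by_contra h0
  have h0 : edges G {y} S = 0 := by omega
  simp [walkProb, h0, hy] at h

theorem walkProb_pos_of_edges_pos {y : V} {S : Finset V} (h : 0 < edges G {y} S) :
    0 < walkProb G y S := by
  have h1 : 0 < (G.degree y : ℝ) := by exact_mod_cast h.trans_le (edges_le_degree G y S)
  have h2 : 0 < (edges G {y} S : ℝ) := by exact_mod_cast h
  unfold walkProb
  split_ifs <;> positivity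

theorem walkProb_pos_of_mem {y : V} {S : Finset V} (hy : y ∈ S) : 0 < walkProb G y S := by
  linarith [half_le_walkProb G hy]

theorem edges_lt_degree_of_walkProb_lt_one {y : V} {S : Finset V} (hy : y ∈ S)
    (hd : 0 < G.degree y) (h : walkProb G y S < 1) : edges G {y} S < G.degree y := by
  by_contra h0
  have h0 : edges G {y} S = G.degree y := le_antisymm (edges_le_degree G y S) (by omega)
  have : (G.degree y : ℝ) ≠ 0 := by positivity
  rw [walkProb, h0, div_self this, if_pos hy] at h
  norm_num at h

/-- The set `{y | p(y, S) ≥ u}` to which the evolving set process moves from `S`. -/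
noncomputable def levelSet (S : Finset V) (u : ℝ) : Finset V := univ.filter fun y => u ≤ walkProb G y S

@[simp] theorem mem_levelSet {S : Finset V} {u : ℝ} {y : V} :
    y ∈ levelSet G S u ↔ u ≤ walkProb G y S := by simp [levelSet]

theorem degree_pos_of_mem_levelSet {S : Finset V} (hS : ∀ y ∈ S, 0 < G.degree y) {u : ℝ}
    (hu : 0 < u) {y : V} (hy : y ∈ levelSet G S u) : 0 < G.degree y := by
  by_cases h : y ∈ S
  · exact hS y h
  · have := edges_pos_of_walkProb_pos G h (hu.trans_le ((mem_levelSet G).1 hy))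
    exact this.trans_le (edges_le_degree G y S)

theorem measurableSet_levelSet_eq (S S' : Finset V) :
    MeasurableSet {u : ℝ | levelSet G S u = S'} := by
  have : {u : ℝ | levelSet G S u = S'} = ⋂ y : V, {u : ℝ | u ≤ walkProb G y S ↔ y ∈ S'} := by
    ext u; simp [Finset.ext_iff]
  rw [this]
  refine MeasurableSet.iInter fun y => ?_
  by_cases hy : y ∈ S'
  · simp only [hy, iff_true]; exact measurableSet_Iic
  · simp only [hy, iff_false]; exact measurableSet_Iic.compl

theorem levelSet_eq_sum_indicator (S : Finset V) (H : Finset V → ℝ≥0∞) (u : ℝ) :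
    H (levelSet G S u) =
      ∑ S' : Finset V, Set.indicator {u : ℝ | levelSet G S u = S'} (fun _ => H S') u := by
  simp [Set.indicator_apply]

theorem measurable_levelSet (S : Finset V) (H : Finset V → ℝ≥0∞) :
    Measurable fun u => H (levelSet G S u) := by
  simp_rw [levelSet_eq_sum_indicator G S H]
  exact Finset.measurable_sum _ fun S' _ =>
    measurable_const.indicator (measurableSet_levelSet_eq G S S')

theorem sum_espKernel_mul (S : Finset V) (H : Finset V → ℝ≥0∞) :
    ∑ S' : Finset V, espKernel G S S' * H S' = ∫⁻ u in Set.Icc (0 : ℝ) 1, H (levelSet G S u) := by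
  simp_rw [levelSet_eq_sum_indicator G S H]
  rw [lintegral_finsetSum _ fun S' _ =>
    measurable_const.indicator (measurableSet_levelSet_eq G S S')]
  refine sum_congr rfl fun S' _ => ?_
  rw [lintegral_indicator_const (measurableSet_levelSet_eq G S S'),
    Measure.restrict_apply (measurableSet_levelSet_eq G S S'), mul_comm, espKernel]
  congr 2
  ext u
  simp only [Set.mem_ofPred_eq, Set.mem_inter_iff, Set.ext_iff, Finset.ext_iff, mem_levelSet,
    Finset.mem_coe]
  tauto

theorem degree_pos_of_espKernel_ne_zero {S S' : Finset V} (hS : ∀ y ∈ S, 0 < G.degree y)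
    (h : espKernel G S S' ≠ 0) : ∀ y ∈ S', 0 < G.degree y := by
  intro y hy
  by_contra hd
  refine h (measure_mono_null (t := {0}) ?_ (by simp))
  rintro u ⟨hu, hu'⟩
  by_contra hne
  have hpos : 0 < u := lt_of_le_of_ne hu.1 (Ne.symm hne)
  have : y ∈ levelSet G S u := by
    rw [mem_levelSet]
    have : y ∈ (S' : Set V) := hy
    rwa [← hu'] at this
  exact hd (degree_pos_of_mem_levelSet G hS hpos this)

/-- Rescaling the threshold: conditionally on `y` lying in the next set, the threshold is uniform
on `[0, p(y, S)]`. -/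
theorem ofReal_walkProb_mul_lintegral (S : Finset V) (y : V) (H : Finset V → ℝ≥0∞) :
    ENNReal.ofReal (walkProb G y S) *
        ∫⁻ u in Set.Icc (0 : ℝ) 1, H (levelSet G S (u * walkProb G y S)) =
      ∫⁻ u in Set.Icc (0 : ℝ) 1, if y ∈ levelSet G S u then H (levelSet G S u) else 0 := by
  set p := walkProb G y S with hp
  have hp0 : 0 ≤ p := walkProb_nonneg G y S
  have hp1 : p ≤ 1 := walkProb_le_one G y S
  have hR : ∫⁻ u in Set.Icc (0 : ℝ) 1, (if y ∈ levelSet G S u then H (levelSet G S u) else 0) =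
      ∫⁻ u, (Set.Icc (0 : ℝ) p).indicator (fun u => H (levelSet G S u)) u := by
    rw [← lintegral_indicator measurableSet_Icc]
    refine lintegral_congr fun u => ?_
    simp only [Set.indicator_apply, Set.mem_Icc, mem_levelSet, ← hp]
    by_cases h0 : 0 ≤ u <;> by_cases h1 : u ≤ p
    · simp [h0, h1, h1.trans hp1]
    · simp [h1]
    · simp [h0]
    · simp [h0]
  rw [hR]
  rcases hp0.eq_or_lt with h0 | h0
  · rw [← h0, ENNReal.ofReal_zero, zero_mul, lintegral_indicator measurableSet_Icc]
    simp
  · have hmeas : Measurable ((Set.Icc (0 : ℝ) p).indicator fun u => H (levelSet G S u)) :=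
      (measurable_levelSet G S H).indicator measurableSet_Icc
    conv_rhs => rw [← Real.smul_map_volume_mul_right h0.ne']
    rw [lintegral_smul_measure, lintegral_map hmeas (measurable_mul_const p), abs_of_pos h0,
      smul_eq_mul, ← lintegral_indicator measurableSet_Icc]
    congr 1
    refine lintegral_congr fun u => ?_
    simp only [Set.indicator_apply, Set.mem_Icc]
    have h1 : 0 ≤ u * p ↔ 0 ≤ u := mul_nonneg_iff_of_pos_right h0
    have h2 : u * p ≤ p ↔ u ≤ 1 := mul_le_iff_le_one_left h0
    simp only [h1, h2]

/-- One step of the joint chain of the set and the lazy walk particle: the expected value of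
`H S' x'` if the particle moves from `x` to `x'`, the threshold `Z` is uniform on `[0, p(x', S)]`,
and `S' = {y | p(y, S) ≥ Z}`. -/
noncomputable def jointStep (S : Finset V) (x : V) (H : Finset V → V → ℝ≥0∞) : ℝ≥0∞ :=
  ((∑ y ∈ G.neighborFinset x,
      ∫⁻ u in Set.Icc (0 : ℝ) 1, H (levelSet G S (u * walkProb G y S)) y) / (G.degree x : ℝ≥0∞) +
    ∫⁻ u in Set.Icc (0 : ℝ) 1, H (levelSet G S (u * walkProb G x S)) x) / 2

variable {G}

theorem jointStep_mono {S : Finset V} {x : V} {H H' : Finset V → V → ℝ≥0∞}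
    (h : ∀ S' x', H S' x' ≤ H' S' x') : jointStep G S x H ≤ jointStep G S x H' := by
  unfold jointStep
  gcongr <;> exact h _ _

theorem degree_mul_ofReal_walkProb (y : V) (S : Finset V) :
    (G.degree y : ℝ≥0∞) * ENNReal.ofReal (walkProb G y S) =
      ((edges G {y} S : ℝ≥0∞) + if y ∈ S then (G.degree y : ℝ≥0∞) else 0) / 2 := by
  rw [← ENNReal.ofReal_natCast (G.degree y), ← ENNReal.ofReal_mul (by positivity),
    degree_mul_walkProb, ENNReal.ofReal_div_of_pos (by norm_num),
    ENNReal.ofReal_add (by positivity) (by positivity), ENNReal.ofReal_natCast]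
  split_ifs <;> simp

/-- Intertwining of the joint chain with the evolving set process: if the particle is distributed
proportionally to the degrees on the current set `S`, then the pair after one step is distributed
as a step of the volume-biased process together with a particle distributed proportionally to the
degrees on the new set. Both sides are multiplied by `μ(S)`, so that no division occurs. -/
theorem sum_degree_mul_jointStep (S : Finset V) (H : Finset V → V → ℝ≥0∞) :
    ∑ x ∈ S, (G.degree x : ℝ≥0∞) * jointStep G S x H =
      ∑ S' : Finset V, espKernel G S S' * ∑ x ∈ S', (G.degree x : ℝ≥0∞) * H S' x := by
  set I : V → ℝ≥0∞ := fun y => ∫⁻ u in Set.Icc (0 : ℝ) 1, H (levelSet G S (u * walkProb G y S)) y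
    with hI
  have h1 : ∀ x ∈ S, (G.degree x : ℝ≥0∞) * jointStep G S x H =
      (∑ y, (if G.Adj x y then I y else 0) + (G.degree x : ℝ≥0∞) * I x) / 2 := by
    intro x _
    have hs : ∑ y ∈ G.neighborFinset x, I y = ∑ y, if G.Adj x y then I y else 0 := by
      rw [← sum_filter]
      exact sum_congr (by ext y; simp) fun _ _ => rfl
    rw [jointStep, ← mul_div_assoc, mul_add]
    change ((G.degree x : ℝ≥0∞) * ((∑ y ∈ G.neighborFinset x, I y) / _) + _ * I x) / 2 = _
    congr 2
    rcases Nat.eq_zero_or_pos (G.degree x) with h0 | h0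
    · have he : G.neighborFinset x = ∅ := by
        rw [← card_eq_zero, SimpleGraph.card_neighborFinset_eq_degree, h0]
      rw [← hs, he, sum_empty, ENNReal.zero_div, mul_zero]
    · rw [hs, ENNReal.mul_div_cancel (by exact_mod_cast h0.ne') (ENNReal.natCast_ne_top _)]
  have h2 : ∀ y, ∑ x ∈ S, (if G.Adj x y then I y else 0) = (edges G {y} S : ℝ≥0∞) * I y := by
    intro y
    rw [edges_eq_sum, sum_singleton, Nat.cast_sum, sum_mul]
    refine sum_congr rfl fun x _ => ?_
    by_cases h : G.Adj x y
    · simp [h, h.symm]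
    · have h' : ¬ G.Adj y x := fun h' => h h'.symm
      simp [h, h']
  calc ∑ x ∈ S, (G.degree x : ℝ≥0∞) * jointStep G S x H
      = (∑ x ∈ S, (∑ y, (if G.Adj x y then I y else 0) + (G.degree x : ℝ≥0∞) * I x)) / 2 := by
        rw [sum_congr rfl h1]
        simp only [div_eq_mul_inv, sum_mul]
    _ = (∑ y, (edges G {y} S : ℝ≥0∞) * I y +
          ∑ y, (if y ∈ S then (G.degree y : ℝ≥0∞) else 0) * I y) / 2 := by
        rw [sum_add_distrib, sum_comm, sum_congr rfl fun y _ => h2 y]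
        congr 2
        simp only [ite_mul, zero_mul, sum_ite_mem, univ_inter]
    _ = ∑ y, (G.degree y : ℝ≥0∞) * (ENNReal.ofReal (walkProb G y S) * I y) := by
        rw [← sum_add_distrib, div_eq_mul_inv, sum_mul]
        refine sum_congr rfl fun y _ => ?_
        rw [← mul_assoc, degree_mul_ofReal_walkProb, ← add_mul, div_eq_mul_inv, mul_right_comm]
    _ = ∑ y, ∫⁻ u in Set.Icc (0 : ℝ) 1,
          (G.degree y : ℝ≥0∞) * if y ∈ levelSet G S u then H (levelSet G S u) y else 0 := by
        refine sum_congr rfl fun y _ => ?_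
        rw [hI, ofReal_walkProb_mul_lintegral G S y fun S' => H S' y]
        exact (lintegral_const_mul _
          (measurable_levelSet G S fun S' => if y ∈ S' then H S' y else 0)).symm
    _ = ∫⁻ u in Set.Icc (0 : ℝ) 1,
          ∑ x ∈ levelSet G S u, (G.degree x : ℝ≥0∞) * H (levelSet G S u) x := by
        rw [← lintegral_finsetSum _ fun y _ => measurable_levelSet G S fun S' =>
          (G.degree y : ℝ≥0∞) * if y ∈ S' then H S' y else 0]
        refine lintegral_congr fun u => ?_
        simp only [mul_ite, mul_zero, sum_ite_mem, univ_inter]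
    _ = _ := (sum_espKernel_mul G S fun S' => ∑ x ∈ S', (G.degree x : ℝ≥0∞) * H S' x).symm

theorem natCast_vol (S : Finset V) : (vol G S : ℝ≥0∞) = ∑ x ∈ S, (G.degree x : ℝ≥0∞) := by
  simp [vol]

theorem jointStep_const {S : Finset V} {x : V} (hx : 0 < G.degree x) (c : ℝ≥0∞) :
    jointStep G S x (fun _ _ => c) = c := by
  have h0 : (G.degree x : ℝ≥0∞) ≠ 0 := by exact_mod_cast hx.ne'
  simp only [jointStep, lintegral_const, Measure.restrict_apply MeasurableSet.univ, Set.univ_inter,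
    Real.volume_Icc, sub_zero, ENNReal.ofReal_one, mul_one, sum_const, nsmul_eq_mul,
    SimpleGraph.card_neighborFinset_eq_degree]
  rw [mul_comm, ENNReal.mul_div_cancel_right h0 (ENNReal.natCast_ne_top _), ← two_mul, mul_comm,
    ENNReal.mul_div_cancel_right two_ne_zero ENNReal.ofNat_ne_top]

/-- The volume of the evolving set is a martingale. -/
theorem sum_espKernel_mul_vol (S : Finset V) :
    ∑ S' : Finset V, espKernel G S S' * (vol G S' : ℝ≥0∞) = vol G S := by
  have h := sum_degree_mul_jointStep (G := G) S fun _ _ => 1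
  simp only [mul_one, ← natCast_vol] at h
  rw [← h, natCast_vol]
  refine sum_congr rfl fun x _ => ?_
  rcases Nat.eq_zero_or_pos (G.degree x) with h0 | h0
  · simp [h0]
  · rw [jointStep_const h0, mul_one]

theorem vol_mul_biasedKernel {S : Finset V} (hS : 0 < vol G S) (S' : Finset V) :
    (vol G S : ℝ≥0∞) * biasedKernel G S S' = espKernel G S S' * vol G S' := by
  have h0 : (vol G S : ℝ≥0∞) ≠ 0 := by exact_mod_cast hS.ne'
  rw [biasedKernel, ← mul_assoc, ENNReal.mul_div_cancel h0 (ENNReal.natCast_ne_top _), mul_comm]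

theorem vol_mul_sum_biasedKernel {S : Finset V} (hS : 0 < vol G S) (H : Finset V → ℝ≥0∞) :
    (vol G S : ℝ≥0∞) * ∑ S' : Finset V, biasedKernel G S S' * H S' =
      ∑ S' : Finset V, espKernel G S S' * (vol G S' * H S') := by
  rw [mul_sum]
  refine sum_congr rfl fun S' _ => ?_
  rw [← mul_assoc, vol_mul_biasedKernel hS, mul_assoc]

theorem sum_biasedKernel {S : Finset V} (hS : 0 < vol G S) :
    ∑ S' : Finset V, biasedKernel G S S' = 1 := by
  have h0 : (vol G S : ℝ≥0∞) ≠ 0 := by exact_mod_cast hS.ne'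
  have h := vol_mul_sum_biasedKernel hS fun _ => 1
  simp only [mul_one] at h
  rw [sum_espKernel_mul_vol] at h
  exact (ENNReal.mul_right_inj h0 (ENNReal.natCast_ne_top _)).1 (h.trans (mul_one _).symm)

theorem vol_pos_of_biasedKernel_ne_zero {S S' : Finset V} (h : biasedKernel G S S' ≠ 0) :
    0 < vol G S' := by
  by_contra h0
  have h0 : vol G S' = 0 := by omega
  simp [biasedKernel, h0] at h

theorem biasedKernel_ne_top {S : Finset V} (hS : 0 < vol G S) (S' : Finset V) :
    biasedKernel G S S' ≠ ∞ := by
  have h : biasedKernel G S S' ≤ 1 := by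
    rw [← sum_biasedKernel hS]
    exact single_le_sum (fun _ _ => zero_le) (mem_univ S')
  exact ne_top_of_le_ne_top ENNReal.one_ne_top h

/-- The integral of the volume of the level sets, by exchanging it with the sum over vertices. -/
theorem setLIntegral_vol_levelSet (S : Finset V) (s : Set ℝ) :
    ∫⁻ u in s, (vol G (levelSet G S u) : ℝ≥0∞) =
      ∑ y, (G.degree y : ℝ≥0∞) * volume (Set.Iic (walkProb G y S) ∩ s) := by
  have h : ∀ u, (vol G (levelSet G S u) : ℝ≥0∞) =
      ∑ y, (Set.Iic (walkProb G y S)).indicator (fun _ => (G.degree y : ℝ≥0∞)) u := by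
    intro u
    simp only [natCast_vol, Set.indicator_apply, Set.mem_Iic, levelSet, sum_filter]
  simp_rw [h]
  rw [lintegral_finsetSum _ fun y _ => measurable_const.indicator measurableSet_Iic]
  refine sum_congr rfl fun y _ => ?_
  rw [lintegral_indicator_const measurableSet_Iic, Measure.restrict_apply measurableSet_Iic]

theorem lintegral_vol_levelSet_low (S : Finset V) :
    ∫⁻ u in Set.Icc (0 : ℝ) (1 / 2), (vol G (levelSet G S u) : ℝ≥0∞) =
      ENNReal.ofReal (((vol G S : ℝ) + boundary G S) / 2) := by
  rw [setLIntegral_vol_levelSet S, boundary_eq_sum_compl, vol]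
  push_cast
  rw [add_div, sum_div, sum_div, ENNReal.ofReal_add (by positivity) (by positivity),
    ENNReal.ofReal_sum_of_nonneg (fun _ _ => by positivity),
    ENNReal.ofReal_sum_of_nonneg (fun _ _ => by positivity), ← sum_add_sum_compl S]
  congr 1
  · refine sum_congr rfl fun y hy => ?_
    have h : Set.Iic (walkProb G y S) ∩ Set.Icc (0 : ℝ) (1 / 2) = Set.Icc 0 (1 / 2) :=
      Set.inter_eq_right.2 fun u hu => hu.2.trans (half_le_walkProb G hy)
    rw [h, Real.volume_Icc, ← ENNReal.ofReal_natCast (G.degree y),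
      ← ENNReal.ofReal_mul (by positivity)]
    congr 1; ring
  · refine sum_congr rfl fun y hy => ?_
    have hy : y ∉ S := by simpa using hy
    have h : Set.Iic (walkProb G y S) ∩ Set.Icc (0 : ℝ) (1 / 2) = Set.Icc 0 (walkProb G y S) := by
      ext u
      have := walkProb_le_half G hy
      simp only [Set.mem_inter_iff, Set.mem_Iic, Set.mem_Icc]
      exact ⟨fun h => ⟨h.2.1, h.1⟩, fun h => ⟨h.2, h.1, h.2.trans this⟩⟩
    rw [h, Real.volume_Icc, ← ENNReal.ofReal_natCast (G.degree y),
      ← ENNReal.ofReal_mul (by positivity), sub_zero, degree_mul_walkProb, if_neg hy, add_zero]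

theorem lintegral_vol_levelSet_high (S : Finset V) :
    ∫⁻ u in Set.Ioc (1 / 2 : ℝ) 1, (vol G (levelSet G S u) : ℝ≥0∞) =
      ENNReal.ofReal (((vol G S : ℝ) - boundary G S) / 2) := by
  have hb : (vol G S : ℝ) - boundary G S = ∑ y ∈ S, (edges G {y} S : ℝ) := by
    rw [boundary_eq_sum, vol]
    push_cast
    rw [← sum_sub_distrib]
    refine sum_congr rfl fun y _ => ?_
    rw [← edges_add_compl G y S]
    push_cast; ring
  rw [setLIntegral_vol_levelSet S, hb, sum_div,
    ENNReal.ofReal_sum_of_nonneg (fun _ _ => by positivity), ← sum_add_sum_compl S]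
  have hc : ∑ y ∈ Sᶜ, (G.degree y : ℝ≥0∞) *
      volume (Set.Iic (walkProb G y S) ∩ Set.Ioc (1 / 2 : ℝ) 1) = 0 := by
    refine sum_eq_zero fun y hy => ?_
    have hy : y ∉ S := by simpa using hy
    have h : Set.Iic (walkProb G y S) ∩ Set.Ioc (1 / 2 : ℝ) 1 = ∅ := by
      ext u
      have := walkProb_le_half G hy
      simp only [Set.mem_inter_iff, Set.mem_Iic, Set.mem_Ioc, Set.mem_empty_iff_false, iff_false]
      rintro ⟨h1, h2, -⟩
      linarith
    rw [h, measure_empty, mul_zero]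
  rw [hc, add_zero]
  refine sum_congr rfl fun y hy => ?_
  have h : Set.Iic (walkProb G y S) ∩ Set.Ioc (1 / 2 : ℝ) 1 = Set.Ioc (1 / 2) (walkProb G y S) := by
    ext u
    have := walkProb_le_one G y S
    simp only [Set.mem_inter_iff, Set.mem_Iic, Set.mem_Ioc]
    exact ⟨fun h => ⟨h.2.1, h.1⟩, fun h => ⟨h.2, h.1, h.2.trans this⟩⟩
  rw [h, Real.volume_Ioc, ← ENNReal.ofReal_natCast (G.degree y),
    ← ENNReal.ofReal_mul (by positivity), mul_sub, degree_mul_walkProb, if_pos hy]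
  congr 1; ring

/-- The expected volume of the symmetric difference of `S` and the next set is `∂(S)`. -/
theorem sum_espKernel_mul_vol_symmDiff (S : Finset V) :
    ∑ S' : Finset V, espKernel G S S' * (vol G (S ∆ S') : ℝ≥0∞) = boundary G S := by
  rw [sum_espKernel_mul G S fun S' => (vol G (S ∆ S') : ℝ≥0∞)]
  have h : ∀ u, (vol G (S ∆ levelSet G S u) : ℝ≥0∞) =
      ∑ y ∈ S, (Set.Ioi (walkProb G y S)).indicator (fun _ => (G.degree y : ℝ≥0∞)) u +
      ∑ y ∈ Sᶜ, (Set.Iic (walkProb G y S)).indicator (fun _ => (G.degree y : ℝ≥0∞)) u := by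
    intro u
    simp only [natCast_vol, Set.indicator_apply, Set.mem_Iic, Set.mem_Ioi, ← sum_filter]
    rw [← sum_union]
    · refine sum_congr ?_ fun _ _ => rfl
      ext y
      simp [mem_symmDiff, and_comm]
    · rw [disjoint_left]
      intro y h1 h2
      simp only [mem_filter, mem_compl] at h1 h2
      exact h2.1 h1.1
  simp_rw [h]
  rw [lintegral_add_left (Finset.measurable_sum _ fun y _ =>
      measurable_const.indicator measurableSet_Ioi),
    lintegral_finsetSum _ fun y _ => measurable_const.indicator measurableSet_Ioi,
    lintegral_finsetSum _ fun y _ => measurable_const.indicator measurableSet_Iic]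
  have h1 : ∀ y ∈ S, ∫⁻ u in Set.Icc (0 : ℝ) 1,
      (Set.Ioi (walkProb G y S)).indicator (fun _ => (G.degree y : ℝ≥0∞)) u =
      ENNReal.ofReal ((edges G {y} Sᶜ : ℝ) / 2) := by
    intro y hy
    have hi : Set.Ioi (walkProb G y S) ∩ Set.Icc (0 : ℝ) 1 = Set.Ioc (walkProb G y S) 1 := by
      ext u
      have := walkProb_nonneg G y S
      simp only [Set.mem_inter_iff, Set.mem_Ioi, Set.mem_Icc, Set.mem_Ioc]
      exact ⟨fun h => ⟨h.1, h.2.2⟩, fun h => ⟨h.1, this.trans h.1.le, h.2⟩⟩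
    rw [lintegral_indicator_const measurableSet_Ioi, Measure.restrict_apply measurableSet_Ioi, hi,
      Real.volume_Ioc, ← ENNReal.ofReal_natCast (G.degree y), ← ENNReal.ofReal_mul (by positivity),
      mul_sub, degree_mul_walkProb, if_pos hy, ← edges_add_compl G y S]
    congr 1
    push_cast; ring
  have h2 : ∀ y ∈ Sᶜ, ∫⁻ u in Set.Icc (0 : ℝ) 1,
      (Set.Iic (walkProb G y S)).indicator (fun _ => (G.degree y : ℝ≥0∞)) u =
      ENNReal.ofReal ((edges G {y} S : ℝ) / 2) := by
    intro y hy
    have hy : y ∉ S := by simpa using hy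
    have hi : Set.Iic (walkProb G y S) ∩ Set.Icc (0 : ℝ) 1 = Set.Icc 0 (walkProb G y S) := by
      ext u
      have := walkProb_le_one G y S
      simp only [Set.mem_inter_iff, Set.mem_Iic, Set.mem_Icc]
      exact ⟨fun h => ⟨h.2.1, h.1⟩, fun h => ⟨h.2, h.1, h.2.trans this⟩⟩
    rw [lintegral_indicator_const measurableSet_Iic, Measure.restrict_apply measurableSet_Iic, hi,
      Real.volume_Icc, ← ENNReal.ofReal_natCast (G.degree y), ← ENNReal.ofReal_mul (by positivity),
      sub_zero, degree_mul_walkProb, if_neg hy, add_zero]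
  rw [sum_congr rfl h1, sum_congr rfl h2,
    ← ENNReal.ofReal_sum_of_nonneg (fun _ _ => by positivity),
    ← ENNReal.ofReal_sum_of_nonneg (fun _ _ => by positivity),
    ← ENNReal.ofReal_add (by positivity) (by positivity), ← sum_div, ← sum_div, ← Nat.cast_sum,
    ← Nat.cast_sum, ← boundary_eq_sum, ← boundary_eq_sum_compl, add_halves,
    ENNReal.ofReal_natCast]

end EvolvingSets

/-! ### Growth of the volume-biased process -/

section Growth

variable {V : Type} [Fintype V] [DecidableEq V] {G : SimpleGraph V} [DecidableRel G.Adj]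

theorem conductance_nonneg (S : Finset V) : 0 ≤ conductance G S := by
  unfold conductance; positivity

theorem conductance_le_one (S : Finset V) : conductance G S ≤ 1 :=
  div_le_one_of_le₀ (by exact_mod_cast boundary_le_vol G S) (by positivity)

/-- The tangent of the concave function `x ↦ x ^ (2 / 3)` at `b ^ 3`. -/
theorem rpow_two_thirds_le_tangent {x b : ℝ} (hx : 0 ≤ x) (hb : 0 < b) :
    x ^ (2 / 3 : ℝ) ≤ 2 / (3 * b) * x + b ^ 2 / 3 := by
  set y := x ^ (1 / 3 : ℝ) with hy
  have hy0 : 0 ≤ y := by positivity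
  have h3 : y ^ 3 = x := by
    rw [hy, ← Real.rpow_natCast, ← Real.rpow_mul hx]; norm_num
  have h2 : x ^ (2 / 3 : ℝ) = y ^ 2 := by
    rw [hy, ← Real.rpow_natCast, ← Real.rpow_mul hx]; norm_num
  rw [h2, ← h3]
  have h : 0 ≤ (y - b) ^ 2 * (2 * y + b) / (3 * b) := by positivity
  have h' : 2 / (3 * b) * y ^ 3 + b ^ 2 / 3 - y ^ 2 = (y - b) ^ 2 * (2 * y + b) / (3 * b) := by
    field_simp; ring
  linarith

/-- The inequality obtained from the tangents at `(1 ± φ / 3) ^ 3` on the two halves of `[0, 1]`.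
These points agree with `1 ± φ` to first order, which suffices for the second order term and avoids
the singularity at `φ = 1`. -/
theorem tangent_sum_le {φ : ℝ} (h0 : 0 ≤ φ) (h1 : φ ≤ 1) :
    2 / (3 * (1 + φ / 3)) * ((1 + φ) / 2) + (1 + φ / 3) ^ 2 / 3 * (1 / 2) +
      (2 / (3 * (1 - φ / 3)) * ((1 - φ) / 2) + (1 - φ / 3) ^ 2 / 3 * (1 / 2)) ≤
      1 - φ ^ 2 / 9 := by
  have ha : 0 < 3 + φ := by linarith
  have hb : 0 < 3 - φ := by linarith
  have key : 1 - φ ^ 2 / 9 - (2 / (3 * (1 + φ / 3)) * ((1 + φ) / 2) + (1 + φ / 3) ^ 2 / 3 * (1 / 2) +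
      (2 / (3 * (1 - φ / 3)) * ((1 - φ) / 2) + (1 - φ / 3) ^ 2 / 3 * (1 / 2))) =
      4 * φ ^ 4 / (27 * ((3 + φ) * (3 - φ))) := by
    have ha' : 1 + φ / 3 ≠ 0 := by linarith
    have hb' : 1 - φ / 3 ≠ 0 := by linarith
    have ha'' : 3 + φ ≠ 0 := ha.ne'
    have hb'' : 3 - φ ≠ 0 := hb.ne'
    have e1 : 2 / (3 * (1 + φ / 3)) = 2 / (3 + φ) := by congr 1; ring
    have e2 : 2 / (3 * (1 - φ / 3)) = 2 / (3 - φ) := by congr 1; ring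
    rw [e1, e2]
    field_simp
    ring
  have : 0 ≤ 4 * φ ^ 4 / (27 * ((3 + φ) * (3 - φ))) := by positivity
  linarith

theorem lintegral_rpow_vol_levelSet_le {S : Finset V} (hS : 0 < vol G S) {s : Set ℝ}
    (hs : volume s = ENNReal.ofReal (1 / 2)) {a b : ℝ} (ha : 0 ≤ a) (hb : 0 < b)
    (h : ∫⁻ u in s, (vol G (levelSet G S u) : ℝ≥0∞) = ENNReal.ofReal (vol G S * a)) :
    ∫⁻ u in s, ENNReal.ofReal ((vol G (levelSet G S u) : ℝ) ^ (2 / 3 : ℝ)) ≤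
      ENNReal.ofReal ((vol G S : ℝ) ^ (2 / 3 : ℝ) * (2 / (3 * b) * a + b ^ 2 / 3 * (1 / 2))) := by
  set m : ℝ := (vol G S : ℝ) with hm
  have hm0 : 0 < m := by rw [hm]; exact_mod_cast hS
  set q := m ^ (2 / 3 : ℝ) with hq
  have hq0 : 0 < q := by positivity
  calc ∫⁻ u in s, ENNReal.ofReal ((vol G (levelSet G S u) : ℝ) ^ (2 / 3 : ℝ))
      ≤ ∫⁻ u in s, (ENNReal.ofReal (q * (2 / (3 * b)) / m) * (vol G (levelSet G S u) : ℝ≥0∞) +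
          ENNReal.ofReal (q * (b ^ 2 / 3))) := by
        refine lintegral_mono fun u => ?_
        rw [← ENNReal.ofReal_natCast (vol G (levelSet G S u)),
          ← ENNReal.ofReal_mul (by positivity), ← ENNReal.ofReal_add (by positivity) (by positivity)]
        refine ENNReal.ofReal_le_ofReal ?_
        set x : ℝ := (vol G (levelSet G S u) : ℝ)
        have hx : x = m * (x / m) := by field_simp
        have h1 := rpow_two_thirds_le_tangent (x := x / m) (by positivity) hb
        calc x ^ (2 / 3 : ℝ) = q * (x / m) ^ (2 / 3 : ℝ) := by
              conv_lhs => rw [hx]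
              rw [Real.mul_rpow hm0.le (by positivity)]
          _ ≤ q * (2 / (3 * b) * (x / m) + b ^ 2 / 3) := by gcongr
          _ = _ := by ring
    _ = ENNReal.ofReal (q * (2 / (3 * b)) / m) * ENNReal.ofReal (m * a) +
          ENNReal.ofReal (q * (b ^ 2 / 3)) * ENNReal.ofReal (1 / 2) := by
        rw [lintegral_add_right _ measurable_const,
          lintegral_const_mul _ (measurable_levelSet G S fun S' => (vol G S' : ℝ≥0∞)), h]
        simp [hs]
    _ = _ := by
        rw [← ENNReal.ofReal_mul (by positivity), ← ENNReal.ofReal_mul (by positivity),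
          ← ENNReal.ofReal_add (by positivity) (by positivity)]
        congr 1
        field_simp

/-- The growth estimate: along the volume-biased process, `μ(S) ^ (-1/3)` decreases in expectation
by a factor that is governed by the conductance. -/
theorem sum_biasedKernel_mul_rpow_le {S : Finset V} (hS : 0 < vol G S) :
    ∑ S' : Finset V, biasedKernel G S S' * ENNReal.ofReal ((vol G S' : ℝ) ^ (-(1 / 3) : ℝ)) ≤
      ENNReal.ofReal ((vol G S : ℝ) ^ (-(1 / 3) : ℝ) * (1 - conductance G S ^ 2 / 9)) := by
  have h0 : (vol G S : ℝ≥0∞) ≠ 0 := by exact_mod_cast hS.ne'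
  have hm0 : 0 < (vol G S : ℝ) := by exact_mod_cast hS
  have hφ0 := conductance_nonneg (G := G) S
  have hφ1 := conductance_le_one (G := G) S
  have hφ : (boundary G S : ℝ) = vol G S * conductance G S := by
    unfold conductance; field_simp
  rw [← ENNReal.mul_le_mul_iff_right h0 (ENNReal.natCast_ne_top _), vol_mul_sum_biasedKernel hS]
  have hpow : ∀ m : ℕ, (m : ℝ≥0∞) * ENNReal.ofReal ((m : ℝ) ^ (-(1 / 3) : ℝ)) =
      ENNReal.ofReal ((m : ℝ) ^ (2 / 3 : ℝ)) := by
    intro m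
    rw [← ENNReal.ofReal_natCast, ← ENNReal.ofReal_mul (by positivity)]
    congr 1
    rcases Nat.eq_zero_or_pos m with hm | hm
    · simp [hm]
    · have : (0 : ℝ) < m := by exact_mod_cast hm
      conv_lhs => rw [← Real.rpow_one (m : ℝ), ← Real.rpow_mul this.le, ← Real.rpow_add this]
      norm_num
  have h1 := lintegral_rpow_vol_levelSet_le hS (s := Set.Icc (0 : ℝ) (1 / 2)) (by simp)
    (a := (1 + conductance G S) / 2) (b := 1 + conductance G S / 3) (by positivity)
    (by positivity) (by rw [lintegral_vol_levelSet_low, hφ]; congr 1; ring)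
  have h2 := lintegral_rpow_vol_levelSet_le hS (s := Set.Ioc (1 / 2 : ℝ) 1)
    (by rw [Real.volume_Ioc]; norm_num)
    (a := (1 - conductance G S) / 2) (b := 1 - conductance G S / 3) (by linarith)
    (by linarith) (by rw [lintegral_vol_levelSet_high, hφ]; congr 1; ring)
  have hu : Set.Icc (0 : ℝ) 1 = Set.Icc (0 : ℝ) (1 / 2) ∪ Set.Ioc (1 / 2 : ℝ) 1 :=
    (Set.Icc_union_Ioc_eq_Icc (by norm_num) (by norm_num)).symm
  have hd : Disjoint (Set.Icc (0 : ℝ) (1 / 2)) (Set.Ioc (1 / 2 : ℝ) 1) := by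
    rw [Set.disjoint_left]
    intro u h1 h2
    exact absurd h1.2 (not_le.2 h2.1)
  simp_rw [hpow]
  rw [sum_espKernel_mul G S fun S' => ENNReal.ofReal ((vol G S' : ℝ) ^ (2 / 3 : ℝ)), hu,
    lintegral_union measurableSet_Ioc hd]
  have ha : 0 ≤ 2 / (3 * (1 - conductance G S / 3)) := by
    apply div_nonneg <;> linarith
  have ha' : 0 ≤ (1 - conductance G S) / 2 := by linarith
  refine (add_le_add h1 h2).trans ?_
  rw [← ENNReal.ofReal_add (by positivity) (by positivity), ← mul_add]
  refine (ENNReal.ofReal_le_ofReal (mul_le_mul_of_nonneg_left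
    (tangent_sum_le hφ0 hφ1) (by positivity))).trans_eq ?_
  rw [ENNReal.ofReal_mul (by positivity), ENNReal.ofReal_mul (by positivity), ← mul_assoc, hpow]

/-- The drift of `log μ(S)`: the potential `log (m / μ(S))` decreases in expectation by at least
`φ(S)² / 3`. Here `m` bounds all volumes. -/
theorem sum_biasedKernel_mul_log_le {S : Finset V} (hS : 0 < vol G S) :
    ∑ S' : Finset V, biasedKernel G S S' *
        ENNReal.ofReal (Real.log ((vol G univ : ℝ) / vol G S')) +
        ENNReal.ofReal (conductance G S ^ 2 / 3) ≤
      ENNReal.ofReal (Real.log ((vol G univ : ℝ) / vol G S)) := by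
  set k : Finset V → ℝ := fun S' => (biasedKernel G S S').toReal with hk
  set M : ℝ := (vol G univ : ℝ) with hM
  have hm0 : 0 < (vol G S : ℝ) := by exact_mod_cast hS
  have hM0 : 0 < M := hm0.trans_le (Nat.cast_le.2 (vol_mono G (subset_univ S)))
  have hk0 : ∀ S', 0 ≤ k S' := fun S' => ENNReal.toReal_nonneg
  have hkK : ∀ S', biasedKernel G S S' = ENNReal.ofReal (k S') := fun S' =>
    (ENNReal.ofReal_toReal (biasedKernel_ne_top hS S')).symm
  have hsum : ∑ S', k S' = 1 := by
    have h := sum_biasedKernel hS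
    simp_rw [hkK] at h
    rw [← ENNReal.ofReal_sum_of_nonneg fun S' _ => hk0 S'] at h
    simpa using h
  have hlog0 : ∀ S' : Finset V, 0 ≤ Real.log (M / vol G S') := by
    intro S'
    rcases Nat.eq_zero_or_pos (vol G S') with h | h
    · simp [h]
    · have h' : 0 < (vol G S' : ℝ) := by exact_mod_cast h
      refine Real.log_nonneg ((one_le_div h').2 ?_)
      exact Nat.cast_le.2 (vol_mono G (subset_univ S'))
  have hφ0 := conductance_nonneg (G := G) S
  have hφ1 := conductance_le_one (G := G) S
  have hgrow := sum_biasedKernel_mul_rpow_le hS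
  simp_rw [hkK, ← ENNReal.ofReal_mul (hk0 _)] at hgrow ⊢
  have hfac : 0 ≤ 1 - conductance G S ^ 2 / 9 := by nlinarith
  rw [← ENNReal.ofReal_sum_of_nonneg fun S' _ => mul_nonneg (hk0 S') (by positivity),
    ENNReal.ofReal_le_ofReal_iff (by positivity)] at hgrow
  rw [← ENNReal.ofReal_sum_of_nonneg fun S' _ => mul_nonneg (hk0 S') (hlog0 S'),
    ← ENNReal.ofReal_add (sum_nonneg fun S' _ => mul_nonneg (hk0 S') (hlog0 S')) (by positivity)]
  refine ENNReal.ofReal_le_ofReal ?_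
  set q := (vol G S : ℝ) ^ (1 / 3 : ℝ) with hq
  have hq0 : 0 < q := by positivity
  have hterm : ∀ S', k S' * Real.log (M / vol G S') ≤ k S' * (Real.log (M / vol G S) - 3) +
      3 * q * (k S' * (vol G S' : ℝ) ^ (-(1 / 3) : ℝ)) := by
    intro S'
    rcases eq_or_ne (biasedKernel G S S') 0 with h | h
    · have : k S' = 0 := by rw [hk]; simp [h]
      simp [this]
    · have hS' : 0 < (vol G S' : ℝ) := by exact_mod_cast vol_pos_of_biasedKernel_ne_zero h
      have h1 : Real.log ((vol G S : ℝ) / vol G S') ≤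
          3 * (q * (vol G S' : ℝ) ^ (-(1 / 3) : ℝ) - 1) := by
        have h2 : 0 < q * (vol G S' : ℝ) ^ (-(1 / 3) : ℝ) := by positivity
        have h3 := Real.log_le_sub_one_of_pos h2
        rw [hq, Real.log_mul (by positivity) (by positivity), Real.log_rpow hm0,
          Real.log_rpow hS', ← hq] at h3
        rw [Real.log_div hm0.ne' hS'.ne']
        linarith
      have h4 : Real.log (M / vol G S') =
          Real.log (M / vol G S) + Real.log ((vol G S : ℝ) / vol G S') := by
        rw [← Real.log_mul (by positivity) (by positivity)]
        congr 1
        field_simp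
      have h5 := mul_le_mul_of_nonneg_left h1 (hk0 S')
      rw [h4]
      linarith
  have hqq : q * (vol G S : ℝ) ^ (-(1 / 3) : ℝ) = 1 := by
    rw [hq, ← Real.rpow_add hm0]; norm_num
  calc ∑ S', k S' * Real.log (M / vol G S') + conductance G S ^ 2 / 3
      ≤ ∑ S', (k S' * (Real.log (M / vol G S) - 3) +
          3 * q * (k S' * (vol G S' : ℝ) ^ (-(1 / 3) : ℝ))) + conductance G S ^ 2 / 3 := by
        gcongr with S' _
        exact hterm S'
    _ = (Real.log (M / vol G S) - 3) +
          3 * q * ∑ S', k S' * (vol G S' : ℝ) ^ (-(1 / 3) : ℝ) + conductance G S ^ 2 / 3 := by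
        rw [sum_add_distrib, ← sum_mul, hsum, ← mul_sum, one_mul]
    _ ≤ (Real.log (M / vol G S) - 3) +
          3 * q * ((vol G S : ℝ) ^ (-(1 / 3) : ℝ) * (1 - conductance G S ^ 2 / 9)) +
          conductance G S ^ 2 / 3 := by gcongr
    _ = Real.log (M / vol G S) := by
        have : 3 * q * ((vol G S : ℝ) ^ (-(1 / 3) : ℝ) * (1 - conductance G S ^ 2 / 9)) =
          3 * (q * (vol G S : ℝ) ^ (-(1 / 3) : ℝ)) * (1 - conductance G S ^ 2 / 9) := by ring
        rw [this, hqq]; ring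

end Growth

/-! ### Stopping the volume-biased process -/

section Stopping

variable {V : Type} [Fintype V] [DecidableEq V] (G : SimpleGraph V) [DecidableRel G.Adj]

/-- The expected value of `g(S_τ)` for the volume-biased process started from the given set, where
`τ` is the first time `t` with `φ(S_t) < θ` or `t = r`. -/
noncomputable def stopVal (θ : ℝ) (g : Finset V → ℝ≥0∞) : ℕ → Finset V → ℝ≥0∞
  | 0, S => g S
  | r + 1, S => if conductance G S < θ then g S else
      ∑ S' : Finset V, biasedKernel G S S' * stopVal θ g r S'

/-- The expected value of `h(S_τ, X_τ)` for the joint chain of the set and the walk particle. -/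
noncomputable def jointVal (θ : ℝ) (h : Finset V → V → ℝ≥0∞) : ℕ → Finset V → V → ℝ≥0∞
  | 0, S, x => h S x
  | r + 1, S, x => if conductance G S < θ then h S x else jointStep G S x (jointVal θ h r)

variable {G} {θ : ℝ}

theorem stopVal_mono {g g' : Finset V → ℝ≥0∞} (h : ∀ S, g S ≤ g' S) (r : ℕ) (S : Finset V) :
    stopVal G θ g r S ≤ stopVal G θ g' r S := by
  induction r generalizing S with
  | zero => exact h S
  | succ r ih =>
      rw [stopVal, stopVal]
      split_ifs
      · exact h S
      · gcongr with S' _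
        exact ih S'

theorem stopVal_add (g g' : Finset V → ℝ≥0∞) (r : ℕ) (S : Finset V) :
    stopVal G θ (fun S => g S + g' S) r S = stopVal G θ g r S + stopVal G θ g' r S := by
  induction r generalizing S with
  | zero => rfl
  | succ r ih =>
      simp only [stopVal]
      split_ifs
      · rfl
      · rw [← sum_add_distrib]
        simp_rw [ih, mul_add]

theorem stopVal_const_mul (c : ℝ≥0∞) (g : Finset V → ℝ≥0∞) (r : ℕ) (S : Finset V) :
    stopVal G θ (fun S => c * g S) r S = c * stopVal G θ g r S := by
  induction r generalizing S with
  | zero => rfl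
  | succ r ih =>
      simp only [stopVal]
      split_ifs
      · rfl
      · rw [mul_sum]
        simp_rw [ih, mul_left_comm]

theorem stopVal_one (r : ℕ) {S : Finset V} (hS : 0 < vol G S) :
    stopVal G θ (fun _ => 1) r S = 1 := by
  induction r generalizing S with
  | zero => rfl
  | succ r ih =>
      rw [stopVal]
      split_ifs
      · rfl
      · refine Eq.trans (sum_congr rfl fun S' _ => ?_) (sum_biasedKernel hS)
        rcases eq_or_ne (biasedKernel G S S') 0 with h | h
        · rw [h, zero_mul]
        · rw [ih (vol_pos_of_biasedKernel_ne_zero h), mul_one]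

/-- The intertwining relation for the stopped processes. -/
theorem sum_degree_mul_jointVal (h : Finset V → V → ℝ≥0∞) (r : ℕ) {S : Finset V}
    (hS : 0 < vol G S) :
    ∑ x ∈ S, (G.degree x : ℝ≥0∞) * jointVal G θ h r S x = (vol G S : ℝ≥0∞) *
      stopVal G θ (fun S => (∑ x ∈ S, (G.degree x : ℝ≥0∞) * h S x) / (vol G S : ℝ≥0∞)) r S := by
  have hnow : ∑ x ∈ S, (G.degree x : ℝ≥0∞) * h S x = (vol G S : ℝ≥0∞) *
      ((∑ x ∈ S, (G.degree x : ℝ≥0∞) * h S x) / (vol G S : ℝ≥0∞)) :=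
    (ENNReal.mul_div_cancel (by exact_mod_cast hS.ne') (ENNReal.natCast_ne_top _)).symm
  induction r generalizing S with
  | zero => exact hnow
  | succ r ih =>
      simp only [jointVal, stopVal]
      split_ifs
      · exact hnow
      · rw [sum_degree_mul_jointStep, vol_mul_sum_biasedKernel hS]
        refine sum_congr rfl fun S' _ => ?_
        rcases Nat.eq_zero_or_pos (vol G S') with h0 | h0
        · have : ∀ x ∈ S', G.degree x = 0 := fun x hx => (sum_eq_zero_iff.1 h0) x hx
          rw [h0, Nat.cast_zero, zero_mul, sum_eq_zero fun x hx => by rw [this x hx]; simp]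
        · rw [ih h0]
          exact (ENNReal.mul_div_cancel (by exact_mod_cast h0.ne') (ENNReal.natCast_ne_top _)).symm

theorem jointVal_singleton (h : Finset V → V → ℝ≥0∞) (r : ℕ) {v : V} (hv : 0 < G.degree v) :
    jointVal G θ h r {v} v =
      stopVal G θ (fun S => (∑ x ∈ S, (G.degree x : ℝ≥0∞) * h S x) / (vol G S : ℝ≥0∞)) r {v} := by
  have hvol : vol G {v} = G.degree v := by simp [vol]
  have h1 := sum_degree_mul_jointVal (θ := θ) h r (S := {v}) (by rw [hvol]; exact hv)
  rw [sum_singleton, hvol] at h1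
  exact (ENNReal.mul_right_inj (by exact_mod_cast hv.ne') (ENNReal.natCast_ne_top _)).1 h1

theorem stopVal_congr {g g' : Finset V → ℝ≥0∞} (hg : ∀ S, 0 < vol G S → g S = g' S) (r : ℕ)
    {S : Finset V} (hS : 0 < vol G S) : stopVal G θ g r S = stopVal G θ g' r S := by
  induction r generalizing S with
  | zero => exact hg S hS
  | succ r ih =>
      simp only [stopVal]
      split_ifs
      · exact hg S hS
      · refine sum_congr rfl fun S' _ => ?_
        rcases eq_or_ne (biasedKernel G S S') 0 with h | h
        · rw [h, zero_mul, zero_mul]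
        · rw [ih (vol_pos_of_biasedKernel_ne_zero h)]

theorem jointVal_singleton_of_set (g : Finset V → ℝ≥0∞) (r : ℕ) {v : V} (hv : 0 < G.degree v) :
    jointVal G θ (fun S _ => g S) r {v} v = stopVal G θ g r {v} := by
  rw [jointVal_singleton _ r hv]
  refine stopVal_congr (fun S hS => ?_) r (by simpa [vol] using hv)
  rw [← sum_mul, ← natCast_vol, mul_comm,
    ENNReal.mul_div_cancel_right (by exact_mod_cast hS.ne') (ENNReal.natCast_ne_top _)]

theorem stopTime_cons_of_lt {T : ℕ} {S₀ : Finset V} (S : Fin (T + 1) → Finset V)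
    (h : conductance G S₀ < θ) :
    stopTime G θ (Fin.cons S₀ S : Fin (T + 2) → Finset V) = 0 := by
  refine le_antisymm (min'_le _ _ ?_) (Fin.zero_le _)
  simp [h]

theorem stopTime_cons_of_not_lt {T : ℕ} {S₀ : Finset V} (S : Fin (T + 1) → Finset V)
    (h : ¬ conductance G S₀ < θ) :
    stopTime G θ (Fin.cons S₀ S : Fin (T + 2) → Finset V) = (stopTime G θ S).succ := by
  have hmem : stopTime G θ S ∈ univ.filter
      (fun t : Fin (T + 1) => conductance G (S t) < θ ∨ t = Fin.last T) := min'_mem _ _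
  refine le_antisymm (min'_le _ _ ?_) (le_min' _ _ _ fun t ht => ?_)
  · simp only [mem_filter, mem_univ, true_and, Fin.cons_succ] at hmem ⊢
    exact hmem.imp_right fun h => by rw [h, Fin.succ_last]
  · simp only [mem_filter, mem_univ, true_and] at ht
    induction t using Fin.cases with
    | zero =>
        rcases ht with ht | ht
        · exact absurd ht h
        · exact absurd ht (Fin.last_pos).ne
    | succ t =>
        rw [Fin.succ_le_succ_iff]
        refine min'_le _ _ ?_
        simp only [mem_filter, mem_univ, true_and, Fin.cons_succ] at ht ⊢
        exact ht.imp_right fun h => Fin.succ_injective _ (h.trans (Fin.succ_last T).symm)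

/-- The recursion for `stopVal` sums over all paths. -/
theorem sum_path_eq_stopVal (g : Finset V → ℝ≥0∞) (T : ℕ) {S₀ : Finset V} (hS : 0 < vol G S₀) :
    ∑ S : Fin (T + 1) → Finset V, (if S 0 = S₀ then 1 else 0) *
        (∏ i : Fin T, biasedKernel G (S i.castSucc) (S i.succ)) * g (S (stopTime G θ S)) =
      stopVal G θ g T S₀ := by
  have hcons : ∀ (T : ℕ) (F : (Fin (T + 1) → Finset V) → ℝ≥0∞),
      ∑ S : Fin (T + 1) → Finset V, F S =
        ∑ a : Finset V, ∑ S : Fin T → Finset V, F (Fin.cons a S) := by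
    intro T F
    rw [← Fintype.sum_prod_type', ← (Fin.consEquiv fun _ => Finset V).sum_comp]
    rfl
  induction T generalizing g S₀ with
  | zero =>
      rw [hcons]
      have h0 : ∀ S : Fin 1 → Finset V, stopTime G θ S = 0 := fun S =>
        Fin.ext (by simp)
      simp [h0, stopVal]
  | succ T ih =>
      have hstep : ∀ F : (Fin (T + 1) → Finset V) → ℝ≥0∞,
          ∑ S : Fin (T + 1) → Finset V, biasedKernel G S₀ (S 0) *
            ((∏ i : Fin T, biasedKernel G (S i.castSucc) (S i.succ)) * F S) =
          ∑ S₁ : Finset V, biasedKernel G S₀ S₁ * ∑ S : Fin (T + 1) → Finset V,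
            (if S 0 = S₁ then 1 else 0) *
              (∏ i : Fin T, biasedKernel G (S i.castSucc) (S i.succ)) * F S := by
        intro F
        simp_rw [mul_sum]
        rw [sum_comm]
        refine sum_congr rfl fun S _ => ?_
        rw [sum_eq_single (S 0)]
        · rw [if_pos rfl, one_mul]
        · intro S₁ _ hne
          rw [if_neg hne.symm]; simp
        · simp
      rw [hcons, sum_eq_single S₀]
      · simp only [Fin.cons_zero, if_true, one_mul, Fin.prod_univ_succ, Fin.castSucc_zero,
          Fin.cons_succ, ← Fin.succ_castSucc, mul_assoc]
        rw [stopVal]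
        split_ifs with hlt
        · simp_rw [stopTime_cons_of_lt _ hlt, Fin.cons_zero]
          rw [hstep fun _ => g S₀]
          calc _ = ∑ S₁ : Finset V, biasedKernel G S₀ S₁ * g S₀ := by
                refine sum_congr rfl fun S₁ _ => ?_
                rcases eq_or_ne (biasedKernel G S₀ S₁) 0 with h | h
                · rw [h, zero_mul, zero_mul]
                · have hS₁ := vol_pos_of_biasedKernel_ne_zero h
                  rw [← sum_mul]
                  have := ih (fun _ => 1) hS₁
                  simp only [mul_one] at this
                  rw [this, stopVal_one T hS₁, one_mul]
            _ = g S₀ := by rw [← sum_mul, sum_biasedKernel hS, one_mul]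
        · simp_rw [stopTime_cons_of_not_lt _ hlt, Fin.cons_succ]
          rw [hstep fun S => g (S (stopTime G θ S))]
          refine sum_congr rfl fun S₁ _ => ?_
          rcases eq_or_ne (biasedKernel G S₀ S₁) 0 with h | h
          · rw [h, zero_mul, zero_mul]
          · rw [ih g (vol_pos_of_biasedKernel_ne_zero h)]
      · intro a _ hne
        refine sum_eq_zero fun S _ => ?_
        rw [Fin.cons_zero, if_neg hne, zero_mul, zero_mul]
      · simp

theorem stoppedProb_eq_stopVal {v : V} (hv : 0 < G.degree v) (T : ℕ) (R : Finset V) :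
    stoppedProb G v T θ R = stopVal G θ (fun S => if S = R then 1 else 0) T {v} := by
  rw [← sum_path_eq_stopVal _ T (by simpa [vol] using hv), stoppedProb]
  refine sum_congr rfl fun S _ => ?_
  rw [pathProb, mul_ite, mul_one, mul_zero]

end Stopping

/-! ### Runs of the algorithm and the joint chain -/

section Simulation

open Prog
open scoped symmDiff

variable {n : ℕ} {G : SimpleGraph (Fin n)} [DecidableRel G.Adj] {S : Finset (Fin n)}
  {s : State n} {θ : ℝ}

theorem Rep.mem_border (h : Rep G S s) (a : Fin n × ℕ) : a ∈ Trie.entries s.border ↔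
    a.2 = edges G {a.1} S ∧ OnBorder G S (fun y => edges G {y} S) a.1 := by
  rw [Trie.mem_entries h.border.good]
  constructor
  · rintro ⟨k, hk, hka⟩
    exact ((h.border.get k hk a).1 hka).2
  · intro ha
    exact ⟨a.1, val_lt_two_pow_clog a.1, (h.border.get _ (val_lt_two_pow_clog a.1) a).2 ⟨rfl, ha⟩⟩

theorem Rep.nodup_border (h : Rep G S s) : ((Trie.entries s.border).map Prod.fst).Nodup := by
  refine List.Nodup.map_on ?_ (Trie.nodup_entries h.border.good (fun a => (a.1 : ℕ))
    fun k hk a hka => ((h.border.get k hk a).1 hka).1)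
  intro a ha b hb hab
  have h1 := ((h.mem_border a).1 ha).1
  have h2 := ((h.mem_border b).1 hb).1
  exact Prod.ext hab (by rw [h1, h2, hab])

/-- Every vertex of the two-sided boundary is an end of an edge that leaves `S`. -/
theorem Rep.length_border_le (h : Rep G S s) :
    (Trie.entries s.border).length ≤ 2 * boundary G S := by
  classical
  have h1 : (Trie.entries s.border).length =
      ((Trie.entries s.border).map Prod.fst).toFinset.card := by
    rw [List.toFinset_card_of_nodup h.nodup_border, List.length_map]
  have h2 : ((Trie.entries s.border).map Prod.fst).toFinset ⊆
      S.filter (fun y => edges G {y} S < G.degree y) ∪ Sᶜ.filter fun y => 0 < edges G {y} S := by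
    intro y hy
    obtain ⟨a, ha, rfl⟩ := List.mem_map.1 (List.mem_toFinset.1 hy)
    have := ((h.mem_border a).1 ha).2
    simpa [OnBorder] using this
  have h3 : (S.filter fun y => edges G {y} S < G.degree y).card ≤ boundary G S := by
    rw [boundary_eq_sum, card_filter]
    refine sum_le_sum fun y _ => ?_
    have := edges_add_compl G y S
    split_ifs <;> omega
  have h4 : (Sᶜ.filter fun y => 0 < edges G {y} S).card ≤ boundary G S := by
    rw [boundary_eq_sum_compl, card_filter]
    refine sum_le_sum fun y _ => ?_
    split_ifs <;> omega
  have h5 := card_le_card h2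
  have h6 := card_union_le (S.filter fun y => edges G {y} S < G.degree y)
    (Sᶜ.filter fun y => 0 < edges G {y} S)
  omega

theorem Rep.nodup_members (h : Rep G S s) : (Trie.entries s.members).Nodup :=
  Trie.nodup_entries h.members.good (fun a => (a : ℕ)) fun k hk a hka =>
    ((h.members.get k hk a).1 hka).1

theorem Rep.toFinset_members (h : Rep G S s) : (Trie.entries s.members).toFinset = S := by
  ext a
  rw [List.mem_toFinset, Trie.mem_entries h.members.good]
  constructor
  · rintro ⟨k, hk, hka⟩
    exact ((h.members.get k hk a).1 hka).2
  · intro ha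
    exact ⟨a, val_lt_two_pow_clog a, (h.members.get _ (val_lt_two_pow_clog a) a).2 ⟨rfl, ha⟩⟩

theorem Rep.length_members (h : Rep G S s) : (Trie.entries s.members).length = S.card := by
  rw [← List.toFinset_card_of_nodup h.nodup_members, h.toFinset_members]

theorem Rep.cut_div_size (h : Rep G S s) : (s.cut : ℝ) / (s.size : ℝ) = conductance G S := by
  rw [h.cut, h.size, conductance]

variable (G) in
/-- An upper bound for the work of one step of the simulation that leads from `S` to `S'`. -/
def stepCost (S S' : Finset (Fin n)) : ℕ :=
  120 * (Nat.clog 2 n + 1) * (1 + boundary G S + vol G (S ∆ S'))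

/-- An upper bound for the work of listing the output `S`. -/
def outCost (S : Finset (Fin n)) : ℕ := 4 * (Nat.clog 2 n + 1) * (S.card + 1)

/-- The part of a step of the simulation that follows the draw of `Z`. For `Z = 0`, an event of
probability zero, the new set need not be `{y | p(y, S) ≥ Z}`, since only boundary vertices are
inspected. -/
theorem exists_run_applyThreshold (h : Rep G S s) (hS : ∀ y ∈ S, 0 < G.degree y) (Z : ℝ)
    (x : Fin n) :
    ∃ (s' : State n) (w : ℕ), (∀ f : State n → ℕ → ℝ≥0∞, Prog.expect G (do
        Prog.step
        let δ ← Trie.toList s.border []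
        let D ← selectChanges s Z δ
        let s' ← toggleAll D s
        return { s' with pos := x }) f = f s' w) ∧ s'.pos = x ∧
      (0 < Z → Z ≤ 1 → Rep G (levelSet G S Z) s' ∧
        w ≤ 60 * (Nat.clog 2 n + 1) * (1 + boundary G S + vol G (S ∆ levelSet G S Z))) := by
  set δ := Trie.entries s.border with hδ
  set D := (δ.filter fun y => ¬ (y.1 ∈ S ↔ Z ≤ walkProb G y.1 S)).map Prod.fst with hD
  have hDn : D.Nodup := by
    rw [hD]
    exact h.nodup_border.sublist (List.filter_sublist.map Prod.fst)
  obtain ⟨s', h1, h2, -⟩ := det_toggleAll D hDn h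
  have ht := Trie.det_toList (G := G) h.border.good []
  rw [List.append_nil] at ht
  obtain ⟨w, hw, hrun⟩ : Det G (do
        Prog.step
        let δ ← Trie.toList s.border []
        let D ← selectChanges s Z δ
        let s' ← toggleAll D s
        return { s' with pos := x }) { s' with pos := x } _ :=
    Det.step.bind (ht.bind ((det_selectChanges h Z δ).bind (h1.bind (Det.pure _) le_rfl) le_rfl)
      le_rfl) le_rfl
  refine ⟨_, w, hrun, rfl, fun hZ0 hZ1 => ?_⟩
  have hDS : D.toFinset = S ∆ levelSet G S Z := by
    ext y
    simp only [hD, List.mem_toFinset, List.mem_map, List.mem_filter, decide_eq_true_eq,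
      mem_symmDiff, mem_levelSet]
    constructor
    · rintro ⟨a, ⟨-, ha⟩, rfl⟩
      tauto
    · intro hy
      refine ⟨(y, edges G {y} S), ⟨(h.mem_border _).2 ⟨rfl, ?_⟩, by simp; tauto⟩, rfl⟩
      rcases hy with ⟨hy, hyZ⟩ | ⟨hyZ, hy⟩
      · exact Or.inl ⟨hy, edges_lt_degree_of_walkProb_lt_one G hy (hS y hy)
          ((not_le.1 hyZ).trans_le hZ1)⟩
      · exact Or.inr ⟨hy, edges_pos_of_walkProb_pos G hy (hZ0.trans_le hyZ)⟩
  have hrep : S ∆ D.toFinset = levelSet G S Z := by rw [hDS, symmDiff_symmDiff_cancel_left]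
  rw [hrep] at h2
  refine ⟨⟨h2.members, h2.border, h2.cut, h2.size⟩, hw.trans ?_⟩
  have hlen : δ.length ≤ 2 * boundary G S := h.length_border_le
  have hsum : (D.map fun y => G.degree y + 1).sum ≤ 2 * vol G (S ∆ levelSet G S Z) := by
    rw [← List.sum_toFinset _ hDn, hDS, vol, mul_sum]
    refine sum_le_sum fun y hy => ?_
    have : 0 < G.degree y := by
      rcases mem_symmDiff.1 hy with hy | hy
      · exact hS y hy.1
      · exact degree_pos_of_mem_levelSet G hS hZ0 hy.1
    omega
  have e1 : (2 * Nat.clog 2 n + 1) * δ.length ≤ 2 * (Nat.clog 2 n + 1) * (2 * boundary G S) :=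
    Nat.mul_le_mul (by omega) hlen
  have e2 : 9 * (Nat.clog 2 n + 1) * δ.length ≤ 9 * (Nat.clog 2 n + 1) * (2 * boundary G S) :=
    Nat.mul_le_mul le_rfl hlen
  have e3 : 26 * (Nat.clog 2 n + 1) * (D.map fun y => G.degree y + 1).sum ≤
      26 * (Nat.clog 2 n + 1) * (2 * vol G (S ∆ levelSet G S Z)) := Nat.mul_le_mul le_rfl hsum
  rw [← hδ]
  nlinarith [Nat.zero_le (Nat.clog 2 n * boundary G S),
    Nat.zero_le (Nat.clog 2 n * vol G (S ∆ levelSet G S Z))]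

theorem lintegral_ite_lt_half (a b : ℝ≥0∞) :
    ∫⁻ c in Set.Icc (0 : ℝ) 1, (if c < 1 / 2 then a else b) = (a + b) / 2 := by
  have hu : Set.Icc (0 : ℝ) 1 = Set.Ico (0 : ℝ) (1 / 2) ∪ Set.Icc (1 / 2 : ℝ) 1 :=
    (Set.Ico_union_Icc_eq_Icc (by norm_num) (by norm_num)).symm
  have hd : Disjoint (Set.Ico (0 : ℝ) (1 / 2)) (Set.Icc (1 / 2 : ℝ) 1) := by
    rw [Set.disjoint_left]
    intro u h1 h2
    exact absurd h1.2 (not_lt.2 h2.1)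
  have h2 : ENNReal.ofReal (1 / 2) = 2⁻¹ := by
    rw [one_div, ENNReal.ofReal_inv_of_pos (by norm_num)]; simp
  have h3 : (1 : ℝ) - 1 / 2 = 1 / 2 := by norm_num
  rw [hu, lintegral_union measurableSet_Icc hd,
    setLIntegral_congr_fun (g := fun _ => a) measurableSet_Ico fun c hc => if_pos hc.2,
    setLIntegral_congr_fun (g := fun _ => b) measurableSet_Icc fun c hc => if_neg (not_lt.2 hc.1),
    setLIntegral_const, setLIntegral_const, Real.volume_Ico, Real.volume_Icc, sub_zero, h3, h2,
    ENNReal.div_eq_inv_mul, mul_add, mul_comm a, mul_comm b]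

theorem lintegral_Icc_mono {f g : ℝ → ℝ≥0∞} (h : ∀ u, 0 < u → u ≤ 1 → f u ≤ g u) :
    ∫⁻ u in Set.Icc (0 : ℝ) 1, f u ≤ ∫⁻ u in Set.Icc (0 : ℝ) 1, g u := by
  rw [← restrict_Ioc_eq_restrict_Icc]
  exact setLIntegral_mono' measurableSet_Ioc fun u hu => h u hu.1 hu.2

theorem lintegral_Icc_congr {f g : ℝ → ℝ≥0∞} (h : ∀ u, 0 < u → u ≤ 1 → f u = g u) :
    ∫⁻ u in Set.Icc (0 : ℝ) 1, f u = ∫⁻ u in Set.Icc (0 : ℝ) 1, g u :=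
  le_antisymm (lintegral_Icc_mono fun u h0 h1 => (h u h0 h1).le)
    (lintegral_Icc_mono fun u h0 h1 => (h u h0 h1).ge)

/-- A step of the simulation: `σ u y` and `ω u y` are the resulting state and a part of the work if
the particle moves to `y` and `Z = u * p(y, S)`. -/
theorem exists_expect_simulateStep (h : Rep G S s) (hS : ∀ y ∈ S, 0 < G.degree y) :
    ∃ (σ : ℝ → Fin n → State n) (ω : ℝ → Fin n → ℕ),
      (∀ F : State n → ℕ → ℝ≥0∞, Prog.expect G (simulateStep s) F =
        ((∑ y ∈ G.neighborFinset s.pos,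
            ∫⁻ u in Set.Icc (0 : ℝ) 1, F (σ u y) (ω u y + 1)) / (G.degree s.pos : ℝ≥0∞) +
          ∫⁻ u in Set.Icc (0 : ℝ) 1, F (σ u s.pos) (ω u s.pos)) / 2) ∧
      (∀ u y, (σ u y).pos = y) ∧
      ∀ u y, 0 < u → u ≤ 1 → 0 < walkProb G y S →
        Rep G (levelSet G S (u * walkProb G y S)) (σ u y) ∧
        ω u y + 2 ≤ stepCost G S (levelSet G S (u * walkProb G y S)) := by
  choose σ ω h1 h2 h3 using fun (u : ℝ) (y : Fin n) =>
    exists_run_applyThreshold h hS (u * walkProb G y S) y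
  choose wp hwp hwp' using fun y => det_computeWalkProb h y
  refine ⟨σ, fun u y => ω u y + (wp y + 3), fun F => ?_, h2, fun u y hu0 hu1 hp => ?_⟩
  · -- the run after the walk particle has moved to `x`
    have htail : ∀ (x : Fin n) (F : State n → ℕ → ℝ≥0∞), Prog.expect G (do
        let p ← computeWalkProb s.members s.border x
        let u ← Prog.randomUnit
        let Z := u * p
        Prog.step
        let δ ← Trie.toList s.border []
        let D ← selectChanges s Z δ
        let s' ← toggleAll D s
        return { s' with pos := x }) F =
        ∫⁻ u in Set.Icc (0 : ℝ) 1, F (σ u x) (ω u x + (wp x + 1)) := by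
      intro x F
      rw [expect_bind, hwp', expect_bind]
      refine lintegral_congr fun u => ?_
      refine (h1 u x fun b w => F b (wp x + (0 + 1 + w))).trans ?_
      congr 1
      ring
    rw [simulateStep, expect_bind]
    refine Eq.trans (lintegral_congr fun c => ?_) (lintegral_ite_lt_half
      ((∑ y ∈ G.neighborFinset s.pos, ∫⁻ u in Set.Icc (0 : ℝ) 1,
        F (σ u y) (ω u y + (wp y + 3) + 1)) / (G.degree s.pos : ℝ≥0∞))
      (∫⁻ u in Set.Icc (0 : ℝ) 1, F (σ u s.pos) (ω u s.pos + (wp s.pos + 3))))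
    refine (expect_bind G _ _ _).trans ?_
    change Prog.expect G (ite (c < 1 / 2) _ _) _ = _
    split_ifs
    · rw [expect_bind]
      simp only [htail]
      simp only [Prog.randomNeighbor, Prog.expect]
      congr 1
      refine sum_congr rfl fun y _ => lintegral_congr fun u => ?_
      congr 1
      ring
    · rw [expect_bind]
      simp only [htail]
      rw [expect_pure]
      refine lintegral_congr fun u => ?_
      congr 1
      ring
  · have hZ0 : 0 < u * walkProb G y S := by positivity
    have hZ1 : u * walkProb G y S ≤ 1 :=
      mul_le_one₀ hu1 hp.le (walkProb_le_one G y S)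
    obtain ⟨h4, h5⟩ := h3 u y hZ0 hZ1
    refine ⟨h4, ?_⟩
    have := hwp y
    unfold stepCost
    nlinarith [Nat.zero_le (Nat.clog 2 n * boundary G S),
      Nat.zero_le (Nat.clog 2 n * vol G (S ∆ levelSet G S (u * walkProb G y S)))]

theorem expect_output (h : Rep G S s) : ∃ w ≤ outCost S, ∀ f : List (Fin n) → ℕ → ℝ≥0∞,
    Prog.expect G (do Prog.step; Trie.toList s.members []) f = f (Trie.entries s.members) w := by
  have ht := Trie.det_toList (G := G) h.members.good []
  rw [List.append_nil] at ht
  obtain ⟨w, hw, hrun⟩ := Det.step.bind (q := fun _ => Trie.toList s.members []) ht le_rfl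
  refine ⟨w, hw.trans ?_, hrun⟩
  rw [h.length_members, outCost]
  nlinarith [Nat.zero_le (Nat.clog 2 n * S.card)]

theorem simulate_succ_of_lt (h : Rep G S s) (hlt : conductance G S < θ) (r : ℕ) :
    simulate θ (r + 1) s = (do Prog.step; Trie.toList s.members []) := by
  rw [simulate]
  simp only [h.cut_div_size, if_pos hlt]

theorem simulate_succ_of_not_lt (h : Rep G S s) (hlt : ¬ conductance G S < θ) (r : ℕ) :
    simulate θ (r + 1) s = (do Prog.step; let s' ← simulateStep s; simulate θ r s') := by
  rw [simulate]
  simp only [h.cut_div_size, if_neg hlt]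

theorem mem_levelSet_mul {u : ℝ} (hu : u ≤ 1) (y : Fin n) :
    y ∈ levelSet G S (u * walkProb G y S) := by
  rw [mem_levelSet]
  exact mul_le_of_le_one_left (walkProb_nonneg G y S) hu

theorem walkProb_pos_of_adj {x y : Fin n} (hx : x ∈ S) (hy : y ∈ G.neighborFinset x) :
    0 < walkProb G y S := by
  refine walkProb_pos_of_edges_pos G ?_
  rw [edges_singleton, card_pos]
  refine ⟨x, ?_⟩
  simp only [mem_filter, SimpleGraph.mem_neighborFinset] at hy ⊢
  exact ⟨hy.symm, hx⟩

/-- The expected value of a function of the output of the simulation. -/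
theorem expect_simulate_eq (g : Finset (Fin n) → ℝ≥0∞) (r : ℕ) (h : Rep G S s)
    (hS : ∀ y ∈ S, 0 < G.degree y) (hx : s.pos ∈ S) :
    Prog.expect G (simulate θ r s) (fun l _ => g l.toFinset) =
      jointVal G θ (fun S _ => g S) r S s.pos := by
  induction r generalizing S s with
  | zero =>
      obtain ⟨w, -, hrun⟩ := expect_output h
      rw [simulate, hrun, h.toFinset_members, jointVal]
  | succ r ih =>
      rw [jointVal]
      split_ifs with hlt
      · obtain ⟨w, -, hrun⟩ := expect_output h
        rw [simulate_succ_of_lt h hlt, hrun, h.toFinset_members]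
      · obtain ⟨σ, ω, h1, h2, h3⟩ := exists_expect_simulateStep h hS
        have key : ∀ y, 0 < walkProb G y S →
            ∫⁻ u in Set.Icc (0 : ℝ) 1,
              Prog.expect G (simulate θ r (σ u y)) (fun l _ => g l.toFinset) =
            ∫⁻ u in Set.Icc (0 : ℝ) 1,
              jointVal G θ (fun S _ => g S) r (levelSet G S (u * walkProb G y S)) y := by
          intro y hp
          refine lintegral_Icc_congr fun u hu0 hu1 => ?_
          have hmem := mem_levelSet_mul (G := G) (S := S) hu1 y
          have := ih (h3 u y hu0 hu1 hp).1
            (fun z hz => degree_pos_of_mem_levelSet G hS (by positivity) hz)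
            (by rw [h2]; exact hmem)
          rw [this, h2]
        rw [simulate_succ_of_not_lt h hlt, expect_bind]
        simp only [Prog.step, Prog.expect]
        rw [expect_bind, h1, jointStep, key _ (walkProb_pos_of_mem G hx)]
        congr 3
        exact sum_congr rfl fun y hy => key y (walkProb_pos_of_adj hx hy)

variable (G) in
/-- An upper bound for the expected work/volume ratio of a run of the simulation from the set `S`
with the particle at `x`, if the work `w` has been performed before. -/
noncomputable def workVal (θ : ℝ) : ℕ → Finset (Fin n) → Fin n → ℕ → ℝ≥0∞
  | 0, S, _, w => ((w + outCost S : ℕ) : ℝ≥0∞) / (vol G S : ℝ≥0∞)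
  | r + 1, S, x, w => if conductance G S < θ then
      ((w + outCost S : ℕ) : ℝ≥0∞) / (vol G S : ℝ≥0∞)
    else jointStep G S x fun S' x' => workVal θ r S' x' (w + stepCost G S S')

theorem expect_output_le (h : Rep G S s) (w₀ : ℕ) :
    Prog.expect G (do Prog.step; Trie.toList s.members [])
        (fun l w => ((w₀ + w : ℕ) : ℝ≥0∞) / (vol G l.toFinset : ℝ≥0∞)) ≤
      ((w₀ + outCost S : ℕ) : ℝ≥0∞) / (vol G S : ℝ≥0∞) := by
  obtain ⟨w, hw, hrun⟩ := expect_output h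
  rw [hrun, h.toFinset_members]
  exact ENNReal.div_le_div_right (Nat.cast_le.2 (by omega)) _

/-- The work/volume ratio of the simulation, if the work `w₀` has been performed before. -/
theorem expect_simulate_le (r : ℕ) (h : Rep G S s) (hS : ∀ y ∈ S, 0 < G.degree y)
    (hx : s.pos ∈ S) (w₀ : ℕ) :
    Prog.expect G (simulate θ r s)
        (fun l w => ((w₀ + w : ℕ) : ℝ≥0∞) / (vol G l.toFinset : ℝ≥0∞)) ≤
      workVal G θ r S s.pos w₀ := by
  induction r generalizing S s w₀ with
  | zero =>
      rw [simulate, workVal]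
      exact expect_output_le h w₀
  | succ r ih =>
      rw [workVal]
      split_ifs with hlt
      · rw [simulate_succ_of_lt h hlt]
        exact expect_output_le h w₀
      · obtain ⟨σ, ω, h1, h2, h3⟩ := exists_expect_simulateStep h hS
        have key : ∀ y (e : ℕ), 0 < walkProb G y S → e ≤ 1 →
            ∫⁻ u in Set.Icc (0 : ℝ) 1, Prog.expect G (simulate θ r (σ u y)) (fun l w =>
              ((w₀ + (0 + 1 + (ω u y + e + w)) : ℕ) : ℝ≥0∞) / (vol G l.toFinset : ℝ≥0∞)) ≤
            ∫⁻ u in Set.Icc (0 : ℝ) 1,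
              workVal G θ r (levelSet G S (u * walkProb G y S)) y
                (w₀ + stepCost G S (levelSet G S (u * walkProb G y S))) := by
          intro y e hp he
          refine lintegral_Icc_mono fun u hu0 hu1 => ?_
          have hmem := mem_levelSet_mul (G := G) (S := S) hu1 y
          obtain ⟨h4, h5⟩ := h3 u y hu0 hu1 hp
          have hS' : ∀ z ∈ levelSet G S (u * walkProb G y S), 0 < G.degree z :=
            fun z hz => degree_pos_of_mem_levelSet G hS (by positivity) hz
          have := ih h4 hS' (by rw [h2]; exact hmem)
            (w₀ + stepCost G S (levelSet G S (u * walkProb G y S)))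
          rw [h2] at this
          refine le_trans (expect_mono G _ fun l w => ?_) this
          exact ENNReal.div_le_div_right (Nat.cast_le.2 (by omega)) _
        rw [simulate_succ_of_not_lt h hlt, expect_bind]
        simp only [Prog.step, Prog.expect]
        rw [expect_bind, h1, jointStep]
        refine ENNReal.div_le_div_right (add_le_add (ENNReal.div_le_div_right
          (sum_le_sum fun y hy => ?_) _) ?_) _
        · exact key y 1 (walkProb_pos_of_adj hx hy) le_rfl
        · exact key _ 0 (walkProb_pos_of_mem G hx) (by norm_num)

theorem rep_empty (v : Fin n) :
    Rep G ∅ { members := Trie.empty, border := Trie.empty, cut := 0, size := 0, pos := v } := by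
  have he : ∀ y, edges G {y} ∅ = 0 := fun y => by simp [edges_singleton]
  refine ⟨⟨by simp [Trie.Good], by simp [Trie.get]⟩,
    ⟨by simp [Trie.Good], by simp [Trie.get, OnBorder, he]⟩, ?_, by simp [vol]⟩
  simp [boundary_eq_sum]

/-- The first call of `toggle` produces the set `{v}`. -/
theorem exists_expect_generateSample (volV : ℕ) (v : Fin n) (T : ℕ) :
    ∃ s : State n, Rep G {v} s ∧ s.pos = v ∧
      ∃ w ≤ 25 * (Nat.clog 2 n + 1) * (G.degree v + 1) + 1, ∀ f : List (Fin n) → ℕ → ℝ≥0∞,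
        Prog.expect G (generateSample volV v T) f =
          Prog.expect G (simulate (threshold volV T) T s) (fun l w' => f l (w + w')) := by
  obtain ⟨s, ⟨w, hw, hrun⟩, h2, h3⟩ := det_toggle (rep_empty (G := G) v) v
  rw [← bot_eq_empty, bot_symmDiff] at h2
  refine ⟨s, h2, h3, w + 1, by omega, fun f => ?_⟩
  rw [generateSample, expect_bind]
  simp only [Prog.step, Prog.expect]
  rw [expect_bind, hrun]
  congr 1
  funext l w'
  congr 1
  ring

theorem expect_evoCut_of_timeLimit_eq_zero (volV : ℕ) (v : Fin n) {φ : ℝ} (hT : timeLimit φ = 0)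
    (f : List (Fin n) → ℕ → ℝ≥0∞) : Prog.expect G (evoCut volV v φ) f = f [v] 1 := by
  rw [evoCut, expect_bind]
  simp only [hT, if_true, Prog.step, Prog.expect, expect_pure]

/-- The expected value of a function of the output of `EvoCut`. -/
theorem expect_evoCut_eq_stopVal (volV : ℕ) {v : Fin n} (hv : 0 < G.degree v) (φ : ℝ)
    (g : Finset (Fin n) → ℝ≥0∞) :
    Prog.expect G (evoCut volV v φ) (fun l _ => g l.toFinset) =
      stopVal G (threshold volV (timeLimit φ)) g (timeLimit φ) {v} := by
  by_cases hT : timeLimit φ = 0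
  · rw [expect_evoCut_of_timeLimit_eq_zero volV v hT, hT, stopVal]
    simp
  · obtain ⟨s, h1, h2, w, -, h3⟩ := exists_expect_generateSample (G := G) volV v (timeLimit φ)
    rw [evoCut, expect_bind]
    simp only [hT, if_false, Prog.step, Prog.expect]
    rw [h3, expect_simulate_eq g _ h1 (by simpa using hv) (by simp [h2]), h2,
      jointVal_singleton_of_set _ _ hv]

end Simulation

/-! ### The expected work/volume ratio -/

section Work

open scoped symmDiff

variable {n : ℕ} {G : SimpleGraph (Fin n)} [DecidableRel G.Adj] {S : Finset (Fin n)} {θ : ℝ}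

theorem sum_espKernel (S : Finset (Fin n)) : ∑ S' : Finset (Fin n), espKernel G S S' = 1 := by
  have h := sum_espKernel_mul G S fun _ => 1
  simp only [mul_one] at h
  rw [h]
  simp

theorem card_le_vol (hS : ∀ y ∈ S, 0 < G.degree y) : S.card ≤ vol G S := by
  rw [card_eq_sum_ones]
  exact sum_le_sum fun y hy => hS y hy

/-- The expected work of one step of the evolving set process is of the order of the boundary. The
constant overhead of a step is absorbed since the boundary is not empty. -/
theorem sum_espKernel_mul_stepCost_le (h : 0 < boundary G S) :
    ∑ S' : Finset (Fin n), espKernel G S S' * (stepCost G S S' : ℝ≥0∞) ≤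
      ((360 * (Nat.clog 2 n + 1) * boundary G S : ℕ) : ℝ≥0∞) := by
  have h1 : ∀ S' : Finset (Fin n), espKernel G S S' * (stepCost G S S' : ℝ≥0∞) =
      ((120 * (Nat.clog 2 n + 1) : ℕ) : ℝ≥0∞) * (espKernel G S S' * ((1 + boundary G S : ℕ) : ℝ≥0∞) +
        espKernel G S S' * (vol G (S ∆ S') : ℝ≥0∞)) := by
    intro S'
    rw [stepCost]
    push_cast
    ring
  simp_rw [h1]
  rw [← mul_sum, sum_add_distrib, ← sum_mul, sum_espKernel, one_mul,
    sum_espKernel_mul_vol_symmDiff, ← Nat.cast_add, ← Nat.cast_mul, Nat.cast_le]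
  have e : 360 * (Nat.clog 2 n + 1) * boundary G S =
      120 * (Nat.clog 2 n + 1) * (3 * boundary G S) := by ring
  rw [e]
  exact Nat.mul_le_mul le_rfl (by omega)

variable (G) in
/-- The potential that bounds the expected work of `r` further steps from the set `S`, divided by
the volume of `S` and by the cost of a dictionary operation. The parameter `t` balances the two
terms in `φ ≤ t φ² + 1 / (4 t)`. -/
noncomputable def workPotential (t : ℝ) (r : ℕ) (S : Finset (Fin n)) : ℝ≥0∞ :=
  ENNReal.ofReal (1 + 45 * (r / (4 * t))) +
    ENNReal.ofReal (135 * t) * ENNReal.ofReal (Real.log ((vol G univ : ℝ) / vol G S))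

theorem conductance_add_sum_workPotential_le {t : ℝ} (ht : 0 < t) (r : ℕ) (hS : 0 < vol G S) :
    ENNReal.ofReal (45 * conductance G S) +
        ∑ S' : Finset (Fin n), biasedKernel G S S' * workPotential G t r S' ≤
      workPotential G t (r + 1) S := by
  have h1 : ∀ S' : Finset (Fin n), biasedKernel G S S' * workPotential G t r S' =
      biasedKernel G S S' * ENNReal.ofReal (1 + 45 * (r / (4 * t))) +
      ENNReal.ofReal (135 * t) * (biasedKernel G S S' *
        ENNReal.ofReal (Real.log ((vol G univ : ℝ) / vol G S'))) := fun S' => by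
    rw [workPotential]; ring
  simp_rw [h1]
  rw [sum_add_distrib, ← sum_mul, sum_biasedKernel hS, one_mul, ← mul_sum, workPotential]
  set φ := conductance G S
  have hφ : 0 ≤ φ := conductance_nonneg S
  have h2 : φ ≤ t * φ ^ 2 + 1 / (4 * t) := by
    have h : t * φ ^ 2 + 1 / (4 * t) - φ = (2 * t * φ - 1) ^ 2 / (4 * t) := by
      field_simp; ring
    have : 0 ≤ (2 * t * φ - 1) ^ 2 / (4 * t) := by positivity
    linarith
  have h3 : ENNReal.ofReal (45 * φ) ≤ ENNReal.ofReal (45 * (1 / (4 * t))) +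
      ENNReal.ofReal (135 * t) * ENNReal.ofReal (φ ^ 2 / 3) := by
    rw [← ENNReal.ofReal_mul (by positivity), ← ENNReal.ofReal_add (by positivity) (by positivity)]
    exact ENNReal.ofReal_le_ofReal (by linarith)
  have h4 : ENNReal.ofReal (1 + 45 * (((r + 1 : ℕ) : ℝ) / (4 * t))) =
      ENNReal.ofReal (1 + 45 * (r / (4 * t))) + ENNReal.ofReal (45 * (1 / (4 * t))) := by
    rw [← ENNReal.ofReal_add (by positivity) (by positivity)]
    congr 1
    push_cast
    ring
  rw [h4]
  calc ENNReal.ofReal (45 * φ) + (ENNReal.ofReal (1 + 45 * (r / (4 * t))) +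
        ENNReal.ofReal (135 * t) * ∑ S' : Finset (Fin n), biasedKernel G S S' *
          ENNReal.ofReal (Real.log ((vol G univ : ℝ) / vol G S')))
      ≤ (ENNReal.ofReal (45 * (1 / (4 * t))) +
          ENNReal.ofReal (135 * t) * ENNReal.ofReal (φ ^ 2 / 3)) +
        (ENNReal.ofReal (1 + 45 * (r / (4 * t))) +
        ENNReal.ofReal (135 * t) * ∑ S' : Finset (Fin n), biasedKernel G S S' *
          ENNReal.ofReal (Real.log ((vol G univ : ℝ) / vol G S'))) := by gcongr
    _ = ENNReal.ofReal (1 + 45 * (r / (4 * t))) + ENNReal.ofReal (45 * (1 / (4 * t))) +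
        ENNReal.ofReal (135 * t) * (∑ S' : Finset (Fin n), biasedKernel G S S' *
          ENNReal.ofReal (Real.log ((vol G univ : ℝ) / vol G S')) +
          ENNReal.ofReal (φ ^ 2 / 3)) := by ring
    _ ≤ _ := by
        gcongr
        exact sum_biasedKernel_mul_log_le hS

theorem sum_degree_mul_output_le {t : ℝ} (ht : 0 < t) (r : ℕ)
    (hS : ∀ y ∈ S, 0 < G.degree y) (w : ℕ) :
    ∑ x ∈ S, (G.degree x : ℝ≥0∞) * (((w + outCost S : ℕ) : ℝ≥0∞) / (vol G S : ℝ≥0∞)) ≤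
      w + ((8 * (Nat.clog 2 n + 1) * vol G S : ℕ) : ℝ≥0∞) * workPotential G t r S := by
  rcases S.eq_empty_or_nonempty with rfl | hne
  · simp
  have hcard := card_le_vol hS
  have hpos : 0 < vol G S := (card_pos.2 hne).trans_le hcard
  have hvol : (vol G S : ℝ≥0∞) ≠ 0 := by exact_mod_cast hpos.ne'
  have h1 : 1 ≤ workPotential G t r S := by
    refine le_trans ?_ le_self_add
    rw [ENNReal.one_le_ofReal]
    have : 0 ≤ 45 * ((r : ℝ) / (4 * t)) := by positivity
    linarith
  have h2 : outCost S ≤ 8 * (Nat.clog 2 n + 1) * vol G S := by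
    have e : 8 * (Nat.clog 2 n + 1) * vol G S = 4 * (Nat.clog 2 n + 1) * (2 * vol G S) := by ring
    rw [outCost, e]
    exact Nat.mul_le_mul le_rfl (by omega)
  rw [← sum_mul, ← natCast_vol, ENNReal.mul_div_cancel hvol (ENNReal.natCast_ne_top _),
    Nat.cast_add]
  gcongr
  calc (outCost S : ℝ≥0∞) ≤ ((8 * (Nat.clog 2 n + 1) * vol G S : ℕ) : ℝ≥0∞) := Nat.cast_le.2 h2
    _ = ((8 * (Nat.clog 2 n + 1) * vol G S : ℕ) : ℝ≥0∞) * 1 := (mul_one _).symm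
    _ ≤ _ := by gcongr

/-- Multiplying the ratio of work and volume by the volume turns the volume-biased process into the
unbiased one, in which a step costs of the order of `∂(S) = φ(S) μ(S)` in expectation. -/
theorem sum_degree_mul_workVal_le (hθ : 0 < θ) {t : ℝ} (ht : 0 < t) (r : ℕ)
    (hS : ∀ y ∈ S, 0 < G.degree y) (w : ℕ) :
    ∑ x ∈ S, (G.degree x : ℝ≥0∞) * workVal G θ r S x w ≤
      w + ((8 * (Nat.clog 2 n + 1) * vol G S : ℕ) : ℝ≥0∞) * workPotential G t r S := by
  induction r generalizing S w with
  | zero => exact sum_degree_mul_output_le ht 0 hS w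
  | succ r ih =>
      simp only [workVal]
      split_ifs with hlt
      · exact sum_degree_mul_output_le ht (r + 1) hS w
      · rcases S.eq_empty_or_nonempty with rfl | hne
        · simp
        have hpos : 0 < vol G S := (card_pos.2 hne).trans_le (card_le_vol hS)
        have hb : 0 < boundary G S := by
          rcases Nat.eq_zero_or_pos (boundary G S) with h0 | h0
          · refine absurd ?_ hlt
            simp [conductance, h0, hθ]
          · exact h0
        have hφ : (boundary G S : ℝ) = vol G S * conductance G S := by
          have : (vol G S : ℝ) ≠ 0 := by exact_mod_cast hpos.ne'
          unfold conductance; field_simp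
        rw [sum_degree_mul_jointStep S fun S' x' => workVal G θ r S' x' (w + stepCost G S S')]
        set L := Nat.clog 2 n + 1 with hL
        calc ∑ S' : Finset (Fin n), espKernel G S S' *
              ∑ x ∈ S', (G.degree x : ℝ≥0∞) * workVal G θ r S' x (w + stepCost G S S')
            ≤ ∑ S' : Finset (Fin n), espKernel G S S' * (((w + stepCost G S S' : ℕ) : ℝ≥0∞) +
                ((8 * L * vol G S' : ℕ) : ℝ≥0∞) * workPotential G t r S') := by
              refine sum_le_sum fun S' _ => ?_
              rcases eq_or_ne (espKernel G S S') 0 with h | h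
              · rw [h, zero_mul, zero_mul]
              · have hS' := degree_pos_of_espKernel_ne_zero G hS h
                gcongr
                exact ih hS' _
          _ = ∑ S' : Finset (Fin n), espKernel G S S' * (w : ℝ≥0∞) +
                ∑ S' : Finset (Fin n), espKernel G S S' * (stepCost G S S' : ℝ≥0∞) +
                ((8 * L : ℕ) : ℝ≥0∞) * ∑ S' : Finset (Fin n), espKernel G S S' *
                  (vol G S' * workPotential G t r S') := by
              rw [mul_sum, ← sum_add_distrib, ← sum_add_distrib]
              refine sum_congr rfl fun S' _ => ?_
              push_cast
              ring
          _ ≤ w + ((360 * L * boundary G S : ℕ) : ℝ≥0∞) + ((8 * L : ℕ) : ℝ≥0∞) *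
                ((vol G S : ℝ≥0∞) * ∑ S' : Finset (Fin n), biasedKernel G S S' *
                  workPotential G t r S') := by
              rw [← sum_mul, sum_espKernel, one_mul, vol_mul_sum_biasedKernel hpos]
              gcongr
              exact sum_espKernel_mul_stepCost_le hb
          _ = w + ((8 * L * vol G S : ℕ) : ℝ≥0∞) * (ENNReal.ofReal (45 * conductance G S) +
                ∑ S' : Finset (Fin n), biasedKernel G S S' * workPotential G t r S') := by
              have e : ((360 * L * boundary G S : ℕ) : ℝ≥0∞) =
                  ((8 * L * vol G S : ℕ) : ℝ≥0∞) * ENNReal.ofReal (45 * conductance G S) := by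
                rw [← ENNReal.ofReal_natCast, ← ENNReal.ofReal_natCast,
                  ← ENNReal.ofReal_mul (by positivity)]
                congr 1
                push_cast
                rw [hφ]
                ring
              rw [e]
              push_cast
              ring
          _ ≤ _ := by
              gcongr
              exact conductance_add_sum_workPotential_le ht r hpos

theorem clog_add_one_le (hn : 2 ≤ n) : ((Nat.clog 2 n + 1 : ℕ) : ℝ) ≤ 5 * Real.log n := by
  have h1 : 2 ^ (Nat.clog 2 n - 1) < n := Nat.pow_pred_clog_lt_self (by norm_num) hn
  have hc : 0 < Nat.clog 2 n := Nat.clog_pos (by norm_num) hn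
  have h2 : ((Nat.clog 2 n - 1 : ℕ) : ℝ) * Real.log 2 ≤ Real.log n := by
    rw [← Real.log_pow]
    exact Real.log_le_log (by positivity) (by exact_mod_cast h1.le)
  rw [Nat.cast_sub hc] at h2
  have h3 : Real.log 2 ≤ Real.log n := Real.log_le_log (by norm_num) (by exact_mod_cast hn)
  have h4 := Real.log_two_gt_d9
  push_cast at h2 ⊢
  nlinarith

theorem two_le_of_degree_pos {v : Fin n} (hv : 0 < G.degree v) : 2 ≤ n := by
  have := G.degree_lt_card_verts v
  rw [Fintype.card_fin] at this
  omega

theorem two_le_vol_univ {v : Fin n} (hv : 0 < G.degree v) : 2 ≤ vol G univ := by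
  obtain ⟨u, hu⟩ := (G.degree_pos_iff_exists_adj v).1 hv
  have h1 : 0 < G.degree u := (G.degree_pos_iff_exists_adj u).2 ⟨v, hu.symm⟩
  have h2 : vol G {v, u} = G.degree v + G.degree u := sum_pair hu.ne
  have := vol_mono G (subset_univ {v, u})
  omega

theorem log_vol_univ_le (hn : 2 ≤ n) : Real.log (vol G univ) ≤ 2 * Real.log n := by
  have h1 : vol G univ ≤ n ^ 2 := by
    calc vol G univ ≤ ∑ _x : Fin n, n := sum_le_sum fun x _ => by
          have := G.degree_lt_card_verts x
          rw [Fintype.card_fin] at this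
          omega
      _ = n ^ 2 := by simp [sq]
  rcases Nat.eq_zero_or_pos (vol G univ) with h0 | h0
  · rw [h0, Nat.cast_zero, Real.log_zero]
    have := Real.log_nonneg (x := n) (by exact_mod_cast (by omega : 1 ≤ n))
    linarith
  · have : Real.log (vol G univ) ≤ Real.log ((n : ℝ) ^ 2) :=
      Real.log_le_log (by exact_mod_cast h0) (by exact_mod_cast h1)
    rwa [Real.log_pow, Nat.cast_ofNat] at this

theorem timeLimit_le {φ : ℝ} (hφ : 0 < φ) : (timeLimit φ : ℝ) ≤ φ⁻¹ / 100 :=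
  Nat.floor_le (by positivity)

theorem threshold_pos {m T : ℕ} (hm : 2 ≤ m) (hT : 0 < T) : 0 < threshold m T := by
  have h1 : 0 < Real.log m := Real.log_pos (by exact_mod_cast (by omega : 1 < m))
  have h2 : (0 : ℝ) < T := by exact_mod_cast hT
  exact Real.sqrt_pos.2 (by positivity)

theorem expect_work_div_vol_le {v : Fin n} (hv : 0 < G.degree v) {φ : ℝ}
    (hT : 0 < timeLimit φ) :
    Prog.expect G (evoCut (vol G univ) v φ)
        (fun l w => (w : ℝ≥0∞) / (vol G l.toFinset : ℝ≥0∞)) ≤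
      ENNReal.ofReal (((Nat.clog 2 n + 1 : ℕ) : ℝ) *
        (60 + 1176 * √(timeLimit φ * Real.log (vol G univ)))) := by
  set T := timeLimit φ with hTdef
  set m := vol G univ with hm
  have hm2 : 2 ≤ m := two_le_vol_univ hv
  have hTR : (0 : ℝ) < T := by exact_mod_cast hT
  have hlog : 0 < Real.log m := Real.log_pos (by exact_mod_cast (by omega : 1 < m))
  obtain ⟨s, h1, h2, w, hw, h3⟩ := exists_expect_generateSample (G := G) m v T
  have hd : (G.degree v : ℝ≥0∞) ≠ 0 := by exact_mod_cast hv.ne'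
  have hprog : Prog.expect G (evoCut m v φ)
      (fun l w => (w : ℝ≥0∞) / (vol G l.toFinset : ℝ≥0∞)) ≤
      workVal G (threshold m T) T {v} v (1 + w) := by
    rw [evoCut, Prog.expect_bind]
    simp only [hT.ne', if_false, Prog.step, Prog.expect, ← hTdef]
    rw [h3]
    have := expect_simulate_le (θ := threshold m T) T h1 (by simpa using hv) (by simp [h2]) (1 + w)
    rw [h2] at this
    refine le_trans (Prog.expect_mono G _ fun l w' => ?_) this
    exact ENNReal.div_le_div_right (Nat.cast_le.2 (by omega)) _
  refine hprog.trans ?_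
  rw [← ENNReal.mul_le_mul_iff_right hd (ENNReal.natCast_ne_top _)]
  -- the value of `t` for which both terms of the potential are `√(T log m)`, up to constants
  set t := √(T / Real.log m) with ht
  have ht0 : 0 < t := Real.sqrt_pos.2 (by positivity)
  have hwork := sum_degree_mul_workVal_le (threshold_pos hm2 hT) ht0 T (S := {v})
    (by simpa using hv) (1 + w)
  have hvol : vol G {v} = G.degree v := by simp [vol]
  rw [sum_singleton, hvol] at hwork
  refine hwork.trans ?_
  set R := √(T * Real.log m) with hR
  have hsq : √(Real.log m) * √(Real.log m) = Real.log m := Real.mul_self_sqrt hlog.le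
  have hsT : √(T : ℝ) * √(T : ℝ) = T := Real.mul_self_sqrt hTR.le
  have hsl0 : 0 < √(Real.log m) := Real.sqrt_pos.2 hlog
  have hsT0 : 0 < √(T : ℝ) := Real.sqrt_pos.2 hTR
  have htR : t * Real.log m = R := by
    rw [ht, hR, Real.sqrt_div hTR.le, Real.sqrt_mul hTR.le]
    nth_rewrite 2 [← hsq]
    field_simp
  have hTt : (T : ℝ) / t = R := by
    rw [ht, hR, Real.sqrt_div hTR.le, Real.sqrt_mul hTR.le]
    nth_rewrite 1 [← hsT]
    field_simp
  have hpot : workPotential G t T {v} ≤ ENNReal.ofReal (1 + 147 * R) := by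
    have hd1 : (1 : ℝ) ≤ G.degree v := by exact_mod_cast hv
    have hm0 : (0 : ℝ) < m := by exact_mod_cast (by omega : 0 < m)
    have h4 : Real.log ((m : ℝ) / G.degree v) ≤ Real.log m :=
      Real.log_le_log (by positivity) (div_le_self hm0.le hd1)
    have hR0 : 0 ≤ R := Real.sqrt_nonneg _
    rw [workPotential, hvol, ← ENNReal.ofReal_mul (by positivity)]
    have h5 : 45 * ((T : ℝ) / (4 * t)) = 45 / 4 * R := by rw [← hTt]; ring
    refine (add_le_add le_rfl (ENNReal.ofReal_le_ofReal (mul_le_mul_of_nonneg_left h4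
      (by positivity)))).trans ?_
    rw [← ENNReal.ofReal_add (by positivity) (by positivity), h5, mul_assoc, htR]
    exact ENNReal.ofReal_le_ofReal (by linarith)
  refine (add_le_add le_rfl (mul_le_mul' le_rfl hpot)).trans ?_
  rw [← ENNReal.ofReal_natCast, ← ENNReal.ofReal_natCast, ← ENNReal.ofReal_natCast,
    ← ENNReal.ofReal_mul (by positivity), ← ENNReal.ofReal_mul (by positivity),
    ← ENNReal.ofReal_add (by positivity) (by positivity)]
  refine ENNReal.ofReal_le_ofReal ?_
  have hw' : 1 + w ≤ 52 * (Nat.clog 2 n + 1) * G.degree v := by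
    have : 25 * (Nat.clog 2 n + 1) * (G.degree v + 1) + 2 ≤
        25 * (Nat.clog 2 n + 1) * (2 * G.degree v) + 2 * ((Nat.clog 2 n + 1) * G.degree v) := by
      have e1 : 25 * (Nat.clog 2 n + 1) * (G.degree v + 1) ≤
        25 * (Nat.clog 2 n + 1) * (2 * G.degree v) := Nat.mul_le_mul le_rfl (by omega)
      have e2 : 0 < (Nat.clog 2 n + 1) * G.degree v := by positivity
      omega
    linarith
  have hw'' : ((1 + w : ℕ) : ℝ) ≤ ((52 * (Nat.clog 2 n + 1) * G.degree v : ℕ) : ℝ) :=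
    Nat.cast_le.2 hw'
  push_cast at hw'' ⊢
  linarith

/-- The work/volume ratio is `O(φ ^ (-1/2) log ^ (3/2) n)`. -/
theorem expect_work_div_vol_le_rpow {v : Fin n} (hv : 0 < G.degree v) {φ : ℝ} (hφ : 0 < φ)
    (hφ1 : φ < 1) :
    Prog.expect G (evoCut (vol G univ) v φ)
        (fun l w => (w : ℝ≥0∞) / (vol G l.toFinset : ℝ≥0∞)) ≤
      ENNReal.ofReal (2000 * (φ ^ (-(1 / 2) : ℝ) * Real.log (n : ℝ) ^ (3 / 2 : ℝ))) := by
  have hn := two_le_of_degree_pos hv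
  have hlog2 := Real.log_two_gt_d9
  have hlogn : Real.log 2 ≤ Real.log n := Real.log_le_log (by norm_num) (by exact_mod_cast hn)
  set a := φ ^ (-(1 / 2) : ℝ) with ha
  have ha0 : 0 < a := by positivity
  have ha1 : 1 ≤ a := Real.one_le_rpow_of_pos_of_le_one_of_nonpos hφ hφ1.le (by norm_num)
  have ha2 : a ^ 2 = φ⁻¹ := by
    rw [ha, ← Real.rpow_natCast, ← Real.rpow_mul hφ.le, ← Real.rpow_neg_one]
    norm_num
  set l := Real.log (n : ℝ) with hl
  have hl0 : 0 < l := by linarith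
  set b := √l with hb
  have hb2 : b ^ 2 = l := Real.sq_sqrt hl0.le
  have hb0 : 0 < b := Real.sqrt_pos.2 hl0
  have hb1 : 0.83 ≤ b := by
    rw [hb]
    refine Real.le_sqrt_of_sq_le ?_
    norm_num
    linarith
  have hb3 : l ^ (3 / 2 : ℝ) = b ^ 3 := by
    rw [← hb2, ← Real.rpow_natCast, ← Real.rpow_mul hb0.le, ← Real.rpow_natCast]
    norm_num
  rw [hb3]
  by_cases hT : timeLimit φ = 0
  · rw [expect_evoCut_of_timeLimit_eq_zero _ _ hT]
    have h1 : ((1 : ℕ) : ℝ≥0∞) / (vol G [v].toFinset : ℝ≥0∞) ≤ 1 := by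
      refine ENNReal.div_le_of_le_mul ?_
      rw [one_mul]
      have : vol G [v].toFinset = G.degree v := by simp [vol]
      rw [this]
      exact Nat.cast_le.2 hv
    refine h1.trans ?_
    rw [ENNReal.one_le_ofReal]
    have h3 : 0.5 ≤ b ^ 3 := by
      calc (0.5 : ℝ) ≤ 0.83 ^ 3 := by norm_num
        _ ≤ b ^ 3 := by gcongr
    nlinarith
  · refine (expect_work_div_vol_le hv (Nat.pos_of_ne_zero hT)).trans
      (ENNReal.ofReal_le_ofReal ?_)
    have h1 : √(timeLimit φ * Real.log (vol G univ)) ≤ 0.15 * (a * b) := by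
      rw [Real.sqrt_le_left (by positivity)]
      have h2 := timeLimit_le hφ
      have h3 := log_vol_univ_le (G := G) hn
      rw [← ha2] at h2
      calc (timeLimit φ : ℝ) * Real.log (vol G univ) ≤ a ^ 2 / 100 * (2 * l) := by gcongr
        _ ≤ (0.15 * (a * b)) ^ 2 := by
            rw [← hb2]
            have : 0 ≤ a ^ 2 * b ^ 2 := by positivity
            nlinarith
    have h2 := clog_add_one_le hn
    rw [← hl, ← hb2] at h2
    have h3 : 1 ≤ 2 * (a * b) := by nlinarith
    calc ((Nat.clog 2 n + 1 : ℕ) : ℝ) * (60 + 1176 * √(timeLimit φ * Real.log (vol G univ)))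
        ≤ (5 * b ^ 2) * (60 * (2 * (a * b)) + 1176 * (0.15 * (a * b))) := by gcongr; linarith
      _ ≤ 2000 * (a * b ^ 3) := by
          have : 0 ≤ a * b ^ 3 := by positivity
          nlinarith

end Work

/-! ### The local approximation guarantee -/

section Escape

variable {V : Type} [Fintype V] [DecidableEq V] (G : SimpleGraph V) [DecidableRel G.Adj]

/-- The probability that the lazy random walk started from the given vertex leaves `A` within `r`
steps. -/
noncomputable def escape (A : Finset V) : ℕ → V → ℝ≥0∞
  | 0, x => if x ∈ A then 0 else 1
  | r + 1, x => if x ∈ A then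
      ((∑ y ∈ G.neighborFinset x, escape A r y) / (G.degree x : ℝ≥0∞) + escape A r x) / 2 else 1

variable {G} {A : Finset V} {θ : ℝ}

theorem escape_le_one (r : ℕ) (x : V) : escape G A r x ≤ 1 := by
  induction r generalizing x with
  | zero => rw [escape]; split_ifs <;> simp
  | succ r ih =>
      rw [escape]
      split_ifs
      · have h1 : (∑ y ∈ G.neighborFinset x, escape G A r y) / (G.degree x : ℝ≥0∞) ≤ 1 := by
          refine (ENNReal.div_le_div_right (sum_le_sum fun y _ => ih y) _).trans ?_
          rw [sum_const, SimpleGraph.card_neighborFinset_eq_degree, nsmul_eq_mul, mul_one]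
          exact ENNReal.div_self_le_one
        refine (ENNReal.div_le_div_right (add_le_add h1 (ih x)) _).trans ?_
        rw [one_add_one_eq_two]
        exact ENNReal.div_self_le_one
      · exact le_rfl

theorem jointStep_of_position (S : Finset V) (x : V) (e : V → ℝ≥0∞) :
    jointStep G S x (fun _ y => e y) =
      ((∑ y ∈ G.neighborFinset x, e y) / (G.degree x : ℝ≥0∞) + e x) / 2 := by
  simp [jointStep]

theorem jointVal_notMem_le_escape (r : ℕ) (S : Finset V) (x : V) :
    jointVal G θ (fun _ x => if x ∈ A then 0 else 1) r S x ≤ escape G A r x := by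
  induction r generalizing S x with
  | zero => exact le_rfl
  | succ r ih =>
      rw [jointVal]
      split_ifs with hlt hx
      · exact zero_le
      · rw [escape, if_neg hx]
      · refine (jointStep_mono fun S' x' => ih S' x').trans ?_
        by_cases hx : x ∈ A
        · rw [jointStep_of_position, escape, if_pos hx]
        · rw [escape, if_neg hx]
          refine (jointStep_mono fun S' x' => escape_le_one r x').trans ?_
          rw [jointStep_of_position]
          have h1 : (∑ y ∈ G.neighborFinset x, (1 : ℝ≥0∞)) / (G.degree x : ℝ≥0∞) ≤ 1 := by
            rw [sum_const, SimpleGraph.card_neighborFinset_eq_degree, nsmul_eq_mul, mul_one]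
            exact ENNReal.div_self_le_one
          refine (ENNReal.div_le_div_right (add_le_add h1 le_rfl) _).trans ?_
          rw [one_add_one_eq_two]
          exact ENNReal.div_self_le_one

/-- In each step, the walk started from the stationary distribution on `A` leaves `A` with
probability at most `φ(A)`. -/
theorem sum_degree_mul_escape_le (r : ℕ) :
    ∑ x ∈ A, (G.degree x : ℝ≥0∞) * escape G A r x ≤ (r : ℝ≥0∞) * boundary G A := by
  induction r with
  | zero =>
      rw [sum_eq_zero fun x hx => by rw [escape, if_pos hx, mul_zero]]
      exact zero_le
  | succ r ih =>
      set a := ∑ x ∈ A, (G.degree x : ℝ≥0∞) * escape G A r x with ha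
      have h1 : ∀ x ∈ A, (G.degree x : ℝ≥0∞) * escape G A (r + 1) x ≤
          (∑ y, (if G.Adj x y then escape G A r y else 0) +
            (G.degree x : ℝ≥0∞) * escape G A r x) / 2 := by
        intro x hx
        have hs : ∑ y ∈ G.neighborFinset x, escape G A r y =
            ∑ y, if G.Adj x y then escape G A r y else 0 := by
          rw [← sum_filter]
          exact sum_congr (by ext y; simp) fun _ _ => rfl
        rw [escape, if_pos hx, ← mul_div_assoc, mul_add, hs]
        gcongr
        exact ENNReal.mul_div_le
      have h2 : ∑ x ∈ A, ∑ y, (if G.Adj x y then escape G A r y else 0) =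
          ∑ y, (edges G {y} A : ℝ≥0∞) * escape G A r y := by
        rw [sum_comm]
        refine sum_congr rfl fun y _ => ?_
        rw [edges_eq_sum, sum_singleton, Nat.cast_sum, sum_mul]
        refine sum_congr rfl fun x _ => ?_
        by_cases h : G.Adj x y
        · simp [h, h.symm]
        · have h' : ¬ G.Adj y x := fun h' => h h'.symm
          simp [h, h']
      have h3 : ∑ y, (edges G {y} A : ℝ≥0∞) * escape G A r y ≤ a + boundary G A := by
        rw [← sum_add_sum_compl A, boundary_eq_sum_compl, Nat.cast_sum]
        refine add_le_add (sum_le_sum fun y _ => ?_) (sum_le_sum fun y _ => ?_)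
        · gcongr
          exact edges_le_degree G y A
        · exact mul_le_of_le_one_right' (escape_le_one r y)
      calc ∑ x ∈ A, (G.degree x : ℝ≥0∞) * escape G A (r + 1) x
          ≤ ∑ x ∈ A, (∑ y, (if G.Adj x y then escape G A r y else 0) +
            (G.degree x : ℝ≥0∞) * escape G A r x) / 2 := sum_le_sum h1
        _ = (∑ y, (edges G {y} A : ℝ≥0∞) * escape G A r y + a) / 2 := by
            rw [← h2, ha, ← sum_add_distrib]
            simp only [div_eq_mul_inv, sum_mul]
        _ ≤ (a + boundary G A + (a + boundary G A)) / 2 := by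
            gcongr
            exact le_self_add
        _ = a + boundary G A := by
            rw [← two_mul, mul_comm,
              ENNReal.mul_div_cancel_right two_ne_zero ENNReal.ofNat_ne_top]
        _ ≤ (r : ℝ≥0∞) * boundary G A + boundary G A := by gcongr
        _ = _ := by push_cast; ring

variable (G) in
/-- The vertices of `A` of positive degree from which the walk is unlikely to leave `A` within `T`
steps. -/
noncomputable def goodStarts (A : Finset V) (T : ℕ) : Finset V :=
  A.filter fun v => 0 < G.degree v ∧ escape G A T v ≤ ENNReal.ofReal (1 / 50)

/-- The good starting vertices make up half of the volume, by Markov's inequality. -/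
theorem vol_le_two_mul_vol_goodStarts {T : ℕ} (hT : 100 * (T * boundary G A) ≤ vol G A) :
    vol G A ≤ 2 * vol G (goodStarts G A T) := by
  have hsplit : vol G A = vol G (goodStarts G A T) + vol G (A \ goodStarts G A T) := by
    rw [add_comm]
    exact (sum_sdiff (filter_subset _ _)).symm
  have hbad : (vol G (A \ goodStarts G A T) : ℝ≥0∞) ≤ ((50 * (T * boundary G A) : ℕ) : ℝ≥0∞) := by
    have h50 : (50 : ℝ≥0∞) * ENNReal.ofReal (1 / 50) = 1 := by
      rw [← ENNReal.ofReal_ofNat 50, ← ENNReal.ofReal_mul (by norm_num)]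
      norm_num
    calc (vol G (A \ goodStarts G A T) : ℝ≥0∞)
        = ∑ x ∈ A \ goodStarts G A T, (G.degree x : ℝ≥0∞) := natCast_vol _
      _ ≤ ∑ x ∈ A \ goodStarts G A T, 50 * ((G.degree x : ℝ≥0∞) * escape G A T x) := by
          refine sum_le_sum fun x hx => ?_
          rw [mem_sdiff, goodStarts, mem_filter] at hx
          rcases Nat.eq_zero_or_pos (G.degree x) with h0 | h0
          · simp [h0]
          · have h1 : ENNReal.ofReal (1 / 50) ≤ escape G A T x := by
              by_contra h
              exact hx.2 ⟨hx.1, h0, (not_le.1 h).le⟩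
            calc (G.degree x : ℝ≥0∞) = (G.degree x : ℝ≥0∞) * (50 * ENNReal.ofReal (1 / 50)) := by
                  rw [h50, mul_one]
              _ ≤ (G.degree x : ℝ≥0∞) * (50 * escape G A T x) := by gcongr
              _ = _ := mul_left_comm _ _ _
      _ ≤ ∑ x ∈ A, 50 * ((G.degree x : ℝ≥0∞) * escape G A T x) :=
          sum_le_sum_of_subset sdiff_subset
      _ ≤ 50 * ((T : ℝ≥0∞) * boundary G A) := by
          rw [← mul_sum]
          gcongr
          exact sum_degree_mul_escape_le T
      _ = _ := by push_cast; ring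
  rw [Nat.cast_le] at hbad
  omega

/-- Since the particle is distributed proportionally to the degrees on the stopped set, a set of
which a large part lies outside `A` is as unlikely as an escape of the walk. -/
theorem stopVal_overlap_le {v : V} (hv : 0 < G.degree v) (T : ℕ) :
    stopVal G θ (fun S => if 9 / 10 * (vol G S : ℝ) ≤ (vol G (S ∩ A) : ℝ) then 0 else 1) T {v} ≤
      10 * escape G A T v := by
  refine le_trans (stopVal_mono (fun S => ?_) T {v}) ((stopVal_const_mul 10
    (fun S => (∑ x ∈ S, (G.degree x : ℝ≥0∞) * if x ∈ A then 0 else 1) / (vol G S : ℝ≥0∞))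
    T {v}).trans_le ?_)
  · split_ifs with h
    · exact zero_le
    · have h1 : ∑ x ∈ S, (G.degree x : ℝ≥0∞) * (if x ∈ A then 0 else 1) =
          (vol G (S \ A) : ℝ≥0∞) := by
        rw [natCast_vol, sdiff_eq_filter, sum_filter]
        refine sum_congr rfl fun x _ => ?_
        split_ifs <;> simp_all
      have h2 : vol G S = vol G (S ∩ A) + vol G (S \ A) := (sum_inter_add_sum_sdiff S A _).symm
      have h2' : (vol G S : ℝ) = vol G (S ∩ A) + vol G (S \ A) := by exact_mod_cast h2
      have h3 : vol G S ≤ 10 * vol G (S \ A) := by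
        have : (vol G S : ℝ) ≤ 10 * vol G (S \ A) := by linarith
        exact_mod_cast this
      have h4 : (vol G S : ℝ≥0∞) ≠ 0 := by
        intro h0
        have h0 : vol G S = 0 := by exact_mod_cast h0
        rw [h0] at h
        simp at h
      rw [h1, ← mul_div_assoc, ENNReal.le_div_iff_mul_le (Or.inl h4)
        (Or.inl (ENNReal.natCast_ne_top _)), one_mul]
      exact_mod_cast h3
  · gcongr
    rw [← jointVal_singleton (fun _ x => if x ∈ A then 0 else 1) T hv]
    exact jointVal_notMem_le_escape T {v} v

/-- The exponential supermartingale bound: it is unlikely that all of the sets `S_0, …, S_r` have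
conductance at least `θ`. The parameter `κ` is a lower bound for such conductances. -/
theorem stopVal_conductance_le {κ : ℝ} (hκ0 : 0 ≤ κ)
    (hκ : ∀ S : Finset V, θ ≤ conductance G S → κ ≤ conductance G S) (r : ℕ) {S : Finset V}
    (hS : 0 < vol G S) :
    stopVal G θ (fun S => if θ ≤ conductance G S then 1 else 0) r S ≤
      ENNReal.ofReal (((vol G univ : ℝ) ^ (1 / 3 : ℝ) * Real.exp (-(κ ^ 2 / 9)) ^ r) *
        (vol G S : ℝ) ^ (-(1 / 3) : ℝ)) := by
  set ρ := Real.exp (-(κ ^ 2 / 9)) with hρ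
  have hρ0 : 0 < ρ := Real.exp_pos _
  induction r generalizing S with
  | zero =>
      have h1 : (1 : ℝ≥0∞) ≤ ENNReal.ofReal (((vol G univ : ℝ) ^ (1 / 3 : ℝ) * ρ ^ 0) *
          (vol G S : ℝ) ^ (-(1 / 3) : ℝ)) := by
        have h0 : 0 < (vol G S : ℝ) := by exact_mod_cast hS
        rw [ENNReal.one_le_ofReal, pow_zero, mul_one, Real.rpow_neg h0.le, ← div_eq_mul_inv,
          one_le_div (by positivity)]
        exact Real.rpow_le_rpow h0.le (Nat.cast_le.2 (vol_mono G (subset_univ S))) (by norm_num)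
      rw [stopVal]
      split_ifs
      · exact h1
      · exact zero_le
  | succ r ih =>
      rw [stopVal]
      split_ifs with hlt hle
      · exact absurd hlt (not_lt.2 hle)
      · exact zero_le
      · have hle := not_lt.1 hlt
        set c := (vol G univ : ℝ) ^ (1 / 3 : ℝ) * ρ ^ r with hc
        have hc0 : 0 ≤ c := by positivity
        calc ∑ S' : Finset V, biasedKernel G S S' *
              stopVal G θ (fun S => if θ ≤ conductance G S then 1 else 0) r S'
            ≤ ∑ S' : Finset V, ENNReal.ofReal c *
                (biasedKernel G S S' * ENNReal.ofReal ((vol G S' : ℝ) ^ (-(1 / 3) : ℝ))) := by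
              refine sum_le_sum fun S' _ => ?_
              rcases eq_or_ne (biasedKernel G S S') 0 with h | h
              · rw [h, zero_mul, zero_mul, mul_zero]
              · rw [mul_left_comm, ← ENNReal.ofReal_mul hc0]
                gcongr
                exact ih (vol_pos_of_biasedKernel_ne_zero h)
          _ ≤ ENNReal.ofReal c *
                ENNReal.ofReal ((vol G S : ℝ) ^ (-(1 / 3) : ℝ) * (1 - conductance G S ^ 2 / 9)) := by
              rw [← mul_sum]
              gcongr
              exact sum_biasedKernel_mul_rpow_le hS
          _ ≤ _ := by
              rw [← ENNReal.ofReal_mul hc0]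
              refine ENNReal.ofReal_le_ofReal ?_
              have h1 : 1 - conductance G S ^ 2 / 9 ≤ ρ := by
                have h2 := Real.add_one_le_exp (-(κ ^ 2 / 9))
                have h3 : κ ^ 2 ≤ conductance G S ^ 2 := by
                  have := hκ S hle
                  gcongr
                linarith
              calc c * ((vol G S : ℝ) ^ (-(1 / 3) : ℝ) * (1 - conductance G S ^ 2 / 9))
                  ≤ c * ((vol G S : ℝ) ^ (-(1 / 3) : ℝ) * ρ) := by gcongr
                _ = _ := by rw [hc, pow_succ]; ring

end Escape

section Guarantee

variable {n : ℕ} {G : SimpleGraph (Fin n)} [DecidableRel G.Adj]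

/-- For large `μ(V)`, the conductances of an unstopped run are at least `θ_T`, which makes it
unlikely by a power of `μ(V)`. For bounded `μ(V)`, they are bounded below by `1 / μ(V)`, and it
suffices that `T` is large. -/
theorem stopVal_threshold_le {v : Fin n} (hv : 0 < G.degree v) {T : ℕ} (hT : 10 ^ 16 ≤ T) :
    stopVal G (threshold (vol G univ) T)
      (fun S => if threshold (vol G univ) T ≤ conductance G S then 1 else 0) T {v} ≤
      ENNReal.ofReal (3 / 10) := by
  set m := vol G univ with hm
  set θ := threshold m T with hθ
  have hm2 : 2 ≤ m := two_le_vol_univ hv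
  have hm0 : (0 : ℝ) < m := by exact_mod_cast (by omega : 0 < m)
  have hT0 : (0 : ℝ) < T := by exact_mod_cast (by omega : 0 < T)
  have hθ0 : 0 < θ := threshold_pos hm2 (by omega)
  have hvol : vol G {v} = G.degree v := by simp [vol]
  have hd : (G.degree v : ℝ) ^ (-(1 / 3) : ℝ) ≤ 1 :=
    Real.rpow_le_one_of_one_le_of_nonpos (by exact_mod_cast hv) (by norm_num)
  have hmain : ∀ κ : ℝ, 0 ≤ κ →
      (∀ S : Finset (Fin n), θ ≤ conductance G S → κ ≤ conductance G S) →
      (m : ℝ) ^ (1 / 3 : ℝ) * Real.exp (-(κ ^ 2 / 9)) ^ T ≤ 3 / 10 →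
      stopVal G θ (fun S => if θ ≤ conductance G S then 1 else 0) T {v} ≤
        ENNReal.ofReal (3 / 10) := by
    intro κ h1 h2 h3
    refine (stopVal_conductance_le h1 h2 T (S := {v}) (by rw [hvol]; exact hv)).trans
      (ENNReal.ofReal_le_ofReal ?_)
    rw [hvol]
    refine le_trans (mul_le_of_le_one_right (by positivity) hd) h3
  by_cases hmM : 60000 ≤ m
  · refine hmain θ hθ0.le (fun _ h => h) ?_
    have hlog : 0 < Real.log m := Real.log_pos (by exact_mod_cast (by omega : 1 < m))
    have h1 : θ ^ 2 = 4 * (T : ℝ)⁻¹ * Real.log m := Real.sq_sqrt (by positivity)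
    have h2 : (m : ℝ) ^ (1 / 3 : ℝ) * Real.exp (-(θ ^ 2 / 9)) ^ T = ((m : ℝ) ^ (1 / 9 : ℝ))⁻¹ := by
      rw [← Real.exp_nat_mul, Real.rpow_def_of_pos hm0, Real.rpow_def_of_pos hm0, ← Real.exp_neg,
        ← Real.exp_add, h1]
      congr 1
      field_simp
      ring
    have h3 : (10 / 3 : ℝ) ≤ (m : ℝ) ^ (1 / 9 : ℝ) := by
      have h4 : (10 / 3 : ℝ) = ((10 / 3 : ℝ) ^ 9) ^ (1 / 9 : ℝ) := by
        rw [← Real.rpow_natCast, ← Real.rpow_mul (by norm_num)]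
        norm_num
      rw [h4]
      refine Real.rpow_le_rpow (by positivity) ?_ (by norm_num)
      have : (60000 : ℝ) ≤ m := by exact_mod_cast hmM
      refine le_trans ?_ this
      norm_num
    rw [h2]
    calc ((m : ℝ) ^ (1 / 9 : ℝ))⁻¹ ≤ (10 / 3 : ℝ)⁻¹ := inv_anti₀ (by norm_num) h3
      _ = 3 / 10 := by norm_num
  · refine hmain (1 / m) (by positivity) (fun S hS => ?_) ?_
    · have hb : 0 < boundary G S := by
        rcases Nat.eq_zero_or_pos (boundary G S) with h0 | h0
        · simp only [conductance, h0, Nat.cast_zero, zero_div] at hS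
          linarith
        · exact h0
      have hv0 : 0 < vol G S := hb.trans_le (boundary_le_vol G S)
      have h1 : (1 : ℝ) ≤ boundary G S := by exact_mod_cast hb
      have h2 : (vol G S : ℝ) ≤ m := Nat.cast_le.2 (vol_mono G (subset_univ S))
      have h3 : (0 : ℝ) < vol G S := by exact_mod_cast hv0
      exact div_le_div₀ (by positivity) h1 h3 h2
    · have hmM' : (m : ℝ) ≤ 60000 := by exact_mod_cast (not_le.1 hmM).le
      have hm1 : (1 : ℝ) ≤ m := by exact_mod_cast (by omega : 1 ≤ m)
      have h1 : (m : ℝ) ^ (1 / 3 : ℝ) ≤ m := by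
        conv_rhs => rw [← Real.rpow_one (m : ℝ)]
        exact Real.rpow_le_rpow_of_exponent_le hm1 (by norm_num)
      have hT' : (10 : ℝ) ^ 16 ≤ T := by exact_mod_cast hT
      have h2 : (300000 : ℝ) ≤ T * ((1 / m) ^ 2 / 9) := by
        have h3 : (1 / 60000 : ℝ) ≤ 1 / m := one_div_le_one_div_of_le hm0 hmM'
        calc (300000 : ℝ) ≤ 10 ^ 16 * ((1 / 60000) ^ 2 / 9) := by norm_num
          _ ≤ T * ((1 / m) ^ 2 / 9) := by gcongr
      have h4 : Real.exp (-((1 / (m : ℝ)) ^ 2 / 9)) ^ T ≤ 1 / 300000 := by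
        rw [← Real.exp_nat_mul, mul_neg, Real.exp_neg, one_div 300000]
        refine inv_anti₀ (by norm_num) ?_
        have := Real.add_one_le_exp (T * ((1 / (m : ℝ)) ^ 2 / 9))
        linarith
      calc (m : ℝ) ^ (1 / 3 : ℝ) * Real.exp (-((1 / (m : ℝ)) ^ 2 / 9)) ^ T
          ≤ 60000 * (1 / 300000) := by gcongr; exact h1.trans hmM'
        _ ≤ 3 / 10 := by norm_num

theorem inv_div_le_timeLimit {φ : ℝ} (hT : 0 < timeLimit φ) : φ⁻¹ / 200 ≤ timeLimit φ := by
  have h1 : φ⁻¹ / 100 < timeLimit φ + 1 := Nat.lt_floor_add_one _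
  have h2 : (1 : ℝ) ≤ timeLimit φ := by exact_mod_cast hT
  linarith

theorem threshold_le {φ : ℝ} (hφ : 0 < φ) (hn : 2 ≤ n) (hT : 0 < timeLimit φ) :
    threshold (vol G univ) (timeLimit φ) ≤
      40 * (φ ^ (1 / 2 : ℝ) * Real.log (n : ℝ) ^ (1 / 2 : ℝ)) := by
  have hl : 0 < Real.log n := Real.log_pos (by exact_mod_cast (by omega : 1 < n))
  have hT0 : (0 : ℝ) < timeLimit φ := by exact_mod_cast hT
  rw [← Real.sqrt_eq_rpow, ← Real.sqrt_eq_rpow, ← Real.sqrt_mul hφ.le, threshold]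
  have h40 : (40 : ℝ) = √(40 ^ 2) := by rw [Real.sqrt_sq (by norm_num)]
  rw [h40, ← Real.sqrt_mul (by norm_num)]
  refine Real.sqrt_le_sqrt ?_
  have h1 := inv_div_le_timeLimit hT
  have h2 : (timeLimit φ : ℝ)⁻¹ ≤ 200 * φ := by
    rw [inv_le_comm₀ hT0 (by positivity), mul_inv]
    linarith
  have h3 := log_vol_univ_le (G := G) hn
  calc 4 * (timeLimit φ : ℝ)⁻¹ * Real.log (vol G univ)
      ≤ 4 * (200 * φ) * (2 * Real.log n) := by gcongr
    _ = 40 ^ 2 * (φ * Real.log n) := by ring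

theorem stopVal_not_conductance_le {v : Fin n} (hv : 0 < G.degree v) {φ : ℝ} (hφ : 0 < φ) :
    stopVal G (threshold (vol G univ) (timeLimit φ))
      (fun S => if conductance G S ≤ 10 ^ 10 * (φ ^ (1 / 2 : ℝ) * Real.log (n : ℝ) ^ (1 / 2 : ℝ))
        then 0 else 1) (timeLimit φ) {v} ≤ ENNReal.ofReal (3 / 10) := by
  have hn := two_le_of_degree_pos hv
  have hlog2 := Real.log_two_gt_d9
  have hlogn : Real.log 2 ≤ Real.log n := Real.log_le_log (by norm_num) (by exact_mod_cast hn)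
  have hl0 : 0 < Real.log n := by linarith
  by_cases hsmall : φ ≤ 1 / 10 ^ 19
  · -- here the time limit is large
    have hinv : (10 : ℝ) ^ 19 ≤ φ⁻¹ := by
      rw [le_inv_comm₀ (by norm_num) hφ, ← one_div]
      exact hsmall
    have hT : 10 ^ 16 ≤ timeLimit φ := by
      refine Nat.le_floor ?_
      push_cast
      linarith
    refine le_trans (stopVal_mono (fun S => ?_) _ _) (stopVal_threshold_le hv hT)
    have h1 := threshold_le (G := G) hφ hn (by omega)
    have h2 : 0 ≤ φ ^ (1 / 2 : ℝ) * Real.log (n : ℝ) ^ (1 / 2 : ℝ) := by positivity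
    split_ifs with h3 h4 h4
    · exact zero_le
    · exact le_rfl
    · exact le_rfl
    · exact absurd ((not_le.1 h4).le.trans (h1.trans (by linarith))) h3
  · -- here the bound on the conductance is trivial
    have h1 : (1 : ℝ) ≤ 10 ^ 10 * (φ ^ (1 / 2 : ℝ) * Real.log (n : ℝ) ^ (1 / 2 : ℝ)) := by
      rw [← Real.sqrt_eq_rpow, ← Real.sqrt_eq_rpow, ← Real.sqrt_mul hφ.le]
      have h2 : (1 / 10 ^ 10 : ℝ) ≤ √(φ * Real.log n) := by
        refine Real.le_sqrt_of_sq_le ?_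
        have h3 : (1 / 10 ^ 19 : ℝ) * 0.69 ≤ φ * Real.log n := by
          gcongr
          · exact (not_le.1 hsmall).le
          · linarith
        refine le_trans ?_ h3
        norm_num
      linarith
    refine le_trans (stopVal_mono (g' := fun S => 0 * 1) (fun S => ?_) _ _) ?_
    · rw [if_pos ((conductance_le_one S).trans h1), zero_mul]
    · rw [stopVal_const_mul 0 fun _ => 1, zero_mul]
      exact zero_le

theorem boundary_mul_timeLimit_le {φ : ℝ} (hφ : 0 < φ) {A : Finset (Fin n)}
    (hA : conductance G A ≤ φ) : 100 * (timeLimit φ * boundary G A) ≤ vol G A := by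
  rcases Nat.eq_zero_or_pos (vol G A) with h0 | h0
  · have := boundary_le_vol G A
    have h1 : boundary G A = 0 := by omega
    simp [h1]
  · have h1 : (0 : ℝ) < vol G A := by exact_mod_cast h0
    rw [conductance, div_le_iff₀ h1] at hA
    have h2 := timeLimit_le hφ
    have h3 : (100 : ℝ) * (timeLimit φ * boundary G A) ≤ vol G A := by
      calc (100 : ℝ) * (timeLimit φ * boundary G A)
          ≤ 100 * (φ⁻¹ / 100 * (φ * vol G A)) := by gcongr
        _ = vol G A := by field_simp
    exact_mod_cast h3

theorem prob_evoCut_eq_stopVal (volV : ℕ) {v : Fin n} (hv : 0 < G.degree v) (φ : ℝ)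
    (P : Finset (Fin n) → Prop) [DecidablePred P] :
    (evoCut volV v φ).prob G (fun l => P l.toFinset) =
      stopVal G (threshold volV (timeLimit φ)) (fun S => if P S then 1 else 0)
        (timeLimit φ) {v} := by
  rw [← expect_evoCut_eq_stopVal volV hv φ, Prog.prob]
  congr 1
  funext l _
  by_cases h : P l.toFinset <;> simp [Set.indicator, h]

theorem half_le_prob_of_mem_goodStarts {φ : ℝ} (hφ : 0 < φ) {A : Finset (Fin n)}
    (hA : (vol G A : ℝ) ≤ 2 / 3 * (vol G univ : ℝ)) {v : Fin n}
    (hv : v ∈ goodStarts G A (timeLimit φ)) :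
    1 / 2 ≤ (evoCut (vol G univ) v φ).prob G (fun l =>
      conductance G l.toFinset ≤
        10 ^ 10 * (φ ^ (1 / 2 : ℝ) * Real.log (n : ℝ) ^ (1 / 2 : ℝ)) ∧
      (vol G l.toFinset : ℝ) ≤ 3 / 4 * (vol G univ : ℝ) ∧
      9 / 10 * (vol G l.toFinset : ℝ) ≤ (vol G (l.toFinset ∩ A) : ℝ)) := by
  classical
  obtain ⟨-, hd, hesc⟩ := mem_filter.1 hv
  set c := 10 ^ 10 * (φ ^ (1 / 2 : ℝ) * Real.log (n : ℝ) ^ (1 / 2 : ℝ)) with hc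
  rw [prob_evoCut_eq_stopVal (vol G univ) hd φ fun S => conductance G S ≤ c ∧
      (vol G S : ℝ) ≤ 3 / 4 * (vol G univ : ℝ) ∧ 9 / 10 * (vol G S : ℝ) ≤ (vol G (S ∩ A) : ℝ)]
  set T := timeLimit φ
  set θ := threshold (vol G univ) T
  set p := stopVal G θ (fun S => if conductance G S ≤ c ∧
      (vol G S : ℝ) ≤ 3 / 4 * (vol G univ : ℝ) ∧ 9 / 10 * (vol G S : ℝ) ≤ (vol G (S ∩ A) : ℝ)
      then 1 else 0) T {v} with hp
  have h1 : 1 ≤ p + (stopVal G θ (fun S => if conductance G S ≤ c then 0 else 1) T {v} +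
      stopVal G θ (fun S => if 9 / 10 * (vol G S : ℝ) ≤ (vol G (S ∩ A) : ℝ) then 0 else 1)
        T {v}) := by
    rw [hp, ← stopVal_add, ← stopVal_add]
    refine (stopVal_one (θ := θ) T (S := {v}) (by simpa [vol])).symm.trans_le ?_
    refine stopVal_mono (fun S => ?_) T {v}
    by_cases ha : conductance G S ≤ c
    · by_cases hov : 9 / 10 * (vol G S : ℝ) ≤ (vol G (S ∩ A) : ℝ)
      · have hle : (vol G (S ∩ A) : ℝ) ≤ vol G A := Nat.cast_le.2 (vol_mono G inter_subset_right)
        have hb : (vol G S : ℝ) ≤ 3 / 4 * (vol G univ : ℝ) := by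
          have : (0 : ℝ) ≤ vol G univ := by positivity
          linarith
        simp [ha, hov, hb]
      · simp [hov]
    · simp [ha]
  have h2 := stopVal_not_conductance_le hd hφ
  have h3 : stopVal G θ (fun S => if 9 / 10 * (vol G S : ℝ) ≤ (vol G (S ∩ A) : ℝ) then 0 else 1)
      T {v} ≤ ENNReal.ofReal (1 / 5) := by
    refine (stopVal_overlap_le hd T).trans ?_
    calc 10 * escape G A T v ≤ 10 * ENNReal.ofReal (1 / 50) := by gcongr
      _ = ENNReal.ofReal (1 / 5) := by
          rw [← ENNReal.ofReal_ofNat 10, ← ENNReal.ofReal_mul (by norm_num)]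
          norm_num
  have h4 : (1 : ℝ≥0∞) ≤ p + 1 / 2 := by
    refine h1.trans (add_le_add le_rfl ((add_le_add h2 h3).trans_eq ?_))
    rw [← ENNReal.ofReal_add (by norm_num) (by norm_num)]
    norm_num [ENNReal.ofReal_div_of_pos]
  exact (ENNReal.add_le_add_iff_right (ENNReal.div_ne_top ENNReal.one_ne_top two_ne_zero)).1
    ((ENNReal.add_halves 1).trans_le h4)

end Guarantee

end EvoCut

theorem theorem1 :
    -- the output is distributed as the stopped volume-biased evolving set process
    (∀ (n : ℕ) (G : SimpleGraph (Fin n)) [DecidableRel G.Adj] (v : Fin n) (φ : ℝ),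
      0 < G.degree v → 0 < φ → φ < 1 →
      ∀ R : Finset (Fin n),
        (EvoCut.evoCut (EvoCut.vol G Finset.univ) v φ).prob G (fun l => l.toFinset = R) =
          EvoCut.stoppedProb G v (EvoCut.timeLimit φ)
            (EvoCut.threshold (EvoCut.vol G Finset.univ) (EvoCut.timeLimit φ)) R) ∧
    -- the expected work/volume ratio
    (∃ C : ℝ, 0 < C ∧
      ∀ (n : ℕ) (G : SimpleGraph (Fin n)) [DecidableRel G.Adj] (v : Fin n) (φ : ℝ),
        0 < G.degree v → 0 < φ → φ < 1 →
        (EvoCut.evoCut (EvoCut.vol G Finset.univ) v φ).expect G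
            (fun l w => (w : ENNReal) / (EvoCut.vol G l.toFinset : ENNReal)) ≤
          ENNReal.ofReal (C * (φ ^ (-(1 / 2) : ℝ) * Real.log (n : ℝ) ^ (3 / 2 : ℝ)))) ∧
    -- the local approximation guarantee
    (∃ C : ℝ, 0 < C ∧
      ∀ (n : ℕ) (G : SimpleGraph (Fin n)) [DecidableRel G.Adj] (φ : ℝ), 0 < φ → φ < 1 →
      ∀ A : Finset (Fin n), EvoCut.conductance G A ≤ φ →
        (EvoCut.vol G A : ℝ) ≤ 2 / 3 * (EvoCut.vol G Finset.univ : ℝ) →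
        ∃ A' : Finset (Fin n), A' ⊆ A ∧ (EvoCut.vol G A : ℝ) / 2 ≤ (EvoCut.vol G A' : ℝ) ∧
          ∀ v ∈ A',
            1 / 2 ≤ (EvoCut.evoCut (EvoCut.vol G Finset.univ) v φ).prob G (fun l =>
              EvoCut.conductance G l.toFinset ≤
                C * (φ ^ (1 / 2 : ℝ) * Real.log (n : ℝ) ^ (1 / 2 : ℝ)) ∧
              (EvoCut.vol G l.toFinset : ℝ) ≤ 3 / 4 * (EvoCut.vol G Finset.univ : ℝ) ∧
              9 / 10 * (EvoCut.vol G l.toFinset : ℝ) ≤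
                (EvoCut.vol G (l.toFinset ∩ A) : ℝ))) := by
  refine ⟨fun n G _ v φ hv _ _ R => ?_, ⟨2000, by norm_num, fun n G _ v φ hv hφ hφ1 =>
    EvoCut.expect_work_div_vol_le_rpow hv hφ hφ1⟩, ⟨10 ^ 10, by norm_num,
    fun n G _ φ hφ _ A hA hA' => ⟨EvoCut.goodStarts G A (EvoCut.timeLimit φ),
      filter_subset _ _, ?_, fun v hv => EvoCut.half_le_prob_of_mem_goodStarts hφ hA' hv⟩⟩⟩
  · rw [EvoCut.stoppedProb_eq_stopVal hv]
    exact EvoCut.prob_evoCut_eq_stopVal _ hv φ fun S => S = R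
  · have h := EvoCut.vol_le_two_mul_vol_goodStarts (EvoCut.boundary_mul_timeLimit_le hφ hA)
    have h' : (EvoCut.vol G A : ℝ) ≤
        2 * (EvoCut.vol G (EvoCut.goodStarts G A (EvoCut.timeLimit φ)) : ℝ) := by
      exact_mod_cast h
    linarith
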